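/- Let $r\ge 0$, $n\ge 1$, let $W=S_{r+1}$ be the Weyl group of type $A_r$ with simple reflections $\sigma_1,\dots,\sigma_r$, length function $\ell$ and Bruhat order $\le$, acting on $\Lambda=\mathbb Z^{r+1}$ by permuting coordinates, and let $\mathbf x^{\mu}=x_1^{\mu_1}\cdots x_{r+1}^{\mu_{r+1}}$, $\mathbf x^{\alpha_i}=x_i/x_{i+1}$ in $\mathcal K=\mathbb C(x_1,\dots,x_{r+1})$. **Parameters.** Let $v\ne 0$ and $g_0,\dots,g_{n-1}$ be complex numbers with $g_0=-1$ and $g_ig_{n-i}=v^{-1}$ for $0<i<n$; extend $g$ to $\mathbb Z$ with period $n$, and put $g^\flat(a)=v\,g_a$, and $h^\flat(a)=1-v$ if $n\mid a$, $h^\flat(a)=0$ otherwise. (In particular one may take $v=q^{-1}$ and the Gauss sums $g_i=\sum_{b\in k}\chi(b)^i\psi(b)$, where $k$ is a finite field with $q\equiv 1 \bmod 2n$ elements, $\chi$ a multiplicative character of $k$ of order $n$, e.g. the $n$-th power residue symbol modulo a prime, and $\psi$ a nontrivial additive character.) **Operators.** Let $\Lambda_0=\{\mu\in\Lambda:\mu_i\equiv\mu_j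 \bmod n \text{ for all } i,j\}$. For $\lambda\in\Lambda$ let $\mathcal K_{\bar\lambda}$ be the space of $f\in\mathcal K$ with $\xi(f)=\xi(\lambda)f$ for all characters $\xi$ of $\Lambda/\Lambda_0$, acting on $\mathcal K$ by the field automorphisms with $\xi(\mathbf x^\mu)=\xi(\mu)\mathbf x^\mu$; then $\mathcal K=\bigoplus_{\bar\lambda\in\Lambda/\Lambda_0}\mathcal K_{\bar\lambda}$. The metaplectic (Chinta–Gunnells) operator $\sigma_i(\cdot)$ is the additive map on $\mathcal K$ given for $f\in\mathcal K_{\bar\lambda}$ by $$\sigma_i(f)=\frac{\sigma_i.f}{1-v\mathbf x^{n\alpha_i}}\Big[(1-v)\,\mathbf x^{-r_n(\lambda_{i+1}-\lambda_i)\alpha_i}-v\,g_{1+\lambda_{i+1}-\lambda_i}\,\mathbf x^{(1-n)\alpha_i}(1-\mathbf x^{n\alpha_i})\Big],$$ where $\sigma_i.f$ is $f$ with $x_i,x_{i+1}$ interchanged and $0\le r_n(j)<n$ is the remainder of $j$ modulo $n$. Put $$\mathcal T_i(f)=(1-v\mathbf x^{n\alpha_i})\frac{f-\mathbf x^{n\alpha_i}\sigma_i(f)}{1-\mathbf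 x^{n\alpha_i}}-f,\qquad \mathcal T_u=\mathcal T_{i_1}\cdots\mathcal T_{i_m}$$ for a reduced expression $u=\sigma_{i_1}\cdots\sigma_{i_m}$ in $W$ (the operator does not depend on the choice of the reduced expression). **Crystals.** Fix the long word $w_0=\sigma_1\,\sigma_2\sigma_1\cdots\sigma_r\cdots\sigma_1=\sigma_{\Omega_1}\cdots\sigma_{\Omega_N}$, $N=\binom{r+1}2$. Let $\mu$ be a dominant effective weight ($\mu_1\ge\dots\ge\mu_{r+1}\ge0$) and $\mathcal C_\mu$ the type $A_r$ crystal of highest weight $\mu$, with Kashiwara operators $f_i$, $\varphi_i(b)=\max\{k: f_i^kb\neq0\}$ and weight function $\mathrm{wt}$. For $b\in\mathcal C_\mu$ put $b^{(0)}=b$, and for $m=1,\dots,N$ put $b_m(b)=\varphi_{\Omega_m}(b^{(m-1)})$, $b^{(m)}=f_{\Omega_m}^{b_m(b)}b^{(m-1)}$. Let $BZL(b)$ be the triangular array whose $i$-th row ($1\le i\le r$), in columns $j=i,\dots,r$, is $b_{\binom{r-i+1}2+1}(b),\dots,b_{\binom{r-i+2}2}(b)$. If $w=\sigma_{\Omega_1}\cdots\sigma_{\Omega_l}$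 with $0\le l\le N$ is a beginning section of the long word, the Demazure crystal is $$\mathcal C_\mu^{(w)}=\{b\in\mathcal C_\mu : b_m(b)=0\text{ for all }m>\ell(w)\}.$$ **Gelfand–Tsetlin coefficients.** A Gelfand–Tsetlin pattern with top row $\mu$ is an array of nonnegative integers $a_{ij}$ ($0\le i\le j\le r$) with $a_{0j}=\mu_{j+1}$ and $a_{i-1,j-1}\ge a_{ij}\ge a_{i-1,j}$ for $1\le i\le j\le r$. Put $\Gamma_{ij}=\sum_{k=j}^r(a_{ik}-a_{i-1,k})$ for $1\le i\le j\le r$, and $\Gamma_{i,r+1}=0$. For $b\in\mathcal C_\mu$ there is exactly one such pattern with $(\Gamma_{ij})=BZL(b)$, and $G^{(n,\mu)}(b)=\prod_{1\le i\le j\le r}g_{ij}$, where, with $M_{ij}=\Gamma_{i,j+1}+a_{i-1,j-1}-a_{i-1,j}$, $$g_{ij}=\begin{cases}1&\Gamma_{i,j+1}=\Gamma_{ij}<M_{ij},\\ h^\flat(\Gamma_{ij})&\Gamma_{i,j+1}<\Gamma_{ij}<M_{ij},\\ g^\flat(\Gamma_{ij})&\Gamma_{i,j+1}<\Gamma_{ij}=M_{ij},\\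 0&\Gamma_{i,j+1}=\Gamma_{ij}=M_{ij}.\end{cases}$$ **Theorem.** Let $\lambda=(\lambda_1,\dots,\lambda_{r+1})$ be a dominant effective weight, $\rho=(r,r-1,\dots,1,0)$, and $w$ a beginning section of the long word. Then $$\Big(\sum_{u\le w}\mathcal T_u\Big)\mathbf x^{w_0\lambda}=\mathbf x^{-w_0\rho}\sum_{b\in\mathcal C^{(w)}_{\lambda+\rho}}G^{(n,\lambda+\rho)}(b)\,\mathbf x^{\mathrm{wt}(b)}.$$ -/

import Mathlib

noncomputable section

namespace Metaplectic

/-! ### The Weyl group of type `A_r`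

Indices are zero-based: `i : Fin r` stands for the simple root `α_{i+1} = e_{i+1} - e_{i+2}`. -/

/-- The Weyl group of type `A_r`. -/
abbrev Weyl (r : ℕ) := Equiv.Perm (Fin (r + 1))

/-- The weight lattice `ℤ^{r+1}`. -/
abbrev Weight (r : ℕ) := Fin (r + 1) → ℤ

variable {r : ℕ}

def simpleReflection (i : Fin r) : Weyl r := Equiv.swap i.castSucc i.succ

/-- The Weyl group element spelled by a word in the simple reflections. -/
def wordProd (l : List (Fin r)) : Weyl r := (l.map simpleReflection).prod

theorem exists_wordProd_eq (w : Weyl r) : ∃ l : List (Fin r), wordProd l = w := by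
  have hw : w ∈ Submonoid.closure (Set.range fun i : Fin r ↦ simpleReflection i) := by
    have h := Equiv.Perm.mclosure_swap_castSucc_succ r
    unfold simpleReflection
    rw [h]; trivial
  obtain ⟨m, hm, rfl⟩ := Submonoid.exists_list_of_mem_closure hw
  clear hw
  induction m with
  | nil => exact ⟨[], rfl⟩
  | cons a m ih =>
    obtain ⟨l, hl⟩ := ih fun y hy ↦ hm y (List.mem_cons_of_mem _ hy)
    obtain ⟨i, hi⟩ := hm a List.mem_cons_self
    refine ⟨i :: l, ?_⟩
    simp only [wordProd, List.map_cons, List.prod_cons] at hl ⊢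
    rw [hl, ← hi]

/-- Length with respect to the simple reflections. -/
def len (w : Weyl r) : ℕ := sInf {k | ∃ l : List (Fin r), wordProd l = w ∧ l.length = k}

def IsReducedWord (l : List (Fin r)) (w : Weyl r) : Prop :=
  wordProd l = w ∧ l.length = len w

theorem exists_isReducedWord (w : Weyl r) : ∃ l : List (Fin r), IsReducedWord l w := by
  obtain ⟨l, hl⟩ := exists_wordProd_eq w
  exact Nat.sInf_mem (s := {k | ∃ l : List (Fin r), wordProd l = w ∧ l.length = k})
    ⟨l.length, l, hl, rfl⟩

/-- A reduced word of `w`. -/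
def reducedWord (w : Weyl r) : List (Fin r) := (exists_isReducedWord w).choose

/-- The Bruhat order: generated by `x < x t` for reflections `t` that increase the length. -/
def BruhatLE (u w : Weyl r) : Prop :=
  Relation.ReflTransGen
    (fun x y : Weyl r ↦ (∃ a b : Fin (r + 1), a ≠ b ∧ y = x * Equiv.swap a b) ∧ len x < len y) u w

open Classical in
/-- The finite set of all `u ≤ w`. -/
def bruhatInterval (w : Weyl r) : Finset (Weyl r) := Finset.univ.filter fun u ↦ BruhatLE u w

/-- The word `σ₁ σ₂σ₁ σ₃σ₂σ₁ ⋯ σ_r⋯σ₁`. -/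
def longWord : (r : ℕ) → List (Fin r)
  | 0 => []
  | r + 1 => (longWord r).map Fin.castSucc ++ (List.finRange (r + 1)).reverse

def longElement (r : ℕ) : Weyl r := wordProd (longWord r)

/-- `w` is a beginning section of the long word. -/
def IsBeginningSection (w : Weyl r) : Prop :=
  ∃ l ≤ (r + 1).choose 2, w = wordProd ((longWord r).take l)

/-- The action of the Weyl group on weights, `w e_j = e_{w j}`. -/
def act (w : Weyl r) (μ : Weight r) : Weight r := fun j ↦ μ (w⁻¹ j)

/-- `ρ = (r, r-1, …, 1, 0)`. -/
def rho (r : ℕ) : Weight r := fun j ↦ (r : ℤ) - (j : ℕ)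

/-- Dominant effective weights `λ₁ ≥ ⋯ ≥ λ_{r+1} ≥ 0`. -/
structure DominantEffectiveWeight (r : ℕ) where
  val : Weight r
  dominant : Antitone val
  effective : 0 ≤ val (Fin.last r)

/-- `λ + ρ`. -/
def DominantEffectiveWeight.addRho (lam : DominantEffectiveWeight r) :
    DominantEffectiveWeight r where
  val := lam.val + rho r
  dominant := by
    intro a b hab
    have h1 := lam.dominant hab
    have h2 : (a : ℕ) ≤ (b : ℕ) := hab
    simp only [Pi.add_apply, rho]
    omega
  effective := by
    have := lam.effective
    simp only [Pi.add_apply, rho, Fin.val_last]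
    omega

/-! ### Rational functions and the parameters -/

/-- The field `ℂ(x₁, …, x_{r+1})`. -/
abbrev RatFun (r : ℕ) := FractionRing (MvPolynomial (Fin (r + 1)) ℂ)

def x (j : Fin (r + 1)) : RatFun r := algebraMap (MvPolynomial (Fin (r + 1)) ℂ) _ (MvPolynomial.X j)

/-- The monomial `x^μ`, `μ ∈ ℤ^{r+1}`. -/
def xpow (μ : Weight r) : RatFun r := ∏ j, x j ^ μ j

/-- `x^{α_i} = x_i / x_{i+1}`. -/
def xroot (i : Fin r) : RatFun r := x i.castSucc / x i.succ

/-- The nonmetaplectic action of the Weyl group, `x_j ↦ x_{w j}`. -/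
def permAut (w : Weyl r) : RatFun r ≃ₐ[ℂ] RatFun r :=
  IsFractionRing.algEquivOfAlgEquiv (MvPolynomial.renameEquiv ℂ w)

/-- The automorphism `x_j ↦ u_j x_j` of the polynomial ring. -/
def scalePoly (u : Fin (r + 1) → ℂˣ) :
    MvPolynomial (Fin (r + 1)) ℂ ≃ₐ[ℂ] MvPolynomial (Fin (r + 1)) ℂ :=
  AlgEquiv.ofAlgHom
    (MvPolynomial.aeval fun j ↦ MvPolynomial.C (u j : ℂ) * MvPolynomial.X j)
    (MvPolynomial.aeval fun j ↦ MvPolynomial.C (((u j)⁻¹ : ℂˣ) : ℂ) * MvPolynomial.X j)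
    (by
      ext1 j
      simp only [AlgHom.comp_apply, MvPolynomial.aeval_X, map_mul, MvPolynomial.algHom_C,
        MvPolynomial.algebraMap_eq, AlgHom.id_apply]
      rw [← mul_assoc, ← map_mul, Units.inv_mul, map_one, one_mul])
    (by
      ext1 j
      simp only [AlgHom.comp_apply, MvPolynomial.aeval_X, map_mul, MvPolynomial.algHom_C,
        MvPolynomial.algebraMap_eq, AlgHom.id_apply]
      rw [← mul_assoc, ← map_mul, Units.mul_inv, map_one, one_mul])

/-- The field automorphism `x^μ ↦ ξ(μ) x^μ` induced by the character `ξ(μ) = ∏ u_j^{μ_j}` of the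
weight lattice. -/
def charAut (u : Fin (r + 1) → ℂˣ) : RatFun r ≃ₐ[ℂ] RatFun r :=
  IsFractionRing.algEquivOfAlgEquiv (scalePoly u)

/-- The complex parameters `v, g_0, …, g_{n-1}`, the index being extended to all integers by
reduction modulo `n`. -/
structure Parameters (n : ℕ) where
  v : ℂ
  g : ZMod n → ℂ
  v_ne_zero : v ≠ 0
  g_zero : g 0 = -1
  g_mul : ∀ i : ZMod n, i ≠ 0 → g i * g (-i) = v⁻¹

/-- `g♭(a) = v g_a`. -/
def Parameters.gFlat {n : ℕ} (P : Parameters n) (a : ℤ) : ℂ := P.v * P.g (a : ZMod n)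

/-- `h♭(a) = 1 - v` if `n ∣ a`, and `0` otherwise. -/
def Parameters.hFlat {n : ℕ} (P : Parameters n) (a : ℤ) : ℂ :=
  if (n : ℤ) ∣ a then 1 - P.v else 0

/-- The Gauss sum parameters `v = 1/q`, `g_i = ∑_b χ(b)^i ψ(b)`, where `q ≡ 1 mod 2n` is the
cardinality of the residue field `k`, `χ` is the `n`-th power residue symbol, and `ψ` is a
nontrivial additive character. -/
def Parameters.ofGaussSums {n : ℕ} [NeZero n] (k : Type*) [Field k] [Fintype k]
    (hq : Fintype.card k ≡ 1 [MOD 2 * n]) (χ : MulChar k ℂ) (hχ : orderOf χ = n)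
    (ψ : AddChar k ℂ) (hψ : ψ ≠ 1) : Parameters n where
  v := (Fintype.card k : ℂ)⁻¹
  g i := gaussSum (χ ^ i.val) ψ
  v_ne_zero := by simp
  g_zero := by
    rw [ZMod.val_zero, pow_zero]
    exact gaussSum_one_left hψ
  g_mul := by
    classical
    intro i hi
    have hi0 : i.val ≠ 0 := by simpa [ZMod.val_eq_zero] using hi
    have hlt : i.val < n := ZMod.val_lt i
    have hne : χ ^ i.val ≠ 1 := pow_ne_one_of_lt_orderOf hi0 (hlt.trans_eq hχ.symm)
    have hneg : (-i).val = n - i.val := by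
      have : NeZero i := ⟨hi⟩
      exact ZMod.val_neg_of_ne_zero i
    have hinv : χ ^ (-i).val = (χ ^ i.val)⁻¹ := by
      rw [eq_inv_iff_mul_eq_one, hneg, ← pow_add, Nat.sub_add_cancel hlt.le, ← hχ,
        pow_orderOf_eq_one]
    -- `-1` is an `n`-th power in the residue field
    have hχneg : ∀ m : ℕ, (χ ^ m) (-1) = 1 := by
      intro m
      obtain ⟨γ, hγ⟩ := IsCyclic.exists_generator (α := kˣ)
      obtain ⟨e, he⟩ := (mem_powers_iff_mem_zpowers (x := γ)).2 (hγ (-1))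
      have he : γ ^ e = -1 := he
      have hord : orderOf γ = Fintype.card k - 1 := by
        rw [orderOf_eq_card_of_forall_mem_zpowers hγ, Nat.card_eq_fintype_card, Fintype.card_units]
      have h2e : Fintype.card k - 1 ∣ 2 * e := by
        rw [← hord]
        apply orderOf_dvd_of_pow_eq_one
        rw [mul_comm, pow_mul, he]
        simp
      have hdvd : 2 * n ∣ Fintype.card k - 1 :=
        (Nat.modEq_iff_dvd' Fintype.card_pos).1 hq.symm
      obtain ⟨s, hs⟩ := Nat.dvd_of_mul_dvd_mul_left (by norm_num : 0 < 2) (hdvd.trans h2e)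
      have hk : (-1 : k) = ((γ ^ s : kˣ) : k) ^ n := by
        rw [← Units.val_pow_eq_pow_val, ← pow_mul, mul_comm s n, ← hs, he]
        simp
      have h1 : χ (-1) = 1 := by
        rw [hk, map_pow, ← MulChar.pow_apply_coe, ← hχ, pow_orderOf_eq_one, MulChar.one_apply_coe]
      have h3 : ((-1 : kˣ) : k) = -1 := by simp
      rw [← h3, MulChar.pow_apply_coe, h3, h1, one_pow]
    have key := gaussSum_mul_gaussSum_eq_card hne (AddChar.IsPrimitive.of_ne_one hψ)
    have hψinv : gaussSum (χ ^ i.val)⁻¹ ψ⁻¹ = gaussSum (χ ^ i.val)⁻¹ ψ := by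
      have h4 := gaussSum_mulShift (χ ^ i.val)⁻¹ ψ (-1)
      have h3 : ((-1 : kˣ) : k) = -1 := by simp
      rw [h3, ← hinv, hχneg, one_mul] at h4
      rw [← hinv, ← h4, ← AddChar.inv_mulShift]
    rw [hinv, inv_inv, ← hψinv, key]

/-! ### The Chinta–Gunnells action -/

section ChintaGunnells

variable {n : ℕ} [NeZero n]

/-- The bracket in the definition of the action on `x^λ`, with `c = λ_i - λ_{i+1}` modulo `n`. -/
def bracket (P : Parameters n) (i : Fin r) (c : ZMod n) : RatFun r :=
  xroot i ^ (-(((-c).val : ℕ) : ℤ)) * (1 - algebraMap ℂ _ P.v)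
    - algebraMap ℂ _ P.v * algebraMap ℂ _ (P.g (1 - c)) * xroot i ^ (1 - (n : ℤ))
        * (1 - xroot i ^ n)

/-- A primitive `n`-th root of unity in `ℂ`. -/
def zeta (n : ℕ) [NeZero n] : ℂˣ :=
  ((Complex.isPrimitiveRoot_exp n (NeZero.ne n)).isUnit (NeZero.ne n)).unit

/-- The character `λ ↦ ζ^{k (λ_i - λ_{i+1})}` of the weight lattice. -/
def rootChar (n : ℕ) [NeZero n] (i : Fin r) (k : ℕ) : Fin (r + 1) → ℂˣ :=
  fun j ↦ if j = i.castSucc then zeta n ^ k else if j = i.succ then (zeta n ^ k)⁻¹ else 1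

/-- The projection of the field of rational functions onto the part spanned (over the functions
invariant under `charAut (rootChar n i 1)`) by the monomials `x^λ` with `λ_i - λ_{i+1} ≡ c`
modulo `n`; it is the sum of the homogeneous parts whose degrees `λ` satisfy this congruence. -/
def component (i : Fin r) (c : ZMod n) : RatFun r →ₗ[ℂ] RatFun r :=
  (n : ℂ)⁻¹ • ∑ k ∈ Finset.range n,
    (((zeta n ^ (k * c.val))⁻¹ : ℂˣ) : ℂ) • (charAut (rootChar n i k)).toLinearMap

/-- The metaplectic (Chinta–Gunnells) action of the simple reflection `σ_i`. -/
def metaReflection (P : Parameters n) (i : Fin r) : RatFun r →ₗ[ℂ] RatFun r :=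
  ∑ c : ZMod n,
    LinearMap.mulLeft ℂ (bracket P i c / (1 - algebraMap ℂ _ P.v * xroot i ^ n)) ∘ₗ
      (permAut (simpleReflection i)).toLinearMap ∘ₗ component i c

/-- The sublattice `Λ₀` of weights all of whose coordinates are congruent modulo `n`. -/
def Lambda0 (r n : ℕ) : AddSubgroup (Weight r) where
  carrier := {μ | ∀ i j, μ i ≡ μ j [ZMOD n]}
  add_mem' ha hb i j := (ha i j).add (hb i j)
  zero_mem' _ _ := rfl
  neg_mem' ha i j := (ha i j).neg

/-- `f` lies in the homogeneous part of degree `λ mod Λ₀`: every character of `Λ/Λ₀` acts on `f`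
through its value at `λ`. -/
def IsHomogeneous (n : ℕ) (lam : Weight r) (f : RatFun r) : Prop :=
  ∀ u : Fin (r + 1) → ℂˣ, (∀ μ ∈ Lambda0 r n, ∏ j, u j ^ μ j = 1) →
    charAut u f = ((∏ j, u j ^ lam j : ℂˣ) : ℂ) • f

theorem prod_rootChar (i : Fin r) (k : ℕ) (μ : Weight r) :
    ∏ j, rootChar n i k j ^ μ j = zeta n ^ ((k : ℤ) * (μ i.castSucc - μ i.succ)) := by
  have hne : i.succ ≠ i.castSucc := (Fin.castSucc_lt_succ).ne'
  rw [Finset.prod_eq_mul i.castSucc i.succ hne.symm]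
  · simp only [rootChar, if_true, if_neg hne]
    rw [inv_zpow', ← zpow_natCast, ← zpow_mul, ← zpow_mul, ← zpow_add]
    congr 1
    ring
  · intro j _ hj
    simp [rootChar, hj.1, hj.2]
  · simp
  · simp

theorem zeta_isPrimitiveRoot : IsPrimitiveRoot (zeta n) n :=
  IsPrimitiveRoot.coe_units_iff.1 (by
    simpa [zeta] using Complex.isPrimitiveRoot_exp n (NeZero.ne n))

theorem component_of_isHomogeneous (i : Fin r) (c : ZMod n) {lam : Weight r} {f : RatFun r}
    (hf : IsHomogeneous n lam f) :
    component i c f = if c = ((lam i.castSucc - lam i.succ : ℤ) : ZMod n) then f else 0 := by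
  set d : ℤ := lam i.castSucc - lam i.succ with hd
  have hζ := zeta_isPrimitiveRoot (n := n)
  have hact : ∀ k : ℕ, charAut (rootChar n i k) f = ((zeta n ^ ((k : ℤ) * d) : ℂˣ) : ℂ) • f := by
    intro k
    rw [hf, prod_rootChar]
    intro μ hμ
    rw [prod_rootChar, hζ.zpow_eq_one_iff_dvd]
    exact ((hμ i.succ i.castSucc).dvd).mul_left _
  have hterm : ∀ k : ℕ, (((zeta n ^ (k * c.val))⁻¹ : ℂˣ) : ℂ) •
      (charAut (rootChar n i k)).toLinearMap f
        = (((zeta n ^ (d - c.val) : ℂˣ) : ℂ) ^ k) • f := by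
    intro k
    rw [AlgEquiv.toLinearMap_apply, hact, smul_smul, ← Units.val_mul, ← Units.val_pow_eq_pow_val]
    congr 2
    rw [← zpow_natCast, ← zpow_neg, ← zpow_natCast, ← zpow_mul, ← zpow_add]
    congr 1
    push_cast
    ring
  have hn : (n : ℂ) ≠ 0 := by exact_mod_cast NeZero.ne n
  simp only [component, LinearMap.smul_apply, LinearMap.sum_apply, hterm]
  rw [← Finset.sum_smul, smul_smul]
  have hiff : c = (d : ZMod n) ↔ zeta n ^ (d - c.val) = 1 := by
    rw [hζ.zpow_eq_one_iff_dvd, ← ZMod.intCast_zmod_eq_zero_iff_dvd]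
    push_cast
    rw [ZMod.natCast_zmod_val, sub_eq_zero, eq_comm]
  split_ifs with h
  · rw [hiff.1 h]
    simp [hn]
  · have h1 : ((zeta n ^ (d - c.val) : ℂˣ) : ℂ) ≠ 1 := by
      intro h2
      exact h (hiff.2 (Units.ext h2))
    have h3 : ((zeta n ^ (d - c.val) : ℂˣ) : ℂ) ^ n = 1 := by
      rw [← Units.val_pow_eq_pow_val, ← zpow_natCast, ← zpow_mul, mul_comm, zpow_mul, zpow_natCast,
        hζ.pow_eq_one]
      simp
    rw [geom_sum_eq h1, h3]
    simp

/-- On the homogeneous part of degree `λ mod Λ₀` the operator is given by the usual formula. -/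
theorem metaReflection_of_isHomogeneous (P : Parameters n) (i : Fin r) {lam : Weight r}
    {f : RatFun r} (hf : IsHomogeneous n lam f) :
    metaReflection P i f =
      permAut (simpleReflection i) f / (1 - algebraMap ℂ _ P.v * xroot i ^ n) *
        (xroot i ^ (-((lam i.succ - lam i.castSucc) % (n : ℤ))) * (1 - algebraMap ℂ _ P.v)
          - algebraMap ℂ _ P.v
            * algebraMap ℂ _ (P.g ((1 + lam i.succ - lam i.castSucc : ℤ) : ZMod n))
            * xroot i ^ (1 - (n : ℤ)) * (1 - xroot i ^ n)) := by
  simp only [metaReflection, LinearMap.sum_apply, LinearMap.comp_apply,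
    component_of_isHomogeneous i _ hf]
  rw [Finset.sum_eq_single ((lam i.castSucc - lam i.succ : ℤ) : ZMod n)]
  · have h1 : (((-((lam i.castSucc - lam i.succ : ℤ) : ZMod n)).val : ℕ) : ℤ)
        = (lam i.succ - lam i.castSucc) % (n : ℤ) := by
      rw [← Int.cast_neg, ZMod.val_intCast, neg_sub]
    have h2 : (1 - ((lam i.castSucc - lam i.succ : ℤ) : ZMod n))
        = ((1 + lam i.succ - lam i.castSucc : ℤ) : ZMod n) := by
      push_cast
      ring
    rw [if_pos rfl, LinearMap.mulLeft_apply, AlgEquiv.toLinearMap_apply, bracket, h1, h2]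
    ring
  · intro c _ hc
    rw [if_neg hc, map_zero, map_zero]
  · simp

/-! ### Demazure and Demazure–Lusztig operators -/

/-- `D_i f = (f - x^{n α_i} σ_i(f)) / (1 - x^{n α_i})`. -/
def demazure (P : Parameters n) (i : Fin r) : Module.End ℂ (RatFun r) :=
  LinearMap.mulLeft ℂ (1 - xroot i ^ n)⁻¹ ∘ₗ
    (LinearMap.id - LinearMap.mulLeft ℂ (xroot i ^ n) ∘ₗ metaReflection P i)

/-- `T_i f = (1 - v x^{n α_i}) D_i f - f`. -/
def demazureLusztigSimple (P : Parameters n) (i : Fin r) : Module.End ℂ (RatFun r) :=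
  LinearMap.mulLeft ℂ (1 - algebraMap ℂ _ P.v * xroot i ^ n) ∘ₗ demazure P i - LinearMap.id

/-- `T_w = T_{i₁} ⋯ T_{i_l}` for a reduced word `w = σ_{i₁} ⋯ σ_{i_l}`. -/
def demazureLusztig (P : Parameters n) (w : Weyl r) : Module.End ℂ (RatFun r) :=
  ((reducedWord w).map (demazureLusztigSimple P)).prod

end ChintaGunnells

/-! ### Highest weight crystals

The crystal of highest weight `μ` is realized on the semistandard Young tableaux of shape `μ`
with entries in `{0, …, r}` (the entry `j` standing for the letter `j + 1`). -/

/-- The function `φ_i` on words: a letter `a` contributes `φ_i = 1` if `a = i` and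
`ε_i = 1` if `a = i + 1`, and `φ_i(a w) = φ_i(a) + max (φ_i(w) - ε_i(a)) 0` by the tensor product
rule. -/
def wordPhi (i : ℕ) : List ℕ → ℕ
  | [] => 0
  | a :: w => if a = i then wordPhi i w + 1
      else if a = i + 1 then wordPhi i w - 1 else wordPhi i w

/-- The Kashiwara operator `f_i` on words (`none` is the zero element), by the tensor product rule:
`f_i(a w) = a f_i(w)` if `φ_i(w) > ε_i(a)`, and `f_i(a w) = f_i(a) w` otherwise. -/
def wordF (i : ℕ) : List ℕ → Option (List ℕ)
  | [] => none
  | a :: w =>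
      if (if a = i + 1 then 1 else 0) < wordPhi i w then (wordF i w).map (a :: ·)
      else if a = i then some ((i + 1) :: w) else none

/-- The Young diagram with row lengths `μ₁, …, μ_{r+1}`. -/
def DominantEffectiveWeight.diagram (μ : DominantEffectiveWeight r) : YoungDiagram :=
  YoungDiagram.ofRowLens (List.ofFn fun j ↦ (μ.val j).toNat)
    (List.sortedGE_ofFn_iff.2 fun _ _ h ↦ Int.toNat_le_toNat (μ.dominant h))

/-- The vertices of the highest weight crystal `C_μ`. -/
def Crystal (μ : DominantEffectiveWeight r) : Type :=
  {T : SemistandardYoungTableau μ.diagram // ∀ i j, T i j ≤ r}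

instance (μ : DominantEffectiveWeight r) : Finite (Crystal μ) := by
  let F : Crystal μ → (μ.diagram.cells → Fin (r + 1)) :=
    fun T c ↦ ⟨T.1 c.1.1 c.1.2, Nat.lt_succ_of_le (T.2 _ _)⟩
  refine Finite.of_injective F fun T T' h ↦ Subtype.ext (SemistandardYoungTableau.ext fun i j ↦ ?_)
  by_cases hc : (i, j) ∈ μ.diagram
  · have := congrFun h ⟨(i, j), hc⟩
    simpa [F] using this
  · rw [T.1.zeros hc, T'.1.zeros hc]

instance (μ : DominantEffectiveWeight r) : Fintype (Crystal μ) := Fintype.ofFinite _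

namespace Crystal

variable {μ : DominantEffectiveWeight r}

/-- The row reading word: rows from bottom to top, each read from left to right. -/
def readingWord (b : Crystal μ) : List ℕ :=
  (List.range (r + 1)).reverse.flatMap fun i ↦
    (List.range (μ.diagram.rowLen i)).map fun j ↦ b.1 i j

/-- The weight of a vertex: the `k`-th coordinate counts the entries equal to `k`. -/
def wt (b : Crystal μ) : Weight r := fun k ↦ ((readingWord b).count (k : ℕ) : ℤ)

open Classical in
/-- The Kashiwara operator `f_i`, computed on reading words. -/
def f (i : Fin r) (b : Crystal μ) : Option (Crystal μ) :=
  if h : ∃ b' : Crystal μ, wordF i (readingWord b) = some (readingWord b') then some h.choose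
  else none

/-- The power `f_i^k`. -/
def fPow (i : Fin r) : ℕ → Crystal μ → Option (Crystal μ)
  | 0, b => some b
  | k + 1, b => (fPow i k b).bind (f i)

/-- `φ_i(b) = max {k | f_i^k b ≠ 0}`. -/
def phi (i : Fin r) (b : Crystal μ) : ℕ := sSup {k | fPow i k b ≠ none}

/-- The end of the `i`-string through `b`. -/
def stringEnd (i : Fin r) (b : Crystal μ) : Crystal μ := (fPow i (phi i b) b).getD b

/-- The lengths of the segments of the path from `b` along a given sequence of edge labels. -/
def path : List (Fin r) → Crystal μ → List ℕ
  | [], _ => []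
  | i :: ω, b => phi i b :: path ω (stringEnd i b)

/-- The Berenstein–Zelevinsky–Littelmann integers `b_1, …, b_N`, `N = r (r + 1) / 2`. -/
def bzl (b : Crystal μ) : List ℕ := path (longWord r) b

/-- The entry in row `i` and column `j` of the `BZL` array, `1 ≤ i ≤ j ≤ r`; the `i`-th row is
`b_{m+1}, b_{m+2}, …, b_{m+r-i+1}` with `m = (r-i+1)(r-i)/2`, in columns `i, …, r`. -/
def bzlEntry (b : Crystal μ) (i j : ℕ) : ℕ := (bzl b).getD ((r + 1 - i).choose 2 + (j - i)) 0

end Crystal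

open Classical in
/-- The vertices of the Demazure crystal `C_μ^{(w)}`: those `b` with `b_i(b) = 0` for all
`i > ℓ(w)`. -/
def demazureCrystal (μ : DominantEffectiveWeight r) (w : Weyl r) : Finset (Crystal μ) :=
  Finset.univ.filter fun b ↦ ∀ m ∈ (Crystal.bzl b).drop (len w), m = 0

/-! ### Gelfand–Tsetlin patterns and coefficients -/

/-- Gelfand–Tsetlin patterns with top row `μ`: arrays of nonnegative integers `a i j`,
`0 ≤ i ≤ j ≤ r` (extended by zero), whose rows interleave. -/
structure GTPattern (μ : DominantEffectiveWeight r) where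
  a : ℕ → ℕ → ℕ
  top : ∀ j : Fin (r + 1), (a 0 j : ℤ) = μ.val j
  interleave : ∀ i j, 1 ≤ i → i ≤ j → j ≤ r → a i j ≤ a (i - 1) (j - 1) ∧ a (i - 1) j ≤ a i j
  zeros : ∀ i j, j < i ∨ r < j → a i j = 0

namespace GTPattern

variable {μ : DominantEffectiveWeight r} {n : ℕ}

/-- The entries `Γ_{ij} = ∑_{k = j}^r (a_{ik} - a_{i-1,k})` of the `Γ`-array. -/
def Gam (t : GTPattern μ) (i j : ℕ) : ℤ :=
  ∑ k ∈ Finset.Icc j r, ((t.a i k : ℤ) - (t.a (i - 1) k : ℤ))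

/-- The factor `g_{ij}`: `Γ_{ij}` is circled if `Γ_{ij} = Γ_{i,j+1}`, and boxed if
`Γ_{ij} = Γ_{i,j+1} + a_{i-1,j-1} - a_{i-1,j}`. -/
def factor (P : Parameters n) (t : GTPattern μ) (i j : ℕ) : ℂ :=
  if t.Gam i j = t.Gam i (j + 1) then
    if t.Gam i j = t.Gam i (j + 1) + t.a (i - 1) (j - 1) - t.a (i - 1) j then 0 else 1
  else
    if t.Gam i j = t.Gam i (j + 1) + t.a (i - 1) (j - 1) - t.a (i - 1) j then P.gFlat (t.Gam i j)
    else P.hFlat (t.Gam i j)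

/-- The Gelfand–Tsetlin coefficient of a pattern. -/
def coeff (P : Parameters n) (t : GTPattern μ) : ℂ :=
  ∏ i ∈ Finset.Icc 1 r, ∏ j ∈ Finset.Icc i r, t.factor P i j

/-- The pattern `t` corresponds to the vertex `b` if `BZL(b) = Γ(t)`. -/
def Corresponds (t : GTPattern μ) (b : Crystal μ) : Prop :=
  ∀ i j, 1 ≤ i → i ≤ j → j ≤ r → t.Gam i j = b.bzlEntry i j

end GTPattern

open Classical in
/-- The Gelfand–Tsetlin coefficient `G^{(n,μ)}(b)` of a vertex: the coefficient of the (unique)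
pattern corresponding to `b`. -/
def gtCoeff {n : ℕ} (P : Parameters n) {μ : DominantEffectiveWeight r} (b : Crystal μ) : ℂ :=
  if h : ∃ t : GTPattern μ, t.Corresponds b then h.choose.coeff P else 0

end Metaplectic

end

open Metaplectic

noncomputable section

namespace Metaplectic

/-! ### Coxeter combinatorics of the symmetric group: length, reduced words, transpositions. -/

section

variable {r : ℕ}

/-! ### Length and inversions -/

/-! One recursion on the rank is found twice, on the operator side and on the crystal side, and the
two versions are matched row by row of a Gelfand–Tsetlin pattern. Indices are zero-based throughout.

Operators. For `r > 0` a beginning section is `w = topEl m * cycleEl m c`: the longest permutation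
of `{0, …, m}` followed by `σ_m ⋯ σ_c`. The interval below it consists of the products `u σ_m ⋯ σ_j`
with `u` a permutation of `{0, …, m}` and `c ≤ j ≤ m + 1`, with lengths adding. By the braid
relations the sum of the operators is therefore `E · ∑_j T_m ⋯ T_j`, where `E` is the sum of all
`T_u` over these `u` (`bruhatInterval_topEl_mul`, `sum_sectionSet_heckeProd`). The quadratic
relation gives `E T_j = v E` for `j < m`, and `E f = 0` whenever `T_j f = -f` (`parabolicSum_comp`).

If `M = ν_{j+1} - ν_j + 1 ≥ 1`, then `T_j x^ν` is the sum over `1 ≤ k ≤ M` of the monomials `x^{ν +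
k α_j}` with coefficient `h♭(k)` for `k < M` and `g♭(M)` for `k = M` (`laurentOp_mono`). These are
Gelfand–Tsetlin factors, but expanding `T_m ⋯ T_j` in this way imposes no relation between
successive exponents `k_j, k_{j+1}, …`, while a `Γ`-row requires `k_j ≤ k_{j+1}` and gives an
equality the factor `1` (or `0`). The two sums become equal after applying `E`: the difference,
grouped by the value of `k_{j+1}`, consists of multiples of `T_j N - v N` and of vectors `N` with
`T_j N = -N`, all killed by `E` (`map_bracket`, `map_descProd`). Summing over `j` supplies the terms
whose first exponents vanish (`map_sum_descProd`). Thus `E · ∑_j T_m ⋯ T_j` on `x^ν` is a sum of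
vectors `E x^{ν'}` over the `ν'` that, after a shift by `ρ`, interlace with `ν` (`mem_rows`).
Iteration turns `E` into a sum over patterns; rows with repeated entries contribute zero on both
sides (`nest_eq_zero`, `parabolicSum_natMono`).

The braid relation itself is proved on monomials. Powers with exponents divisible by `n` are treated
as coefficients, and the ρ-shifted exponents are reduced modulo `n` to three colours, so that a
finite list of field identities remains (`braid_of_box`, `demazureLusztigSimple_braid`).

Crystal. A tableau is a chain of shapes, and a chain of shapes is a pattern. Along each block `σ_m ⋯
σ_0` of the long word the shapes are replaced by truncations of one larger shape, so that the string
lengths are explicit and equal the entries `Γ_{ij}` (`fPow_excess`, `string_along`,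
`gam_eq_stringLength`). The Demazure condition then says that the first rows of the pattern are
forced and that the last `c` entries of the next `Γ`-row vanish. This is the index set of the nested
sum (`levelWeight_mem_rows`, `sum_agreeAbove_succ`). -/

def inversionSet (u : Weyl r) : Finset (Fin (r + 1) × Fin (r + 1)) :=
  Finset.univ.filter fun p ↦ p.1 < p.2 ∧ u p.2 < u p.1

theorem mem_inversionSet {u : Weyl r} {p : Fin (r + 1) × Fin (r + 1)} :
    p ∈ inversionSet u ↔ p.1 < p.2 ∧ u p.2 < u p.1 := by simp [inversionSet]

theorem simpleReflection_val (i : Fin r) (a : Fin (r + 1)) :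
    (simpleReflection i a : ℕ) = if (a : ℕ) = i then (i : ℕ) + 1
      else if (a : ℕ) = i + 1 then (i : ℕ) else a := by
  unfold simpleReflection
  rw [Equiv.swap_apply_def]
  simp only [Fin.ext_iff, Fin.val_castSucc, Fin.val_succ]
  split_ifs <;> simp_all

theorem simpleReflection_lt {i : Fin r} {a b : Fin (r + 1)} (h : a < b)
    (hne : ¬ (a = i.castSucc ∧ b = i.succ)) : simpleReflection i a < simpleReflection i b := by
  rw [Fin.lt_def] at *
  simp only [Fin.ext_iff, Fin.val_castSucc, Fin.val_succ] at hne
  rw [simpleReflection_val, simpleReflection_val]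
  split_ifs <;> omega

@[simp] theorem simpleReflection_mul_self (i : Fin r) :
    simpleReflection i * simpleReflection i = 1 := Equiv.swap_mul_self _ _

@[simp] theorem simpleReflection_apply_apply (i : Fin r) (a : Fin (r + 1)) :
    simpleReflection i (simpleReflection i a) = a := by
  rw [← Equiv.Perm.mul_apply, simpleReflection_mul_self, Equiv.Perm.one_apply]

@[simp] theorem simpleReflection_castSucc (i : Fin r) :
    simpleReflection i i.castSucc = i.succ := Equiv.swap_apply_left _ _

@[simp] theorem simpleReflection_succ (i : Fin r) :
    simpleReflection i i.succ = i.castSucc := Equiv.swap_apply_right _ _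

/-- Applying `σ_i` to both positions matches the inversions of `u` with those of `u σ_i` other than
`(i, i + 1)`, because `σ_i` preserves the order of every other pair. -/
theorem card_inversionSet_mul {u : Weyl r} {i : Fin r} (h : u i.castSucc < u i.succ) :
    (inversionSet (u * simpleReflection i)).card = (inversionSet u).card + 1 := by
  have hmem : (i.castSucc, i.succ) ∈ inversionSet (u * simpleReflection i) := by
    simp [mem_inversionSet, h]
  rw [← Finset.card_erase_add_one hmem]
  congr 1
  refine Finset.card_nbij' (fun p ↦ (simpleReflection i p.1, simpleReflection i p.2))
    (fun p ↦ (simpleReflection i p.1, simpleReflection i p.2)) ?_ ?_ ?_ ?_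
  · rintro ⟨a, b⟩ hp
    simp only [Finset.coe_erase, Set.mem_sdiff, Finset.mem_coe, mem_inversionSet,
      Set.mem_singleton_iff, Prod.mk.injEq, Equiv.Perm.mul_apply] at hp ⊢
    exact ⟨simpleReflection_lt hp.1.1 hp.2, hp.1.2⟩
  · rintro ⟨a, b⟩ hp
    simp only [Finset.coe_erase, Set.mem_sdiff, Finset.mem_coe, mem_inversionSet,
      Set.mem_singleton_iff, Prod.mk.injEq, Equiv.Perm.mul_apply,
      simpleReflection_apply_apply] at hp ⊢
    have hne : ¬ (a = i.castSucc ∧ b = i.succ) := by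
      rintro ⟨rfl, rfl⟩
      exact lt_asymm h hp.2
    refine ⟨⟨simpleReflection_lt hp.1 hne, hp.2⟩, ?_⟩
    rintro ⟨h1, h2⟩
    have h1' := congrArg (simpleReflection i) h1
    have h2' := congrArg (simpleReflection i) h2
    simp only [simpleReflection_apply_apply, simpleReflection_castSucc,
      simpleReflection_succ] at h1' h2'
    subst h1' h2'
    exact lt_asymm hp.1 Fin.castSucc_lt_succ
  · intro p _; simp
  · intro p _; simp

theorem lt_or_lt_apply (u : Weyl r) (i : Fin r) :
    u i.castSucc < u i.succ ∨ u i.succ < u i.castSucc :=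
  lt_or_gt_of_ne (u.injective.ne (Fin.castSucc_lt_succ).ne)

theorem card_inversionSet_mul' {u : Weyl r} {i : Fin r} (h : u i.succ < u i.castSucc) :
    (inversionSet (u * simpleReflection i)).card + 1 = (inversionSet u).card := by
  have := card_inversionSet_mul (u := u * simpleReflection i) (i := i) (by simpa using h)
  rw [mul_assoc, simpleReflection_mul_self, mul_one] at this
  exact this.symm

theorem eq_one_of_forall_lt {u : Weyl r} (h : ∀ i : Fin r, u i.castSucc < u i.succ) : u = 1 := by
  have hm : StrictMono u := Fin.strictMono_iff_lt_succ.2 h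
  have h1 := hm.range_inj strictMono_id |>.1 (by simp [u.surjective.range_eq])
  exact Equiv.ext fun a ↦ congrFun h1 a

theorem wordProd_append (l l' : List (Fin r)) : wordProd (l ++ l') = wordProd l * wordProd l' := by
  simp [wordProd]

@[simp] theorem wordProd_singleton (i : Fin r) : wordProd [i] = simpleReflection i := by
  simp [wordProd]

theorem card_inversionSet_one : (inversionSet (1 : Weyl r)).card = 0 := by
  rw [Finset.card_eq_zero, Finset.eq_empty_iff_forall_notMem]
  intro p hp
  rw [mem_inversionSet] at hp
  exact lt_asymm hp.1 hp.2

theorem card_inversionSet_wordProd_le (l : List (Fin r)) :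
    (inversionSet (wordProd l)).card ≤ l.length := by
  induction l using List.reverseRecOn with
  | nil => exact (card_inversionSet_one (r := r)).le
  | append_singleton l i ih =>
    rw [wordProd_append, wordProd_singleton, List.length_append, List.length_singleton]
    rcases lt_or_lt_apply (wordProd l) i with h | h
    · rw [card_inversionSet_mul h]; omega
    · have := card_inversionSet_mul' h; omega

/-- Bubble sort: a permutation other than the identity has a descent, and removing it lowers the
number of inversions by one. -/
theorem exists_word_card_inversionSet (k : ℕ) : ∀ u : Weyl r, (inversionSet u).card = k →
    ∃ l : List (Fin r), wordProd l = u ∧ l.length = k := by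
  induction k with
  | zero =>
    intro u hu
    refine ⟨[], (eq_one_of_forall_lt fun i ↦ ?_).symm, rfl⟩
    refine (lt_or_lt_apply u i).resolve_right fun h ↦ ?_
    have := card_inversionSet_mul' h
    omega
  | succ k ih =>
    intro u hu
    obtain ⟨i, hi⟩ : ∃ i : Fin r, u i.succ < u i.castSucc := by
      by_contra! h
      have := eq_one_of_forall_lt fun i ↦ (lt_or_lt_apply u i).resolve_right (h i).not_gt
      rw [this, card_inversionSet_one] at hu
      omega
    have := card_inversionSet_mul' hi
    obtain ⟨l, hl, hlen⟩ := ih (u * simpleReflection i) (by omega)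
    refine ⟨l ++ [i], ?_, by simp [hlen]⟩
    rw [wordProd_append, hl, wordProd_singleton, mul_assoc, simpleReflection_mul_self, mul_one]

theorem len_le_length (l : List (Fin r)) : len (wordProd l) ≤ l.length :=
  Nat.sInf_le ⟨l, rfl, rfl⟩

theorem len_eq_card_inversionSet (u : Weyl r) : len u = (inversionSet u).card := by
  apply le_antisymm
  · obtain ⟨l, rfl, hlen⟩ := exists_word_card_inversionSet _ u rfl
    exact (len_le_length l).trans hlen.le
  · obtain ⟨l, hl, hlen⟩ := exists_isReducedWord u
    rw [← hlen, ← hl]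
    exact card_inversionSet_wordProd_le l

theorem len_mul_simpleReflection {u : Weyl r} {i : Fin r} (h : u i.castSucc < u i.succ) :
    len (u * simpleReflection i) = len u + 1 := by
  simp only [len_eq_card_inversionSet, card_inversionSet_mul h]

theorem len_mul_simpleReflection' {u : Weyl r} {i : Fin r} (h : u i.succ < u i.castSucc) :
    len (u * simpleReflection i) + 1 = len u := by
  simp only [len_eq_card_inversionSet, card_inversionSet_mul' h]

theorem len_one : len (1 : Weyl r) = 0 := by
  rw [len_eq_card_inversionSet, card_inversionSet_one]

theorem apply_succ_lt_of_len {u : Weyl r} {i : Fin r}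
    (h : len (u * simpleReflection i) < len u) : u i.succ < u i.castSucc := by
  refine (lt_or_lt_apply u i).resolve_left fun h' ↦ ?_
  rw [len_mul_simpleReflection h'] at h
  omega

theorem IsReducedWord.append {l : List (Fin r)} {u : Weyl r} {i : Fin r}
    (h : IsReducedWord l u) (hu : u i.castSucc < u i.succ) :
    IsReducedWord (l ++ [i]) (u * simpleReflection i) := by
  refine ⟨by rw [wordProd_append, h.1, wordProd_singleton], ?_⟩
  rw [len_mul_simpleReflection hu, List.length_append, h.2, List.length_singleton]

theorem IsReducedWord.of_append {l : List (Fin r)} {u : Weyl r} {i : Fin r}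
    (h : IsReducedWord (l ++ [i]) u) :
    IsReducedWord l (u * simpleReflection i) ∧ u i.succ < u i.castSucc := by
  have h1 : wordProd l = u * simpleReflection i := by
    rw [← h.1, wordProd_append, wordProd_singleton, mul_assoc, simpleReflection_mul_self, mul_one]
  have h2 : l.length + 1 = len u := by rw [← h.2]; simp
  have h3 := len_le_length l
  rw [h1] at h3
  have h4 := apply_succ_lt_of_len (u := u) (i := i) (by omega)
  have := len_mul_simpleReflection' h4
  exact ⟨⟨h1, by omega⟩, h4⟩

/-! ### Products over reduced words -/

structure SatisfiesBraid {M : Type*} [Monoid M] (τ : Fin r → M) : Prop where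
  braid : ∀ i j : Fin r, (i : ℕ) + 1 = j → τ i * τ j * τ i = τ j * τ i * τ j
  comm : ∀ i j : Fin r, (i : ℕ) + 1 < j → τ i * τ j = τ j * τ i

section Reduced

variable {M : Type*} [Monoid M] {τ : Fin r → M}

theorem simpleReflection_apply_of_ne {i : Fin r} {a : Fin (r + 1)} (h1 : (a : ℕ) ≠ i)
    (h2 : (a : ℕ) ≠ i + 1) : simpleReflection i a = a := by
  rw [Fin.ext_iff, simpleReflection_val, if_neg h1, if_neg h2]

theorem simpleReflection_braid {i j : Fin r} (h : (i : ℕ) + 1 = j) :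
    simpleReflection i * simpleReflection j * simpleReflection i =
      simpleReflection j * simpleReflection i * simpleReflection j := by
  have e0 : j.castSucc = i.succ := Fin.ext (by simp [h])
  have e1 : simpleReflection i j.succ = j.succ :=
    simpleReflection_apply_of_ne (by simp; omega) (by simp; omega)
  have e2 : simpleReflection j i.castSucc = i.castSucc :=
    simpleReflection_apply_of_ne (by simp; omega) (by simp; omega)
  have h1 := Equiv.mul_swap_eq_swap_mul (simpleReflection i) j.castSucc j.succ
  have h2 := Equiv.mul_swap_eq_swap_mul (simpleReflection j) i.castSucc i.succ
  rw [e0, simpleReflection_succ, e1, ← e0] at h1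
  rw [e2, ← e0, simpleReflection_castSucc, e0] at h2
  have h1' : simpleReflection i * simpleReflection j =
    Equiv.swap i.castSucc j.succ * simpleReflection i := h1
  have h2' : simpleReflection j * simpleReflection i =
    Equiv.swap i.castSucc j.succ * simpleReflection j := h2
  rw [h1', h2', mul_assoc, mul_assoc, simpleReflection_mul_self, simpleReflection_mul_self]

theorem simpleReflection_comm {i j : Fin r} (h : (i : ℕ) + 1 < j) :
    simpleReflection i * simpleReflection j = simpleReflection j * simpleReflection i := by
  have e1 : simpleReflection i j.succ = j.succ :=
    simpleReflection_apply_of_ne (by simp; omega) (by simp; omega)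
  have e2 : simpleReflection i j.castSucc = j.castSucc :=
    simpleReflection_apply_of_ne (by simp; omega) (by simp; omega)
  have h1 := Equiv.mul_swap_eq_swap_mul (simpleReflection i) j.castSucc j.succ
  rw [e1, e2] at h1
  exact h1

theorem isReducedWord_of_descent {u : Weyl r} {i : Fin r} {l : List (Fin r)}
    (hl : IsReducedWord l (u * simpleReflection i)) (h : u i.succ < u i.castSucc) :
    IsReducedWord (l ++ [i]) u := by
  have := hl.append (i := i) (by simpa using h)
  rwa [mul_assoc, simpleReflection_mul_self, mul_one] at this

/-- Matsumoto's argument. Both `i` and `j` are descents of `u`, so `u` has reduced words ending in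
either of the two longest words of the subgroup generated by `σ_i` and `σ_j`. The induction
hypothesis connects the given words with these, and the braid or commutation relation connects these
with each other. -/
theorem SatisfiesBraid.prod_eq_aux (hτ : SatisfiesBraid τ) {k : ℕ}
    (ih : ∀ (l l' : List (Fin r)) (u : Weyl r), l.length = k → IsReducedWord l u →
      IsReducedWord l' u → (l.map τ).prod = (l'.map τ).prod)
    {l l' : List (Fin r)} {i j : Fin r} {u : Weyl r} (hlen : l.length = k)
    (hl : IsReducedWord (l ++ [i]) u) (hl' : IsReducedWord (l' ++ [j]) u) (hij : i < j) :
    (l.map τ).prod * τ i = (l'.map τ).prod * τ j := by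
  obtain ⟨h1, hi⟩ := hl.of_append
  obtain ⟨h2, hj⟩ := hl'.of_append
  have hlen' : l'.length = k := by
    have := hl.2.trans hl'.2.symm
    simp only [List.length_append, List.length_singleton] at this
    omega
  rcases Nat.lt_or_ge ((i : ℕ) + 1) j with hd | hd
  · have e1 : simpleReflection i j.succ = j.succ :=
      simpleReflection_apply_of_ne (by simp; omega) (by simp; omega)
    have e2 : simpleReflection i j.castSucc = j.castSucc :=
      simpleReflection_apply_of_ne (by simp; omega) (by simp; omega)
    have e3 : simpleReflection j i.succ = i.succ :=
      simpleReflection_apply_of_ne (by simp; omega) (by simp; omega)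
    have e4 : simpleReflection j i.castSucc = i.castSucc :=
      simpleReflection_apply_of_ne (by simp; omega) (by simp; omega)
    obtain ⟨q, hq⟩ := exists_isReducedWord (u * simpleReflection i * simpleReflection j)
    have q1 := isReducedWord_of_descent hq (by simpa [e1, e2] using hj)
    rw [mul_assoc, simpleReflection_comm hd, ← mul_assoc] at hq
    have q2 := isReducedWord_of_descent hq (by simpa [e3, e4] using hi)
    rw [ih _ _ _ hlen h1 q1, ih _ _ _ hlen' h2 q2]
    simp only [List.map_append, List.prod_append, List.map_singleton, List.prod_singleton,
      mul_assoc, hτ.comm i j hd]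
  · have hd : (i : ℕ) + 1 = j := by
      have : (i : ℕ) < j := hij
      omega
    have e0 : j.castSucc = i.succ := Fin.ext (by simp [hd])
    have e1 : simpleReflection i j.succ = j.succ :=
      simpleReflection_apply_of_ne (by simp; omega) (by simp; omega)
    have e4 : simpleReflection j i.castSucc = i.castSucc :=
      simpleReflection_apply_of_ne (by simp; omega) (by simp; omega)
    have f1 : simpleReflection j i.succ = j.succ := by rw [← e0, simpleReflection_castSucc]
    have f2 : simpleReflection i j.castSucc = i.castSucc := by rw [e0, simpleReflection_succ]
    have f3 : simpleReflection j j.succ = i.succ := by rw [simpleReflection_succ, e0]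
    rw [e0] at hj
    obtain ⟨q, hq⟩ := exists_isReducedWord
      (u * simpleReflection i * simpleReflection j * simpleReflection i)
    have q1 := isReducedWord_of_descent (isReducedWord_of_descent hq
      (by simpa [e4, f1, f2, e1] using hj)) (by simpa [e1, f2] using hj.trans hi)
    have hq' : IsReducedWord q
        (u * simpleReflection j * simpleReflection i * simpleReflection j) := by
      simpa only [mul_assoc, simpleReflection_braid hd] using
        (show IsReducedWord q (u * (simpleReflection i * simpleReflection j * simpleReflection i))
          by simpa only [mul_assoc] using hq)
    have q2 := isReducedWord_of_descent (isReducedWord_of_descent hq'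
      (by simpa [e4, f1, f2, e1, f3, e0] using hi)) (by simpa [e4, f1] using hj.trans hi)
    rw [ih _ _ _ hlen h1 q1, ih _ _ _ hlen' h2 q2]
    simp only [List.map_append, List.prod_append, List.map_singleton, List.prod_singleton]
    have := hτ.braid i j hd
    simp only [mul_assoc] at this ⊢
    rw [this]

theorem SatisfiesBraid.prod_eq (hτ : SatisfiesBraid τ) (k : ℕ) :
    ∀ (l l' : List (Fin r)) (u : Weyl r), l.length = k → IsReducedWord l u →
      IsReducedWord l' u → (l.map τ).prod = (l'.map τ).prod := by
  induction k with
  | zero =>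
    intro l l' u hlen hl hl'
    have h0 : l'.length = 0 := by rw [hl'.2, ← hl.2, hlen]
    rw [List.length_eq_zero_iff.1 hlen, List.length_eq_zero_iff.1 h0]
  | succ k ih =>
    intro l l' u hlen hl hl'
    have h0 : l'.length = k + 1 := by rw [hl'.2, ← hl.2, hlen]
    rcases List.eq_nil_or_concat' l with rfl | ⟨l1, i, rfl⟩
    · simp at hlen
    rcases List.eq_nil_or_concat' l' with rfl | ⟨l2, j, rfl⟩
    · simp at h0
    simp only [List.length_append, List.length_singleton, Nat.add_right_cancel_iff] at hlen h0
    simp only [List.map_append, List.prod_append, List.map_singleton, List.prod_singleton]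
    rcases lt_trichotomy i j with h | rfl | h
    · exact hτ.prod_eq_aux ih hlen hl hl' h
    · rw [ih _ _ _ hlen hl.of_append.1 hl'.of_append.1]
    · exact (hτ.prod_eq_aux ih h0 hl' hl h).symm

/-- The product of `τ` along a reduced word. -/
def heckeProd (τ : Fin r → M) (u : Weyl r) : M := ((reducedWord u).map τ).prod

theorem reducedWord_spec (u : Weyl r) : IsReducedWord (reducedWord u) u :=
  (exists_isReducedWord u).choose_spec

theorem heckeProd_one : heckeProd τ (1 : Weyl r) = 1 := by
  have h := (reducedWord_spec (1 : Weyl r)).2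
  rw [len_one, List.length_eq_zero_iff] at h
  simp [heckeProd, h]

theorem heckeProd_mul (hτ : SatisfiesBraid τ) {u : Weyl r} {i : Fin r}
    (h : u i.castSucc < u i.succ) :
    heckeProd τ (u * simpleReflection i) = heckeProd τ u * τ i := by
  have := hτ.prod_eq _ _ _ _ rfl (reducedWord_spec (u * simpleReflection i))
    ((reducedWord_spec u).append h)
  rw [heckeProd, this]
  simp [heckeProd]

end Reduced

/-! ### Transpositions and the length -/

/-- Induction on `b - a`, conjugating the transposition by `σ_a`, so that `u (a b) = z σ_a` with `z
= u σ_a (a+1 b)`. If `u` ascends at `a`, then `z` has length at least `len u + 2` and the last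
letter loses at most one. If `u` descends at `a`, then `u σ_a` is one shorter than `u`, but `z`
ascends at `a` and the last letter adds one. -/
theorem len_lt_len_mul_swap (k : ℕ) : ∀ (u : Weyl r) (a b : Fin (r + 1)), (a : ℕ) + k + 1 = b →
    u a < u b → len u < len (u * Equiv.swap a b) := by
  induction k with
  | zero =>
    intro u a b hab h
    have ha : (a : ℕ) < r := by omega
    have h1 : a = (⟨a, ha⟩ : Fin r).castSucc := rfl
    have h2 : b = (⟨a, ha⟩ : Fin r).succ := Fin.ext (by simp; omega)
    rw [h1, h2] at h ⊢
    have := len_mul_simpleReflection h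
    unfold simpleReflection at this
    omega
  | succ k ih =>
    intro u a b hab h
    have ha : (a : ℕ) < r := by omega
    set i : Fin r := ⟨a, ha⟩ with hi
    have h1 : a = i.castSucc := rfl
    set a' : Fin (r + 1) := i.succ with ha'
    have h2 : (a' : ℕ) + k + 1 = b := by simp [ha', hi]; omega
    have hb : simpleReflection i b = b := simpleReflection_apply_of_ne (by simp [hi]; omega)
      (by simp [hi]; omega)
    have hconj : u * Equiv.swap a b =
        u * simpleReflection i * Equiv.swap a' b * simpleReflection i := by
      have : Equiv.swap a b = simpleReflection i * Equiv.swap a' b * simpleReflection i := by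
        have h3 := Equiv.mul_swap_eq_swap_mul (simpleReflection i) a' b
        rw [hb, ha', simpleReflection_succ] at h3
        rw [h3, mul_assoc, simpleReflection_mul_self, mul_one, ← h1]
      rw [this]; simp only [mul_assoc]
    set z := u * simpleReflection i * Equiv.swap a' b with hz
    have hlt := ih (u * simpleReflection i) a' b h2 (by simpa [hb, ha', ← h1] using h)
    have hab' : a ≠ b := by intro e; rw [e] at hab; omega
    have haa' : a ≠ a' := by rw [h1]; exact Fin.castSucc_lt_succ.ne
    have hza : z i.castSucc = u i.succ := by
      simp [hz, ← h1, Equiv.swap_apply_of_ne_of_ne haa' hab']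
      rw [h1, simpleReflection_castSucc]
    have hzs : z i.succ = u b := by simp [hz, ← ha', hb]
    rw [hconj]
    rw [← hz] at hlt
    rcases lt_or_lt_apply u i with h4 | h4
    · rw [len_mul_simpleReflection h4] at hlt
      rcases lt_or_lt_apply z i with h5 | h5
      · have := len_mul_simpleReflection h5; omega
      · have := len_mul_simpleReflection' h5; omega
    · have h6 := len_mul_simpleReflection' h4
      have h7 : z i.castSucc < z i.succ := by rw [hza, hzs]; exact h4.trans h
      have := len_mul_simpleReflection h7
      omega

theorem apply_lt_of_len_lt {x y : Weyl r} {a b : Fin (r + 1)} (hab : a < b)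
    (hy : y = x * Equiv.swap a b) (hlen : len x < len y) : x a < x b := by
  refine (lt_or_gt_of_ne (x.injective.ne hab.ne)).resolve_right fun h ↦ ?_
  have := len_lt_len_mul_swap ((b : ℕ) - a - 1) y a b (by have : (a : ℕ) < b := hab; omega)
    (by simpa [hy] using h)
  rw [hy, mul_assoc, Equiv.swap_mul_self, mul_one, ← hy] at this
  omega

end

/-! ### Factorization of the Bruhat interval below a beginning section. -/

section

variable {r : ℕ}

/-! ### Parabolic subgroups and beginning sections -/

/-- Extend a family indexed by the simple reflections to all natural numbers. -/
def natFam {M : Type*} [One M] (f : Fin r → M) (i : ℕ) : M := if h : i < r then f ⟨i, h⟩ else 1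

/-- The product `f m * f (m - 1) * ⋯ * f j`. -/
def descProd {M : Type*} [Monoid M] (f : ℕ → M) (m j : ℕ) : M :=
  ((List.range' j (m + 1 - j)).reverse.map f).prod

theorem descProd_self {M : Type*} [Monoid M] (f : ℕ → M) (m : ℕ) : descProd f m (m + 1) = 1 := by
  simp [descProd]

theorem descProd_of_le {M : Type*} [Monoid M] (f : ℕ → M) {m j : ℕ} (h : j ≤ m) :
    descProd f m j = descProd f m (j + 1) * f j := by
  unfold descProd
  rw [show m + 1 - j = (m + 1 - (j + 1)) + 1 by omega, List.range'_succ]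
  simp

theorem natFam_of_lt {M : Type*} [One M] (f : Fin r → M) (i : Fin r) : natFam f i = f i := by
  simp [natFam]

/-- The element `σ_m σ_{m-1} ⋯ σ_j`. -/
def cycleEl (m j : ℕ) : Weyl r := descProd (natFam simpleReflection) m j

theorem cycleEl_self (m : ℕ) : (cycleEl m (m + 1) : Weyl r) = 1 := descProd_self _ _

theorem cycleEl_of_le {m : ℕ} {j : Fin r} (h : (j : ℕ) ≤ m) :
    (cycleEl m j : Weyl r) = cycleEl m (j + 1) * simpleReflection j := by
  unfold cycleEl
  rw [descProd_of_le _ h, natFam_of_lt]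

theorem cycleEl_apply {m : ℕ} (hm : m < r) (k : ℕ) : ∀ j, j + k = m + 1 →
    (∀ a : Fin (r + 1), ((a : ℕ) < j ∨ m + 1 < a) → (cycleEl m j : Weyl r) a = a) ∧
    (∀ a : Fin (r + 1), (a : ℕ) = j → ((cycleEl m j : Weyl r) a : ℕ) = m + 1) := by
  induction k with
  | zero =>
    intro j hj
    obtain rfl : j = m + 1 := by omega
    rw [cycleEl_self]
    exact ⟨fun a _ ↦ rfl, fun a h ↦ h⟩
  | succ k ih =>
    intro j hj
    obtain ⟨h1, h2⟩ := ih (j + 1) (by omega)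
    have hjr : j < r := by omega
    have e := cycleEl_of_le (j := (⟨j, hjr⟩ : Fin r)) (m := m) (by simp; omega)
    simp only at e
    rw [e]
    constructor
    · intro a ha
      rw [Equiv.Perm.mul_apply, simpleReflection_apply_of_ne (by simp; omega) (by simp; omega),
        h1 a (by omega)]
    · intro a ha
      rw [Equiv.Perm.mul_apply]
      apply h2
      rw [simpleReflection_val, if_pos ha]

theorem cycleEl_apply_of_notMem {m j : ℕ} (hm : m < r) (hj : j ≤ m + 1) {a : Fin (r + 1)}
    (ha : (a : ℕ) < j ∨ m + 1 < a) : (cycleEl m j : Weyl r) a = a :=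
  (cycleEl_apply hm (m + 1 - j) j (by omega)).1 a ha

theorem cycleEl_apply_start {m j : ℕ} (hm : m < r) (hj : j ≤ m + 1) {a : Fin (r + 1)}
    (ha : (a : ℕ) = j) : ((cycleEl m j : Weyl r) a : ℕ) = m + 1 :=
  (cycleEl_apply hm (m + 1 - j) j (by omega)).2 a ha

/-- The permutations of `{0, …, m}`. -/
def parabolic (r m : ℕ) : Finset (Weyl r) :=
  Finset.univ.filter fun u ↦ ∀ a : Fin (r + 1), m < (a : ℕ) → u a = a

theorem mem_parabolic {m : ℕ} {u : Weyl r} :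
    u ∈ parabolic r m ↔ ∀ a : Fin (r + 1), m < (a : ℕ) → u a = a := by simp [parabolic]

/-- The elements `u σ_m ⋯ σ_j` with `u` a permutation of `{0, …, m}` and `c ≤ j ≤ m + 1`. -/
def sectionSet (r m c : ℕ) : Finset (Weyl r) :=
  (parabolic r (m + 1)).filter fun u ↦ ∀ a : Fin (r + 1), (u a : ℕ) = m + 1 → c ≤ (a : ℕ)

theorem mem_sectionSet {m c : ℕ} {u : Weyl r} :
    u ∈ sectionSet r m c ↔ (∀ a : Fin (r + 1), m + 1 < (a : ℕ) → u a = a) ∧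
      ∀ a : Fin (r + 1), (u a : ℕ) = m + 1 → c ≤ (a : ℕ) := by
  simp [sectionSet, mem_parabolic]

theorem sectionSet_zero (m : ℕ) : sectionSet r m 0 = parabolic r (m + 1) := by
  ext u; simp [mem_sectionSet, mem_parabolic]

theorem parabolic_zero : parabolic r 0 = {1} := by
  ext u
  rw [mem_parabolic, Finset.mem_singleton]
  constructor
  · intro h
    refine Equiv.ext fun a ↦ ?_
    by_contra hne
    have ha : ¬ 0 < (a : ℕ) := fun h0 ↦ hne (h a h0)
    have h1 : 0 < (u a : ℕ) := by
      rw [Nat.pos_iff_ne_zero]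
      intro h0
      apply hne
      rw [Equiv.Perm.one_apply, Fin.ext_iff, h0]
      omega
    exact hne (u.injective (h _ h1))
  · rintro rfl a _; rfl

theorem mul_cycleEl_mem {m c j : ℕ} (hm : m < r) (hcj : c ≤ j) (hj : j ≤ m + 1) {u : Weyl r}
    (hu : u ∈ parabolic r m) : u * cycleEl m j ∈ sectionSet r m c := by
  rw [mem_parabolic] at hu
  rw [mem_sectionSet]
  constructor
  · intro a ha
    rw [Equiv.Perm.mul_apply, cycleEl_apply_of_notMem hm hj (Or.inr ha), hu a (by omega)]
  · intro a ha
    set b : Fin (r + 1) := ⟨j, by omega⟩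
    have h1 := cycleEl_apply_start hm hj (a := b) rfl
    have h2 : u (cycleEl m j b) = cycleEl m j b := hu _ (by omega)
    have : (u * cycleEl m j : Weyl r) a = (u * cycleEl m j : Weyl r) b :=
      Fin.ext (by rw [ha, Equiv.Perm.mul_apply, h2, h1])
    rw [(u * cycleEl m j : Weyl r).injective this]
    exact hcj

/-- The index `j` is the position at which `u` takes the value `m + 1`: `cycleEl m j` sends `j` to
`m + 1`, so dividing by it on the right leaves a permutation fixing `m + 1`. -/
theorem exists_eq_mul_cycleEl {m c : ℕ} (hm : m < r) {u : Weyl r} (hu : u ∈ sectionSet r m c) :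
    ∃ u' ∈ parabolic r m, ∃ j, c ≤ j ∧ j ≤ m + 1 ∧ u = u' * cycleEl m j := by
  rw [mem_sectionSet] at hu
  set b : Fin (r + 1) := ⟨m + 1, by omega⟩
  set p := u⁻¹ b
  have hp : u p = b := by simp [p]
  have hp1 : (p : ℕ) ≤ m + 1 := by
    by_contra h
    have := hu.1 p (by omega)
    rw [hp] at this
    rw [← this] at h
    exact h le_rfl
  refine ⟨u * (cycleEl m p)⁻¹, ?_, p, hu.2 p (by rw [hp]), hp1, by simp⟩
  rw [mem_parabolic]
  intro a ha
  rw [Equiv.Perm.mul_apply]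
  rcases Nat.lt_or_ge (m + 1) a with h | h
  · have : (cycleEl m (p : ℕ))⁻¹ a = a := by
      rw [Equiv.Perm.inv_eq_iff_eq, cycleEl_apply_of_notMem hm hp1 (Or.inr h)]
    rw [this, hu.1 a h]
  · have hab : a = b := Fin.ext (by simp [b]; omega)
    have : (cycleEl m (p : ℕ))⁻¹ a = p := by
      rw [Equiv.Perm.inv_eq_iff_eq, hab, Fin.ext_iff, cycleEl_apply_start hm hp1 rfl]
    rw [this, hp, hab]

theorem sum_sectionSet {A : Type*} [AddCommMonoid A] {m c : ℕ} (hm : m < r) (F : Weyl r → A) :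
    ∑ u ∈ sectionSet r m c, F u =
      ∑ u ∈ parabolic r m, ∑ j ∈ Finset.Icc c (m + 1), F (u * cycleEl m j) := by
  rw [← Finset.sum_product']
  symm
  refine Finset.sum_bij (fun p _ ↦ p.1 * cycleEl m p.2) ?_ ?_ ?_ ?_
  · rintro ⟨u, j⟩ hp
    simp only [Finset.mem_product, Finset.mem_Icc] at hp
    exact mul_cycleEl_mem hm hp.2.1 hp.2.2 hp.1
  · rintro ⟨u, j⟩ hp ⟨u', j'⟩ hp' h
    simp only [Finset.mem_product, Finset.mem_Icc] at hp hp' h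
    have key : ∀ {u u' : Weyl r} {j j' : ℕ}, u ∈ parabolic r m → u' ∈ parabolic r m →
        j ≤ m + 1 → j' ≤ m + 1 → u * cycleEl m j = u' * cycleEl m j' → j' ≤ j := by
      intro u u' j j' hu hu' hj hj' h
      have h1 := mul_cycleEl_mem hm le_rfl hj' hu'
      rw [mem_sectionSet] at h1
      refine h1.2 ⟨j, by omega⟩ ?_
      rw [← h, Equiv.Perm.mul_apply]
      have h2 := cycleEl_apply_start hm hj (a := (⟨j, by omega⟩ : Fin (r + 1))) rfl
      rw [mem_parabolic.1 hu _ (by omega), h2]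
    obtain rfl : j = j' := le_antisymm (key hp'.1 hp.1 hp'.2.2 hp.2.2 h.symm)
      (key hp.1 hp'.1 hp.2.2 hp'.2.2 h)
    rw [mul_right_cancel h]
  · intro u hu
    obtain ⟨u', hu', j, h1, h2, rfl⟩ := exists_eq_mul_cycleEl hm hu
    exact ⟨(u', j), by simp [hu', h1, h2], rfl⟩
  · rintro ⟨u, j⟩ _; rfl

/-- At position `j` the value is at most `m`, at position `j + 1` it is `m + 1`. Every further
letter of `σ_m ⋯ σ_j` therefore increases the length, which is what makes lengths add and products
`τ_u` factor below. -/
theorem mul_cycleEl_ascent {m : ℕ} (hm : m < r) {u : Weyl r} (hu : u ∈ parabolic r m) {j : Fin r}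
    (hj : (j : ℕ) ≤ m) : (u * cycleEl m (j + 1) : Weyl r) j.castSucc < (u * cycleEl m (j + 1) : Weyl r) j.succ := by
  rw [mem_parabolic] at hu
  rw [Equiv.Perm.mul_apply, Equiv.Perm.mul_apply,
    cycleEl_apply_of_notMem hm (by omega) (Or.inl (by simp)), Fin.lt_def]
  have h1 := cycleEl_apply_start hm (j := (j : ℕ) + 1) (by omega) (a := j.succ) (by simp)
  rw [hu (cycleEl m _ j.succ) (by omega), h1]
  by_contra h
  have h2 := u.injective (hu (u j.castSucc) (by omega))
  rw [h2] at h
  simp at h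
  omega

theorem len_mul_cycleEl {m : ℕ} (hm : m < r) {u : Weyl r} (hu : u ∈ parabolic r m) (k : ℕ) :
    ∀ j, j + k = m + 1 → len (u * cycleEl m j) = len u + k := by
  induction k with
  | zero =>
    intro j hj
    obtain rfl : j = m + 1 := by omega
    rw [cycleEl_self, mul_one, add_zero]
  | succ k ih =>
    intro j hj
    have hjr : j < r := by omega
    have e := cycleEl_of_le (j := (⟨j, hjr⟩ : Fin r)) (m := m) (by simp; omega)
    simp only at e
    rw [e, ← mul_assoc,
      len_mul_simpleReflection (mul_cycleEl_ascent hm hu (j := ⟨j, hjr⟩) (by simp; omega)),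
      ih (j + 1) (by omega), add_assoc]

theorem heckeProd_mul_cycleEl {M : Type*} [Monoid M] {τ : Fin r → M} (hτ : SatisfiesBraid τ)
    {m : ℕ} (hm : m < r) {u : Weyl r} (hu : u ∈ parabolic r m) (k : ℕ) :
    ∀ j, j + k = m + 1 →
      heckeProd τ (u * cycleEl m j) = heckeProd τ u * descProd (natFam τ) m j := by
  induction k with
  | zero =>
    intro j hj
    obtain rfl : j = m + 1 := by omega
    rw [cycleEl_self, mul_one, descProd_self, mul_one]
  | succ k ih =>
    intro j hj
    have hjr : j < r := by omega
    have e := cycleEl_of_le (j := (⟨j, hjr⟩ : Fin r)) (m := m) (by simp; omega)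
    have e2 := natFam_of_lt τ ⟨j, hjr⟩
    simp only at e e2
    rw [e, ← mul_assoc,
      heckeProd_mul hτ (mul_cycleEl_ascent hm hu (j := ⟨j, hjr⟩) (by simp; omega)),
      ih (j + 1) (by omega), descProd_of_le (j := j) _ (by omega), e2, mul_assoc]

/-- The sum of all `τ_u` over the permutations `u` of `{0, …, m}`. -/
def parabolicSum {M : Type*} [Ring M] (τ : Fin r → M) (m : ℕ) : M :=
  ∑ u ∈ parabolic r m, heckeProd τ u

section Sums

variable {M : Type*} [Ring M] {τ : Fin r → M}

theorem parabolicSum_zero : parabolicSum τ 0 = 1 := by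
  simp [parabolicSum, parabolic_zero, heckeProd_one]

theorem sum_sectionSet_heckeProd (hτ : SatisfiesBraid τ) {m c : ℕ} (hm : m < r) :
    ∑ u ∈ sectionSet r m c, heckeProd τ u =
      parabolicSum τ m * ∑ j ∈ Finset.Icc c (m + 1), descProd (natFam τ) m j := by
  rw [sum_sectionSet hm, parabolicSum, Finset.sum_mul]
  refine Finset.sum_congr rfl fun u hu ↦ ?_
  rw [Finset.mul_sum]
  refine Finset.sum_congr rfl fun j hj ↦ ?_
  rw [Finset.mem_Icc] at hj
  exact heckeProd_mul_cycleEl hτ hm hu (m + 1 - j) j (by omega)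

theorem parabolicSum_succ (hτ : SatisfiesBraid τ) {m : ℕ} (hm : m < r) :
    parabolicSum τ (m + 1) =
      parabolicSum τ m * ∑ j ∈ Finset.Icc 0 (m + 1), descProd (natFam τ) m j := by
  rw [← sum_sectionSet_heckeProd hτ hm, sectionSet_zero, parabolicSum]

/-- Pair each `u` ascending at `i` with `u σ_i`. Since `i < m` the parabolic subgroup is stable
under this, and a pair contributes `τ_u (1 + τ_i)`. -/
theorem exists_parabolicSum_eq (hτ : SatisfiesBraid τ) {m : ℕ} {i : Fin r} (hi : (i : ℕ) < m) :
    ∃ F : M, parabolicSum τ m = F * (1 + τ i) := by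
  refine ⟨∑ u ∈ (parabolic r m).filter fun u ↦ u i.castSucc < u i.succ, heckeProd τ u, ?_⟩
  have hmul : ∀ u ∈ parabolic r m, u * simpleReflection i ∈ parabolic r m := by
    intro u hu
    rw [mem_parabolic] at hu ⊢
    intro a ha
    rw [Equiv.Perm.mul_apply, simpleReflection_apply_of_ne (by omega) (by omega), hu a ha]
  rw [parabolicSum, ← Finset.sum_filter_add_sum_filter_not (parabolic r m)
    (fun u ↦ u i.castSucc < u i.succ), mul_add, mul_one, Finset.sum_mul]
  congr 1
  symm
  refine Finset.sum_nbij' (fun u ↦ u * simpleReflection i) (fun u ↦ u * simpleReflection i)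
    ?_ ?_ ?_ ?_ ?_
  · intro u hu
    rw [Finset.mem_filter] at hu ⊢
    exact ⟨hmul u hu.1, by simpa using hu.2.le⟩
  · intro u hu
    rw [Finset.mem_filter] at hu ⊢
    exact ⟨hmul u hu.1, by simpa using (lt_or_lt_apply u i).resolve_left hu.2⟩
  · intro u _; simp [mul_assoc]
  · intro u _; simp [mul_assoc]
  · intro u hu
    rw [Finset.mem_filter] at hu
    rw [heckeProd_mul hτ hu.2]

end Sums

/-! ### Bruhat intervals -/

theorem swap_step {x y : Weyl r} (h : (∃ a b : Fin (r + 1), a ≠ b ∧ y = x * Equiv.swap a b) ∧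
    len x < len y) : ∃ a b : Fin (r + 1), a < b ∧ x a < x b ∧ y = x * Equiv.swap a b := by
  obtain ⟨⟨a, b, hab, hy⟩, hlen⟩ := h
  rcases lt_or_gt_of_ne hab with h | h
  · exact ⟨a, b, h, apply_lt_of_len_lt h hy hlen, hy⟩
  · rw [Equiv.swap_comm] at hy
    exact ⟨b, a, h, apply_lt_of_len_lt h hy hlen, hy⟩

theorem parabolic_of_step {m : ℕ} {x y : Weyl r} {a b : Fin (r + 1)} (hab : a < b)
    (hx : x a < x b) (hy : y = x * Equiv.swap a b) (hm : y ∈ parabolic r m) :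
    x ∈ parabolic r m ∧ (b : ℕ) ≤ m := by
  rw [mem_parabolic] at hm
  have h1 : y a = x b := by simp [hy]
  have h2 : y b = x a := by simp [hy]
  have hb : (b : ℕ) ≤ m := by
    by_contra h
    have h3 := hm b (by omega)
    rw [h2] at h3
    rw [h3, ← h1] at hx
    have h4 := y.injective (hm (y a) (by have : (b : ℕ) < y a := hx; omega))
    rw [h4] at hx
    exact lt_asymm hx hab
  refine ⟨?_, hb⟩
  rw [mem_parabolic]
  intro e he
  have := hm e he
  have hab' : (a : ℕ) < b := hab
  rwa [hy, Equiv.Perm.mul_apply, Equiv.swap_apply_of_ne_of_ne] at this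
  · rintro rfl; omega
  · rintro rfl; omega

/-- A downward Bruhat step puts the larger of two values at the larger of the two positions, so the
position of the value `m + 1` can only move to the right. -/
theorem sectionSet_of_step {m c : ℕ} {x y : Weyl r} {a b : Fin (r + 1)} (hab : a < b)
    (hx : x a < x b) (hy : y = x * Equiv.swap a b) (hm : y ∈ sectionSet r m c) :
    x ∈ sectionSet r m c := by
  rw [sectionSet, Finset.mem_filter] at hm ⊢
  obtain ⟨h1, h2⟩ := parabolic_of_step hab hx hy hm.1
  refine ⟨h1, fun e he ↦ ?_⟩
  have hab' : (a : ℕ) < b := hab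
  by_cases hea : e = a
  · subst hea
    have h4 : (x b : ℕ) ≤ m + 1 := by
      by_contra h
      have := x.injective (mem_parabolic.1 h1 (x b) (by omega))
      rw [this] at h
      omega
    have : (x e : ℕ) < x b := hx
    omega
  · by_cases heb : e = b
    · subst heb
      have := hm.2 a (by rw [hy]; simpa using he)
      omega
    · apply hm.2
      rw [hy, Equiv.Perm.mul_apply, Equiv.swap_apply_of_ne_of_ne hea heb, he]

theorem sectionSet_of_bruhatLE {m c : ℕ} {x y : Weyl r} (h : BruhatLE x y)
    (hy : y ∈ sectionSet r m c) : x ∈ sectionSet r m c := by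
  induction h using Relation.ReflTransGen.head_induction_on with
  | refl => exact hy
  | head hstep _ ih =>
    obtain ⟨a, b, hab, hx, h⟩ := swap_step hstep
    exact sectionSet_of_step hab hx h ih

/-- Right multiplication by `cycleEl m j` conjugates the reflection of each step and adds the same
amount to the length at both ends of it. -/
theorem BruhatLE.mul_cycleEl {m j : ℕ} (hm : m < r) (hj : j ≤ m + 1) {x y : Weyl r}
    (h : BruhatLE x y) (hy : y ∈ parabolic r m) :
    x ∈ parabolic r m ∧ BruhatLE (x * cycleEl m j) (y * cycleEl m j) := by
  induction h using Relation.ReflTransGen.head_induction_on with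
  | refl => exact ⟨hy, .refl⟩
  | @head x z hstep _ ih =>
    obtain ⟨a, b, hab, hx, h⟩ := swap_step hstep
    have hxp := (parabolic_of_step hab hx h ih.1).1
    refine ⟨hxp, .head ⟨⟨(cycleEl m j)⁻¹ a, (cycleEl m j)⁻¹ b, ?_, ?_⟩, ?_⟩ ih.2⟩
    · exact (cycleEl m j)⁻¹.injective.ne hab.ne
    · have := Equiv.mul_swap_eq_swap_mul (cycleEl m j : Weyl r) ((cycleEl m j)⁻¹ a)
        ((cycleEl m j)⁻¹ b)
      rw [← Equiv.Perm.mul_apply, ← Equiv.Perm.mul_apply, mul_inv_cancel, Equiv.Perm.one_apply,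
        Equiv.Perm.one_apply] at this
      rw [mul_assoc, this, h, mul_assoc]
    · rw [len_mul_cycleEl hm hxp (m + 1 - j) j (by omega),
        len_mul_cycleEl hm ih.1 (m + 1 - j) j (by omega)]
      have := hstep.2
      omega

theorem bruhatLE_mul_cycleEl {m c : ℕ} (hm : m < r) {u : Weyl r} (hu : u ∈ parabolic r m) (k : ℕ) :
    c + k ≤ m + 1 → BruhatLE (u * cycleEl m (c + k)) (u * cycleEl m c) := by
  induction k with
  | zero => intro _; exact .refl
  | succ k ih =>
    intro hk
    refine .head ?_ (ih (by omega))
    have hjr : c + k < r := by omega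
    have e := cycleEl_of_le (j := (⟨c + k, hjr⟩ : Fin r)) (m := m) (by simp; omega)
    simp only at e
    have h1 := len_mul_cycleEl hm hu (m + 1 - (c + k)) (c + k) (by omega)
    have h2 := len_mul_cycleEl hm hu (m + 1 - (c + (k + 1))) (c + (k + 1)) (by omega)
    refine ⟨⟨_, _, (Fin.castSucc_lt_succ (i := ⟨c + k, hjr⟩)).ne, ?_⟩, by omega⟩
    rw [e, ← mul_assoc]
    rfl

/-- The longest permutation of `{0, …, m}`. -/
def topEl : ℕ → Weyl r
  | 0 => 1
  | m + 1 => topEl m * cycleEl m 0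

theorem topEl_mem {m : ℕ} (hm : m ≤ r) : (topEl m : Weyl r) ∈ parabolic r m := by
  induction m with
  | zero => simp [topEl, parabolic_zero]
  | succ m ih =>
    rw [← sectionSet_zero]
    exact mul_cycleEl_mem (by omega) le_rfl (by omega) (ih (by omega))

theorem bruhatLE_topEl_mul {m c : ℕ} (hm : m < r)
    (ih : ∀ u ∈ parabolic r m, BruhatLE u (topEl m)) {u : Weyl r} (hu : u ∈ sectionSet r m c) :
    BruhatLE u (topEl m * cycleEl m c) := by
  obtain ⟨u', hu', j, h1, h2, rfl⟩ := exists_eq_mul_cycleEl hm hu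
  obtain ⟨k, rfl⟩ := Nat.exists_eq_add_of_le h1
  exact ((ih u' hu').mul_cycleEl hm h2 (topEl_mem hm.le)).2.trans
    (bruhatLE_mul_cycleEl hm (topEl_mem hm.le) k h2)

theorem bruhatLE_topEl {m : ℕ} (hm : m ≤ r) : ∀ u ∈ parabolic r m, BruhatLE u (topEl m) := by
  induction m with
  | zero =>
    intro u hu
    rw [parabolic_zero, Finset.mem_singleton] at hu
    subst hu
    exact .refl
  | succ m ih =>
    intro u hu
    rw [← sectionSet_zero] at hu
    exact bruhatLE_topEl_mul (by omega) (ih (by omega)) hu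

/-- One inclusion holds because `sectionSet` is closed under going down. For the other, enlarge the
left factor to `topEl m`, then extend `σ_m ⋯ σ_j` letter by letter to `σ_m ⋯ σ_c`. -/
theorem bruhatInterval_topEl_mul {m c : ℕ} (hm : m < r) (hc : c ≤ m + 1) :
    bruhatInterval (topEl m * cycleEl m c : Weyl r) = sectionSet r m c := by
  classical
  ext u
  rw [bruhatInterval, Finset.mem_filter]
  constructor
  · rintro ⟨_, h⟩
    exact sectionSet_of_bruhatLE h (mul_cycleEl_mem hm le_rfl hc (topEl_mem hm.le))
  · intro h
    exact ⟨Finset.mem_univ _, bruhatLE_topEl_mul hm (bruhatLE_topEl hm.le) h⟩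

theorem len_topEl {m : ℕ} (hm : m ≤ r) : len (topEl m : Weyl r) = (m + 1).choose 2 := by
  induction m with
  | zero => simp [topEl, len_one]
  | succ m ih =>
    rw [topEl, len_mul_cycleEl (by omega) (topEl_mem (by omega)) (m + 1) 0 (by omega),
      ih (by omega), Nat.choose_succ_succ' (m + 1) 1, Nat.choose_one_right, add_comm]

/-! ### The long word -/

/-- The long word with letters in the natural numbers. -/
def longWordNat : ℕ → List ℕ
  | 0 => []
  | m + 1 => longWordNat m ++ (List.range' 0 (m + 1)).reverse

theorem map_val_longWord (r : ℕ) : (longWord r).map Fin.val = longWordNat r := by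
  induction r with
  | zero => rfl
  | succ r ih =>
    rw [longWord, longWordNat, List.map_append, List.map_map, List.map_reverse, ← ih]
    congr 2
    rw [List.map_coe_finRange_eq_range, List.range_eq_range']

theorem length_longWordNat (m : ℕ) : (longWordNat m).length = (m + 1).choose 2 := by
  induction m with
  | zero => rfl
  | succ m ih =>
    rw [longWordNat, List.length_append, ih, Nat.choose_succ_succ' (m + 1) 1,
      Nat.choose_one_right, add_comm]
    simp

theorem wordProd_eq_natFam (l : List (Fin r)) :
    wordProd l = ((l.map Fin.val).map (natFam simpleReflection)).prod := by
  rw [wordProd, List.map_map]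
  congr 2
  funext i
  exact (natFam_of_lt _ i).symm

theorem prod_longWordNat (m : ℕ) :
    ((longWordNat m).map (natFam simpleReflection)).prod = (topEl m : Weyl r) := by
  induction m with
  | zero => rfl
  | succ m ih =>
    rw [longWordNat, List.map_append, List.prod_append, ih, topEl]
    rfl

theorem longElement_eq : longElement r = topEl r := by
  rw [longElement, wordProd_eq_natFam, map_val_longWord, prod_longWordNat]

/-- An initial part of the long word is some number of full blocks followed by a block cut off at
the letter `c`; `c = m + 1` means that nothing of the last block is taken. -/
theorem exists_take_longWordNat {r : ℕ} (hr : 0 < r) {l : ℕ} (hl : l ≤ (r + 1).choose 2) :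
    ∃ m c, m < r ∧ c ≤ m + 1 ∧
      (longWordNat r).take l = longWordNat m ++ (List.range' c (m + 1 - c)).reverse := by
  induction r with
  | zero => omega
  | succ r ih =>
    by_cases h : l ≤ (r + 1).choose 2 ∧ 0 < r
    · obtain ⟨m, c, h1, h2, h3⟩ := ih h.2 h.1
      refine ⟨m, c, by omega, h2, ?_⟩
      rw [longWordNat, List.take_append_of_le_length (by rw [length_longWordNat]; exact h.1), h3]
    · have h' : (r + 1).choose 2 ≤ l := by
        by_contra h0
        have hr : r = 0 := by
          by_contra h1
          exact h ⟨by omega, by omega⟩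
        subst hr
        simp at h0
      rw [Nat.choose_succ_succ' (r + 1) 1, Nat.choose_one_right] at hl
      obtain ⟨k, rfl⟩ := Nat.exists_eq_add_of_le h'
      refine ⟨r, r + 1 - k, by omega, by omega, ?_⟩
      rw [longWordNat, ← length_longWordNat, List.take_length_add_append, List.take_reverse,
        List.drop_range', List.length_range']
      congr 3; omega

theorem exists_beginningSection (hr : 0 < r) {w : Weyl r} (hw : IsBeginningSection w) :
    ∃ m c, m < r ∧ c ≤ m + 1 ∧ w = topEl m * cycleEl m c := by
  obtain ⟨l, hl, rfl⟩ := hw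
  obtain ⟨m, c, hm, hc, h⟩ := exists_take_longWordNat hr hl
  refine ⟨m, c, hm, hc, ?_⟩
  rw [wordProd_eq_natFam, List.map_take, map_val_longWord, h, List.map_append, List.prod_append,
    prod_longWordNat]
  rfl

theorem len_topEl_mul {m c : ℕ} (hm : m < r) (hc : c ≤ m + 1) :
    len (topEl m * cycleEl m c : Weyl r) = (m + 1).choose 2 + (m + 1 - c) := by
  rw [len_mul_cycleEl hm (topEl_mem hm.le) (m + 1 - c) c (by omega), len_topEl hm.le]

end

/-! ### Monomials, and the operators on an invariant function times a monomial. -/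

section

variable {r n : ℕ}

/-! ### Monomials -/

theorem x_ne_zero (j : Fin (r + 1)) : (x j : RatFun r) ≠ 0 := by
  rw [x, Ne, FaithfulSMul.algebraMap_eq_zero_iff]
  exact MvPolynomial.X_ne_zero j

theorem xpow_add (μ ν : Weight r) : xpow (μ + ν) = xpow μ * xpow ν := by
  simp only [xpow, ← Finset.prod_mul_distrib, Pi.add_apply, zpow_add₀ (x_ne_zero _)]

@[simp] theorem xpow_zero : xpow (0 : Weight r) = 1 := by simp [xpow]

theorem xpow_ne_zero (μ : Weight r) : xpow μ ≠ 0 :=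
  Finset.prod_ne_zero_iff.2 fun j _ ↦ zpow_ne_zero _ (x_ne_zero j)

theorem xpow_neg (μ : Weight r) : xpow (-μ) = (xpow μ)⁻¹ := by
  apply eq_inv_of_mul_eq_one_left
  rw [← xpow_add, neg_add_cancel, xpow_zero]

theorem xpow_zsmul (k : ℤ) (μ : Weight r) : xpow (k • μ) = xpow μ ^ k := by
  simp only [xpow, ← Finset.prod_zpow, Pi.smul_apply, smul_eq_mul, mul_comm k, zpow_mul]

/-- The simple root `α_i`. -/
def root (i : Fin r) : Weight r := Pi.single i.castSucc 1 - Pi.single i.succ 1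

theorem xpow_single (j : Fin (r + 1)) (k : ℤ) : xpow (Pi.single j k : Weight r) = x j ^ k := by
  rw [xpow, Finset.prod_eq_single j]
  · simp
  · intro b _ hb; simp [Pi.single_eq_of_ne hb]
  · simp

theorem xpow_root (i : Fin r) : xpow (root i) = xroot i := by
  rw [root, sub_eq_add_neg, xpow_add, xpow_neg, xpow_single, xpow_single, xroot, zpow_one,
    zpow_one, div_eq_mul_inv]

theorem xroot_ne_zero (i : Fin r) : xroot i ≠ 0 := by
  rw [← xpow_root]; exact xpow_ne_zero _

theorem permAut_x (w : Weyl r) (j : Fin (r + 1)) : permAut w (x j) = x (w j) := by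
  simp [permAut, x]

theorem charAut_x (u : Fin (r + 1) → ℂˣ) (j : Fin (r + 1)) :
    charAut u (x j) = (u j : ℂ) • x j := by
  have h : scalePoly u (MvPolynomial.X j) = MvPolynomial.C (u j : ℂ) * MvPolynomial.X j :=
    MvPolynomial.aeval_X _ _
  rw [charAut, x, IsFractionRing.algEquivOfAlgEquiv_algebraMap, h, map_mul, Algebra.smul_def,
    IsScalarTower.algebraMap_apply ℂ (MvPolynomial (Fin (r + 1)) ℂ) (RatFun r)]
  rfl

theorem permAut_xpow (w : Weyl r) (μ : Weight r) : permAut w (xpow μ) = xpow (act w μ) := by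
  simp only [xpow, map_prod, map_zpow₀, permAut_x, act]
  exact Fintype.prod_equiv w _ _ fun j ↦ by simp

theorem charAut_xpow (u : Fin (r + 1) → ℂˣ) (μ : Weight r) :
    charAut u (xpow μ) = ((∏ j, u j ^ μ j : ℂˣ) : ℂ) • xpow μ := by
  simp only [xpow, map_prod, map_zpow₀, charAut_x, Algebra.smul_def, mul_zpow,
    Finset.prod_mul_distrib, Units.coe_prod, Units.val_zpow_eq_zpow_val]

theorem algHom_ext_x {f g : RatFun r →ₐ[ℂ] RatFun r} (h : ∀ j, f (x j) = g (x j)) : f = g := by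
  apply IsLocalization.algHom_ext (nonZeroDivisors (MvPolynomial (Fin (r + 1)) ℂ))
  apply MvPolynomial.algHom_ext
  intro j
  exact h j

theorem charAut_permAut (u : Fin (r + 1) → ℂˣ) (w : Weyl r) (p : RatFun r) :
    charAut u (permAut w p) = permAut w (charAut (u ∘ w) p) := by
  have : (charAut u).toAlgHom.comp (permAut w).toAlgHom =
      (permAut w).toAlgHom.comp (charAut (u ∘ w)).toAlgHom := by
    apply algHom_ext_x
    intro j
    change charAut u (permAut w (x j)) = permAut w (charAut (u ∘ w) (x j))
    rw [permAut_x, charAut_x, charAut_x, Algebra.smul_def, Algebra.smul_def, map_mul, permAut_x,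
      AlgEquiv.commutes, Function.comp_apply]
  exact DFunLike.congr_fun this p

theorem permAut_mul (w w' : Weyl r) (p : RatFun r) :
    permAut (w * w') p = permAut w (permAut w' p) := by
  have : (permAut (w * w')).toAlgHom = (permAut w).toAlgHom.comp (permAut w').toAlgHom := by
    apply algHom_ext_x
    intro j
    simp [permAut_x]
  exact DFunLike.congr_fun this p

theorem permAut_one (p : RatFun r) : permAut 1 p = p := by
  have : (permAut 1).toAlgHom = AlgHom.id ℂ (RatFun r) := by
    apply algHom_ext_x
    intro j
    simp [permAut_x]
  exact DFunLike.congr_fun this p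

theorem one_sub_mul_xroot_pow_ne_zero [NeZero n] (i : Fin r) (c : ℂ) :
    1 - algebraMap ℂ (RatFun r) c * xroot i ^ n ≠ 0 := by
  intro h
  have hne : i.castSucc ≠ i.succ := Fin.castSucc_lt_succ.ne
  rw [xroot, div_pow, sub_eq_zero, ← mul_div_assoc,
    eq_div_iff (pow_ne_zero n (x_ne_zero _)), one_mul,
    IsScalarTower.algebraMap_apply ℂ (MvPolynomial (Fin (r + 1)) ℂ), x, x, ← map_pow, ← map_pow,
    ← map_mul] at h
  have h1 := FaithfulSMul.algebraMap_injective _ _ h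
  -- At the point with `x_{i+1} = 1` and all other variables zero the identity reads `1 = 0`, since
  -- `n ≠ 0`.
  have h2 := congrArg (MvPolynomial.eval fun j ↦ if j = i.succ then (1 : ℂ) else 0) h1
  simp [hne, NeZero.ne n] at h2

/-! ### Invariants of the characters -/

/-- `p` has degree `0` in `Λ/Λ₀`. -/
abbrev IsInvariant (n : ℕ) (p : RatFun r) : Prop := IsHomogeneous n 0 p

theorem isInvariant_iff {p : RatFun r} : IsInvariant n p ↔ ∀ u : Fin (r + 1) → ℂˣ,
    (∀ μ ∈ Lambda0 r n, ∏ j, u j ^ μ j = 1) → charAut u p = p := by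
  simp [IsInvariant, IsHomogeneous]

section Invariant

variable {p q : RatFun r}

theorem IsHomogeneous.add {μ : Weight r} (hp : IsHomogeneous n μ p) (hq : IsHomogeneous n μ q) :
    IsHomogeneous n μ (p + q) := fun u hu ↦ by rw [map_add, hp u hu, hq u hu, smul_add]

theorem IsHomogeneous.sub {μ : Weight r} (hp : IsHomogeneous n μ p) (hq : IsHomogeneous n μ q) :
    IsHomogeneous n μ (p - q) := fun u hu ↦ by rw [map_sub, hp u hu, hq u hu, smul_sub]

theorem IsInvariant.sub (hp : IsInvariant n p) (hq : IsInvariant n q) : IsInvariant n (p - q) :=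
  IsHomogeneous.sub hp hq

theorem IsInvariant.mul (hp : IsInvariant n p) (hq : IsInvariant n q) : IsInvariant n (p * q) := by
  rw [isInvariant_iff] at *
  intro u hu
  rw [map_mul, hp u hu, hq u hu]

theorem IsInvariant.div (hp : IsInvariant n p) (hq : IsInvariant n q) : IsInvariant n (p / q) := by
  rw [isInvariant_iff] at *
  intro u hu
  rw [map_div₀, hp u hu, hq u hu]

theorem IsInvariant.zpow (hp : IsInvariant n p) (k : ℤ) : IsInvariant n (p ^ k) := by
  rw [isInvariant_iff] at *
  intro u hu
  rw [map_zpow₀, hp u hu]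

theorem isInvariant_algebraMap (c : ℂ) : IsInvariant n (algebraMap ℂ (RatFun r) c) := by
  rw [isInvariant_iff]
  intro u hu
  exact (charAut u).commutes c

theorem isInvariant_one : IsInvariant n (1 : RatFun r) := by
  simpa using isInvariant_algebraMap (r := r) (n := n) 1

theorem isInvariant_xpow {μ : Weight r} (h : μ ∈ Lambda0 r n) : IsInvariant n (xpow μ) := by
  rw [isInvariant_iff]
  intro u hu
  rw [charAut_xpow, hu μ h, Units.val_one, one_smul]

theorem isInvariant_xroot_pow (i : Fin r) : IsInvariant n (xroot i ^ n) := by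
  rw [← xpow_root, ← zpow_natCast, ← xpow_zsmul]
  apply isInvariant_xpow
  intro a b
  simp [Int.ModEq]

/-- Permuting the variables permutes the parameters of the character, and `Λ₀` is stable under
permutations. -/
theorem IsInvariant.permAut (hp : IsInvariant n p) (w : Weyl r) :
    IsInvariant n (permAut w p) := by
  rw [isInvariant_iff] at *
  intro u hu
  rw [charAut_permAut, hp]
  intro μ hμ
  have h1 : act w μ ∈ Lambda0 r n := fun a b ↦ hμ _ _
  rw [← hu _ h1]
  exact Fintype.prod_equiv w _ _ fun j ↦ by simp [act]

theorem IsInvariant.mul_xpow (hp : IsInvariant n p) (ν : Weight r) :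
    IsHomogeneous n ν (p * xpow ν) := by
  rw [isInvariant_iff] at hp
  intro u hu
  rw [map_mul, hp u hu, charAut_xpow, mul_smul_comm]

end Invariant

theorem act_simpleReflection (i : Fin r) (ν : Weight r) :
    act (simpleReflection i) ν = ν + (ν i.succ - ν i.castSucc) • root i := by
  have hne : i.succ ≠ i.castSucc := Fin.castSucc_lt_succ.ne'
  funext j
  have hinv : (simpleReflection i)⁻¹ = simpleReflection i :=
    inv_eq_of_mul_eq_one_left (simpleReflection_mul_self i)
  simp only [act, hinv, Pi.add_apply, Pi.smul_apply, root, Pi.sub_apply, smul_eq_mul]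
  by_cases h1 : j = i.castSucc
  · subst h1
    simp [hne.symm]
  · by_cases h2 : j = i.succ
    · subst h2
      simp [hne]
    · have h3 : (j : ℕ) ≠ i := fun h ↦ h1 (Fin.ext h)
      have h4 : (j : ℕ) ≠ i + 1 := fun h ↦ h2 (Fin.ext h)
      simp [simpleReflection_apply_of_ne h3 h4, h1, h2]

theorem permAut_simple_xpow (i : Fin r) (ν : Weight r) :
    permAut (simpleReflection i) (xpow ν) =
      xroot i ^ (ν i.succ - ν i.castSucc) * xpow ν := by
  rw [permAut_xpow, act_simpleReflection, xpow_add, xpow_zsmul, xpow_root, mul_comm]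

/-- Invariance of `p` means that `p x^ν` is homogeneous of the same degree as `x^ν`, so the action
uses the bracket of `ν`. Since `σ_i` moves `p`, both `p` and `σ_i p` appear. Such products are
needed because the coefficients produced by one operator are again invariant, so that operators can
be iterated. -/
theorem demazureLusztigSimple_apply [NeZero n] (P : Parameters n) (i : Fin r) {p : RatFun r}
    (hp : IsInvariant n p) (ν : Weight r) :
    demazureLusztigSimple P i (p * xpow ν) =
      (1 - algebraMap ℂ _ P.v) * xroot i ^ n *
        (p - (xroot i ^ n) ^ ((ν i.succ - ν i.castSucc) / (n : ℤ))
          * permAut (simpleReflection i) p) / (1 - xroot i ^ n) * xpow ν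
      + algebraMap ℂ _ (P.v * P.g ((1 + ν i.succ - ν i.castSucc : ℤ) : ZMod n))
        * permAut (simpleReflection i) p
        * xpow (ν + (1 + ν i.succ - ν i.castSucc) • root i) := by
  have h1 : 1 - algebraMap ℂ _ P.v * xroot i ^ n ≠ 0 := one_sub_mul_xroot_pow_ne_zero i P.v
  have h2 : 1 - xroot i ^ n ≠ 0 := by
    simpa using one_sub_mul_xroot_pow_ne_zero (n := n) i 1
  have hX := xroot_ne_zero i
  simp only [demazureLusztigSimple, demazure, LinearMap.sub_apply, LinearMap.comp_apply,
    LinearMap.mulLeft_apply, LinearMap.id_apply]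
  rw [metaReflection_of_isHomogeneous P i (hp.mul_xpow ν), map_mul, permAut_simple_xpow,
    xpow_add, xpow_zsmul, xpow_root]
  set d := ν i.succ - ν i.castSucc with hd
  have e1 : (1 + ν i.succ - ν i.castSucc) = 1 + d := by rw [hd]; ring
  clear_value d
  rw [e1, ← zpow_natCast, ← zpow_mul, zpow_add₀ hX, zpow_sub₀ hX, zpow_neg]
  -- The factor `x^{-r_n(d) α_i}` of the action cancels the remainder part, leaving a power of `x^{n
  -- α_i}` with exponent `⌊d/n⌋`.
  have e3 : xroot i ^ d = xroot i ^ ((n : ℤ) * (d / n)) * xroot i ^ (d % n) := by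
    rw [← zpow_add₀ hX, Int.mul_ediv_add_emod]
  rw [e3]
  have e4 := zpow_ne_zero (d % n) hX
  have e5 := zpow_ne_zero (n : ℤ) hX
  rw [← zpow_natCast] at h1 h2
  simp only [map_mul, zpow_one]
  generalize xroot i ^ ((n : ℤ) * (d / n)) = a at *
  generalize xroot i ^ (d % n) = b at *
  generalize xroot i ^ (n : ℤ) = y at *
  field_simp
  ring

end

section

variable {r n : ℕ} [NeZero n]

/-! ### Hecke relations -/

omit [NeZero n] in
theorem isInvariant_simple_coeff (P : Parameters n) (i : Fin r) {p : RatFun r}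
    (hp : IsInvariant n p) (k : ℤ) :
    IsInvariant n ((1 - algebraMap ℂ _ P.v) * xroot i ^ n *
        (p - (xroot i ^ n) ^ k * permAut (simpleReflection i) p) / (1 - xroot i ^ n)) :=
  (((IsInvariant.sub isInvariant_one (isInvariant_algebraMap _)).mul (isInvariant_xroot_pow i)).mul
    (hp.sub (((isInvariant_xroot_pow i).zpow k).mul (hp.permAut _)))).div
    (IsInvariant.sub isInvariant_one (isInvariant_xroot_pow i))

theorem permAut_xroot (i : Fin r) : permAut (simpleReflection i) (xroot i) = (xroot i)⁻¹ := by
  rw [xroot, map_div₀, permAut_x, permAut_x, simpleReflection_castSucc, simpleReflection_succ,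
    inv_div]

theorem permAut_permAut_simple (i : Fin r) (p : RatFun r) :
    permAut (simpleReflection i) (permAut (simpleReflection i) p) = p := by
  rw [← permAut_mul, simpleReflection_mul_self, permAut_one]

theorem one_sub_xroot_pow_ne_zero (i : Fin r) : 1 - xroot i ^ n ≠ 0 := by
  simpa using one_sub_mul_xroot_pow_ne_zero (n := n) i 1

omit [NeZero n] in
theorem Parameters.g_mul_neg (P : Parameters n) (a : ℤ) (h : ¬ (n : ℤ) ∣ a) :
    (P.v * P.g (a : ZMod n)) * (P.v * P.g ((-a : ℤ) : ZMod n)) = P.v := by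
  have h1 : (a : ZMod n) ≠ 0 := by rwa [Ne, ZMod.intCast_zmod_eq_zero_iff_dvd]
  have := P.g_mul a h1
  push_cast
  rw [mul_mul_mul_comm, this, mul_assoc, mul_inv_cancel₀ P.v_ne_zero, mul_one]

theorem root_castSucc (i : Fin r) : root i i.castSucc = 1 := by
  have hne : i.castSucc ≠ i.succ := Fin.castSucc_lt_succ.ne
  simp [root, hne]

theorem root_succ (i : Fin r) : root i i.succ = -1 := by
  have hne : i.succ ≠ i.castSucc := Fin.castSucc_lt_succ.ne'
  simp [root, hne]

/-- `T_i` maps `x^ν` to a combination, with invariant coefficients, of `x^ν` and the monomial `x^{ν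
+ (1 + d) α_i}`, and the second application returns from the latter to `x^ν`. The two Gauss sum
parameters met on the way have opposite indices. -/
theorem demazureLusztigSimple_quadratic (P : Parameters n) (i : Fin r) (ν : Weight r) :
    demazureLusztigSimple P i (demazureLusztigSimple P i (xpow ν)) =
      (algebraMap ℂ _ P.v - 1) * demazureLusztigSimple P i (xpow ν)
        + algebraMap ℂ _ P.v * xpow ν := by
  have h1 := demazureLusztigSimple_apply P i (isInvariant_one (r := r) (n := n)) ν
  rw [one_mul] at h1
  set d := ν i.succ - ν i.castSucc with hd
  have e1 : 1 + ν i.succ - ν i.castSucc = 1 + d := by rw [hd]; ring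
  rw [e1] at h1
  have hd' : (ν + (1 + d) • root i) i.succ - (ν + (1 + d) • root i) i.castSucc = - d - 2 := by
    simp only [Pi.add_apply, Pi.smul_apply, root_castSucc, root_succ, smul_eq_mul]
    rw [hd]; ring
  have h2 := fun (p : RatFun r) hp ↦ demazureLusztigSimple_apply P i (p := p) hp
    (ν + (1 + d) • root i)
  simp only [add_sub_assoc, hd'] at h2
  have h4 : ν + (1 + d) • root i + (1 + (-d - 2)) • root i = ν := by module
  rw [h4] at h2
  have hc := one_sub_xroot_pow_ne_zero (n := n) i
  have hX := pow_ne_zero n (xroot_ne_zero i)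
  have h3 := demazureLusztigSimple_apply P i
    (isInvariant_simple_coeff P i (isInvariant_one (r := r) (n := n)) (d / n)) ν
  rw [e1, ← hd] at h3
  simp only [map_one, mul_one] at h1 h3
  rw [h1, map_add, h3, h2 _ (isInvariant_algebraMap _)]
  simp only [map_mul, map_div₀, map_sub, map_one, map_pow, map_zpow₀, permAut_xroot,
    AlgEquiv.commutes]
  have hv : algebraMap ℂ (RatFun r) P.v ≠ 0 := by
    rw [Ne, FaithfulSMul.algebraMap_eq_zero_iff]; exact P.v_ne_zero
  -- If `n ∣ 1 + d`, both monomials differ by a power of `x^{n α_i}` and both parameters are `g_0 =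
  -- -1`. Otherwise the parameters multiply to `v⁻¹`, and the two floors are exchanged by `k ↦ -k -
  -- 1`.
  by_cases hdvd : (n : ℤ) ∣ 1 + d
  · obtain ⟨k, hk⟩ := hdvd
    have hn0 : (0 : ℤ) < n := by exact_mod_cast NeZero.pos n
    have q1 : d / (n : ℤ) = k - 1 := by
      rw [Int.ediv_eq_iff_of_pos hn0]; constructor <;> nlinarith
    have q2 : (- d - 2) / (n : ℤ) = - k - 1 := by
      rw [Int.ediv_eq_iff_of_pos hn0]; constructor <;> nlinarith
    have g1 : P.g ((1 + d : ℤ) : ZMod n) = -1 := by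
      rw [(ZMod.intCast_zmod_eq_zero_iff_dvd _ _).2 ⟨k, hk⟩, P.g_zero]
    have g2 : P.g ((1 + (- d - 2) : ℤ) : ZMod n) = -1 := by
      rw [(ZMod.intCast_zmod_eq_zero_iff_dvd _ _).2 ⟨-k, by linarith⟩, P.g_zero]
    have q3 : xpow (ν + (1 + d) • root i) = (xroot i ^ n) ^ k * xpow ν := by
      rw [xpow_add, xpow_zsmul, xpow_root, hk, zpow_mul, zpow_natCast, mul_comm]
    rw [q1, q2, g1, g2, q3, inv_pow, inv_zpow, zpow_sub₀ hX, zpow_sub₀ hX, zpow_neg, zpow_one]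
    have h5 := zpow_ne_zero k hX
    generalize (xroot i ^ n) ^ k = a at *
    generalize (xroot i ^ n) = y at *
    have hc' : y - 1 ≠ 0 := fun h ↦ hc (by linear_combination -h)
    simp only [map_neg, map_one]
    field_simp
    ring
  · have q2 : (- d - 2) / (n : ℤ) = - (d / n) - 1 := by
      have hn0 : (0 : ℤ) < n := by exact_mod_cast NeZero.pos n
      have m1 := Int.emod_nonneg d hn0.ne'
      have m2 := Int.emod_lt_of_pos d hn0
      have m3 := Int.mul_ediv_add_emod d n
      have m4 : d % n ≠ n - 1 := by
        intro h
        apply hdvd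
        exact ⟨d / n + 1, by rw [h] at m3; linarith⟩
      have m5 : d % n < n - 1 := lt_of_le_of_ne (by omega) m4
      rw [Int.ediv_eq_iff_of_pos hn0]; constructor <;> nlinarith
    have hg := congrArg (algebraMap ℂ (RatFun r)) (P.g_mul_neg (1 + d) hdvd)
    rw [show 1 + (-d - 2) = -(1 + d) by ring, q2]
    simp only [map_mul] at hg
    generalize algebraMap ℂ (RatFun r) (P.g ((-(1 + d) : ℤ) : ZMod n)) = g2 at *
    generalize algebraMap ℂ (RatFun r) (P.g ((1 + d : ℤ) : ZMod n)) = g1 at *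
    rw [inv_pow, inv_zpow, zpow_sub₀ hX, zpow_neg, zpow_one]
    have h5 := zpow_ne_zero (d / n) hX
    generalize (xroot i ^ n) ^ (d / (n : ℤ)) = a at *
    generalize (xroot i ^ n) = y at *
    have hc' : y - 1 ≠ 0 := fun h ↦ hc (by linear_combination -h)
    generalize algebraMap ℂ (RatFun r) P.v = v at *
    generalize xpow ν = e at *
    generalize xpow (ν + (1 + d) • root i) = e' at *
    have hg' : g1 * g2 = v⁻¹ := by
      apply mul_left_cancel₀ (mul_ne_zero hv hv)
      rw [mul_assoc v v v⁻¹, mul_inv_cancel₀ hv]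
      linear_combination hg
    have hg2 : g2 ≠ 0 := by rintro rfl; simp at hg'; exact hv hg'.symm
    have : g1 = v⁻¹ * g2⁻¹ := by rw [← hg', mul_assoc, mul_inv_cancel₀ hg2, mul_one]
    subst this
    field_simp
    ring

end

/-! ### Commutation and braid relations of the operators. -/

section

variable {r n : ℕ} [NeZero n]

theorem demazureLusztigSimple_apply_fixed (P : Parameters n) (i : Fin r) {p : RatFun r}
    (hp : IsInvariant n p) (hs : permAut (simpleReflection i) p = p) (ν : Weight r) :
    demazureLusztigSimple P i (p * xpow ν) = p * demazureLusztigSimple P i (xpow ν) := by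
  have h := demazureLusztigSimple_apply P i (isInvariant_one (r := r) (n := n)) ν
  rw [one_mul, map_one] at h
  rw [h, demazureLusztigSimple_apply P i hp, hs]
  ring

theorem root_apply_of_ne {i : Fin r} {a : Fin (r + 1)} (h1 : a ≠ i.castSucc) (h2 : a ≠ i.succ) :
    root i a = 0 := by simp [root, h1, h2]

theorem permAut_xroot_of_lt {i j : Fin r} (h : (i : ℕ) + 1 < j) :
    permAut (simpleReflection i) (xroot j) = xroot j ∧
      permAut (simpleReflection j) (xroot i) = xroot i := by
  constructor <;>
  · rw [xroot, map_div₀, permAut_x, permAut_x,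
      simpleReflection_apply_of_ne (by simp; omega) (by simp; omega),
      simpleReflection_apply_of_ne (by simp; omega) (by simp; omega)]

/-- The roots are orthogonal: `σ_i` fixes the coefficients of `T_j` and conversely, and a shift by
one root does not change the exponent difference seen by the other operator. -/
theorem demazureLusztigSimple_comm (P : Parameters n) {i j : Fin r} (h : (i : ℕ) + 1 < j)
    (ν : Weight r) :
    demazureLusztigSimple P i (demazureLusztigSimple P j (xpow ν)) =
      demazureLusztigSimple P j (demazureLusztigSimple P i (xpow ν)) := by
  obtain ⟨hij, hji⟩ := permAut_xroot_of_lt h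
  have hi := fun ν ↦ demazureLusztigSimple_apply P i (isInvariant_one (r := r) (n := n)) ν
  have hj := fun ν ↦ demazureLusztigSimple_apply P j (isInvariant_one (r := r) (n := n)) ν
  simp only [one_mul, map_one, mul_one] at hi hj
  have Hi := isInvariant_simple_coeff P i (isInvariant_one (r := r) (n := n))
  have Hj := isInvariant_simple_coeff P j (isInvariant_one (r := r) (n := n))
  simp only [map_one, mul_one] at Hi Hj
  have r1 : root i j.castSucc = 0 := root_apply_of_ne (by simp [Fin.ext_iff]; omega)
    (by simp [Fin.ext_iff]; omega)
  have r2 : root i j.succ = 0 := root_apply_of_ne (by simp [Fin.ext_iff]; omega)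
    (by simp [Fin.ext_iff]; omega)
  have r3 : root j i.castSucc = 0 := root_apply_of_ne (by simp [Fin.ext_iff]; omega)
    (by simp [Fin.ext_iff]; omega)
  have r4 : root j i.succ = 0 := root_apply_of_ne (by simp [Fin.ext_iff]; omega)
    (by simp [Fin.ext_iff]; omega)
  rw [hi, hj, map_add, map_add, demazureLusztigSimple_apply_fixed P i (Hj _),
    demazureLusztigSimple_apply_fixed P i (isInvariant_algebraMap _),
    demazureLusztigSimple_apply_fixed P j (Hi _),
    demazureLusztigSimple_apply_fixed P j (isInvariant_algebraMap _), hi, hj, hi, hj]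
  · simp only [Pi.add_apply, Pi.smul_apply, r1, r2, r3, r4, smul_zero, add_zero]
    rw [add_right_comm ν]
    ring
  · exact AlgEquiv.commutes _ _
  · simp only [map_mul, map_div₀, map_sub, map_one, map_pow, map_zpow₀, hji, AlgEquiv.commutes]
  · exact AlgEquiv.commutes _ _
  · simp only [map_mul, map_div₀, map_sub, map_one, map_pow, map_zpow₀, hij, AlgEquiv.commutes]

-- For colours in `[0, n)` the floor only records whether `a < b`, so on box monomials the operator
-- depends only on the order of the colours and on a Gauss sum parameter.
omit [NeZero n] in
theorem box_ediv {a b : ℤ} (ha : 0 ≤ a) (ha' : a < n) (hb : 0 ≤ b) (hb' : b < n) :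
    (b - a - 1) / (n : ℤ) = if a < b then 0 else -1 := by
  have hn0 : (0 : ℤ) < n := by omega
  split_ifs with h
  · exact Int.ediv_eq_zero_of_lt (by omega) (by omega)
  · rw [Int.ediv_eq_iff_of_pos hn0]; constructor <;> omega

/-- The twist in the coefficient of the operator on a monomial in the fundamental box. -/
def boxTwist (i : Fin r) (n : ℕ) (a b : ℤ) : RatFun r := if a < b then 1 else (xroot i ^ n)⁻¹

theorem demazureLusztigSimple_apply_box (P : Parameters n) (i : Fin r) {p : RatFun r}
    (hp : IsInvariant n p) (ν ν' : Weight r) {a b : ℤ} (ha : 0 ≤ a) (ha' : a < n) (hb : 0 ≤ b)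
    (hb' : b < n) (hν : ν i.succ - ν i.castSucc = b - a - 1) (hν' : ν + (b - a) • root i = ν') :
    demazureLusztigSimple P i (p * xpow ν) =
      (1 - algebraMap ℂ _ P.v) * xroot i ^ n *
        (p - boxTwist i n a b * permAut (simpleReflection i) p) / (1 - xroot i ^ n) * xpow ν
      + algebraMap ℂ _ (P.v * P.g ((b - a : ℤ) : ZMod n))
        * permAut (simpleReflection i) p * xpow ν' := by
  have e : 1 + ν i.succ - ν i.castSucc = b - a := by omega
  rw [demazureLusztigSimple_apply P i hp, e, hν', hν, box_ediv ha ha' hb hb', boxTwist]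
  congr 5
  split_ifs <;> simp

set_option linter.unusedSimpArgs false in
set_option maxHeartbeats 1000000 in
/-- The algebra behind the braid relation: `s`, `t` play the role of the two simple reflections,
`E a b c` that of the monomials in the fundamental box. -/
theorem braid_of_box {F κ : Type*} [Field F] [LinearOrder κ] (s t : F →+* F) (T U : F → F) (I : F → Prop)
    (γ : κ → κ → F) (E : κ → κ → κ → F) (δ : κ → κ → F) {A B C v : F} {a b c : κ}
    (sA : s A = -1 - A) (sB : s B = C) (sC : s C = B) (tA : t A = C) (tB : t B = -1 - B)
    (tC : t C = A) (hC : C * (A + B + 1) = A * B) (hAB : A + B + 1 ≠ 0)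
    (sv : s v = v) (tv : t v = v) (sg : ∀ k l, s (γ k l) = γ k l) (tg : ∀ k l, t (γ k l) = γ k l)
    (hss : ∀ q, s (s q) = q) (htt : ∀ q, t (t q) = q) (hst : ∀ q, t (s (t q)) = s (t (s q)))
    (hδ : ∀ a b, δ a b = if a < b then 0 else 1)
    (g0 : ∀ k, γ k k = -v) (hv : v ≠ 0) (hab : a ≠ b → γ a b * γ b a = v)
    (hbc : b ≠ c → γ b c * γ c b = v)
    (hT : ∀ p a b c, I p → T (p * E a b c) =
      (1 - v) * (A * p - (A + δ a b) * s p) * E a b c + γ a b * s p * E b a c)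
    (hU : ∀ p a b c, I p → U (p * E a b c) =
      (1 - v) * (B * p - (B + δ b c) * t p) * E a b c + γ b c * t p * E a c b)
    (Tadd : ∀ p q, T (p + q) = T p + T q) (Uadd : ∀ p q, U (p + q) = U p + U q)
    (Is : ∀ p, I p → I (s p)) (It : ∀ p, I p → I (t p)) (Ig : ∀ p k l, I p → I (γ k l * p))
    (IT : ∀ p a b, I p → I ((1 - v) * (A * p - (A + δ a b) * s p)))
    (IU : ∀ p a b, I p → I ((1 - v) * (B * p - (B + δ a b) * t p)))
    {p : F} (hp : I p) :
    T (U (T (p * E a b c))) = U (T (U (p * E a b c))) := by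
  have h1 := IT p a b hp
  have h1' := Ig _ a b (Is _ hp)
  have h2 := IU p b c hp
  have h2' := Ig _ b c (It _ hp)
  rw [hT _ _ _ _ hp, hU _ _ _ _ hp, Uadd, hU _ _ _ _ h1, hU _ _ _ _ h1', Tadd (_ * E a b c), hT _ _ _ _ h2,
    hT _ _ _ _ h2', Tadd, Tadd, Tadd, Uadd, Uadd, Uadd,
    hT _ _ _ _ (IU _ _ _ h1), hT _ _ _ _ (Ig _ _ _ (It _ h1)), hT _ _ _ _ (IU _ _ _ h1'),
    hT _ _ _ _ (Ig _ _ _ (It _ h1')), hU _ _ _ _ (IT _ _ _ h2), hU _ _ _ _ (Ig _ _ _ (Is _ h2)),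
    hU _ _ _ _ (IT _ _ _ h2'), hU _ _ _ _ (Ig _ _ _ (Is _ h2'))]
  -- `C` belongs to the sum of the two roots; `A`, `B`, `C` stand for `X / (1 - X)` at the three
  -- positive roots of the rank two system, which explains this relation.
  have hC' : C = A * B / (A + B + 1) := eq_div_of_mul_eq hAB hC
  have hlt : ∀ {a b : κ}, a < b → ¬ b < a := fun h ↦ h.not_gt
  -- There are thirteen weak orderings of three colours. In each of them the floors are constants,
  -- and one of `γ a b`, `γ b a` is eliminated by their product `v` when the colours differ; what
  -- remains is a rational identity.
  rcases lt_trichotomy a b with h | h | h <;> rcases lt_trichotomy b c with h' | h' | h' <;>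
  rcases lt_trichotomy a c with h'' | h'' | h'' <;> first | (exfalso; order) | skip
  · have e1 := hab h.ne
    have e2 := hbc h'.ne
    have n1 : γ b a ≠ 0 := right_ne_zero_of_mul (e1.trans_ne hv)
    have n2 : γ c b ≠ 0 := right_ne_zero_of_mul (e2.trans_ne hv)
    rw [eq_div_of_mul_eq n1 e1, eq_div_of_mul_eq n2 e2]
    simp only [hδ, h, h', h'', hlt h, hlt h', hlt h'', if_true, if_false, map_mul, map_div₀,
      map_sub, map_neg, map_one, map_add, map_zero, sA, sB, sC, tA, tB, tC, sv,
      tv, sg, tg, hss, htt, hst, lt_irrefl,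
      g0]
    rw [hC']
    field_simp
    ring
  · subst h'
    have e1 := hab h.ne
    have n1 : γ b a ≠ 0 := right_ne_zero_of_mul (e1.trans_ne hv)
    rw [eq_div_of_mul_eq n1 e1]
    simp only [hδ, h, hlt h, if_true, if_false, map_mul, map_div₀,
      map_sub, map_neg, map_one, map_add, map_zero, sA, sB, sC, tA, tB, tC, sv,
      tv, sg, tg, hss, htt, hst, lt_irrefl,
      g0]
    rw [hC']
    field_simp
    ring
  · have e1 := hab h.ne
    have e2 := hbc h'.ne.symm
    have n1 : γ b a ≠ 0 := right_ne_zero_of_mul (e1.trans_ne hv)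
    have n2 : γ c b ≠ 0 := right_ne_zero_of_mul (e2.trans_ne hv)
    rw [eq_div_of_mul_eq n1 e1, eq_div_of_mul_eq n2 e2]
    simp only [hδ, h, h', h'', hlt h, hlt h', hlt h'', if_true, if_false, map_mul, map_div₀,
      map_sub, map_neg, map_one, map_add, map_zero, sA, sB, sC, tA, tB, tC, sv,
      tv, sg, tg, hss, htt, hst, lt_irrefl,
      g0]
    rw [hC']
    field_simp
    ring
  · subst h''
    have e1 := hab h.ne
    have n1 : γ b a ≠ 0 := right_ne_zero_of_mul (e1.trans_ne hv)
    rw [eq_div_of_mul_eq n1 e1]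
    simp only [hδ, h, hlt h, if_true, if_false, map_mul, map_div₀,
      map_sub, map_neg, map_one, map_add, map_zero, sA, sB, sC, tA, tB, tC, sv,
      tv, sg, tg, hss, htt, hst, lt_irrefl,
      g0]
    rw [hC']
    field_simp
    ring
  · have e1 := hab h.ne
    have e2 := hbc h'.ne.symm
    have n1 : γ b a ≠ 0 := right_ne_zero_of_mul (e1.trans_ne hv)
    have n2 : γ c b ≠ 0 := right_ne_zero_of_mul (e2.trans_ne hv)
    rw [eq_div_of_mul_eq n1 e1, eq_div_of_mul_eq n2 e2]
    simp only [hδ, h, h', h'', hlt h, hlt h', hlt h'', if_true, if_false, map_mul, map_div₀,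
      map_sub, map_neg, map_one, map_add, map_zero, sA, sB, sC, tA, tB, tC, sv,
      tv, sg, tg, hss, htt, hst, lt_irrefl,
      g0]
    rw [hC']
    field_simp
    ring
  · subst h
    have e2 := hbc h'.ne
    have n2 : γ c a ≠ 0 := right_ne_zero_of_mul (e2.trans_ne hv)
    rw [eq_div_of_mul_eq n2 e2]
    simp only [hδ, h', hlt h', if_true, if_false, map_mul, map_div₀,
      map_sub, map_neg, map_one, map_add, map_zero, sA, sB, sC, tA, tB, tC, sv,
      tv, sg, tg, hss, htt, hst, lt_irrefl,
      g0]
    rw [hC']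
    field_simp
    ring
  · subst h h'
    simp only [hδ,  if_true, if_false, map_mul, map_div₀,
      map_sub, map_neg, map_one, map_add, map_zero, sA, sB, sC, tA, tB, tC, sv,
      tv, sg, tg, hss, htt, hst, lt_irrefl,
      g0]
    rw [hC']
    field_simp
    ring
  · subst h
    have e2 := hbc h'.ne.symm
    have n2 : γ c a ≠ 0 := right_ne_zero_of_mul (e2.trans_ne hv)
    rw [eq_div_of_mul_eq n2 e2]
    simp only [hδ, h', hlt h', if_true, if_false, map_mul, map_div₀,
      map_sub, map_neg, map_one, map_add, map_zero, sA, sB, sC, tA, tB, tC, sv,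
      tv, sg, tg, hss, htt, hst, lt_irrefl,
      g0]
    rw [hC']
    field_simp
    ring
  · have e1 := hab h.ne.symm
    have e2 := hbc h'.ne
    have n1 : γ b a ≠ 0 := right_ne_zero_of_mul (e1.trans_ne hv)
    have n2 : γ c b ≠ 0 := right_ne_zero_of_mul (e2.trans_ne hv)
    rw [eq_div_of_mul_eq n1 e1, eq_div_of_mul_eq n2 e2]
    simp only [hδ, h, h', h'', hlt h, hlt h', hlt h'', if_true, if_false, map_mul, map_div₀,
      map_sub, map_neg, map_one, map_add, map_zero, sA, sB, sC, tA, tB, tC, sv,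
      tv, sg, tg, hss, htt, hst, lt_irrefl,
      g0]
    rw [hC']
    field_simp
    ring
  · subst h''
    have e1 := hab h.ne.symm
    have n1 : γ b a ≠ 0 := right_ne_zero_of_mul (e1.trans_ne hv)
    rw [eq_div_of_mul_eq n1 e1]
    simp only [hδ, h, hlt h, if_true, if_false, map_mul, map_div₀,
      map_sub, map_neg, map_one, map_add, map_zero, sA, sB, sC, tA, tB, tC, sv,
      tv, sg, tg, hss, htt, hst, lt_irrefl,
      g0]
    rw [hC']
    field_simp
    ring
  · have e1 := hab h.ne.symm
    have e2 := hbc h'.ne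
    have n1 : γ b a ≠ 0 := right_ne_zero_of_mul (e1.trans_ne hv)
    have n2 : γ c b ≠ 0 := right_ne_zero_of_mul (e2.trans_ne hv)
    rw [eq_div_of_mul_eq n1 e1, eq_div_of_mul_eq n2 e2]
    simp only [hδ, h, h', h'', hlt h, hlt h', hlt h'', if_true, if_false, map_mul, map_div₀,
      map_sub, map_neg, map_one, map_add, map_zero, sA, sB, sC, tA, tB, tC, sv,
      tv, sg, tg, hss, htt, hst, lt_irrefl,
      g0]
    rw [hC']
    field_simp
    ring
  · subst h'
    have e1 := hab h.ne.symm
    have n1 : γ b a ≠ 0 := right_ne_zero_of_mul (e1.trans_ne hv)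
    rw [eq_div_of_mul_eq n1 e1]
    simp only [hδ, h, hlt h, if_true, if_false, map_mul, map_div₀,
      map_sub, map_neg, map_one, map_add, map_zero, sA, sB, sC, tA, tB, tC, sv,
      tv, sg, tg, hss, htt, hst, lt_irrefl,
      g0]
    rw [hC']
    field_simp
    ring
  · have e1 := hab h.ne.symm
    have e2 := hbc h'.ne.symm
    have n1 : γ b a ≠ 0 := right_ne_zero_of_mul (e1.trans_ne hv)
    have n2 : γ c b ≠ 0 := right_ne_zero_of_mul (e2.trans_ne hv)
    rw [eq_div_of_mul_eq n1 e1, eq_div_of_mul_eq n2 e2]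
    simp only [hδ, h, h', h'', hlt h, hlt h', hlt h'', if_true, if_false, map_mul, map_div₀,
      map_sub, map_neg, map_one, map_add, map_zero, sA, sB, sC, tA, tB, tC, sv,
      tv, sg, tg, hss, htt, hst, lt_irrefl,
      g0]
    rw [hC']
    field_simp
    ring

theorem demazureLusztigSimple_braid (P : Parameters n) {i j : Fin r} (h : (i : ℕ) + 1 = j)
    (ν : Weight r) :
    demazureLusztigSimple P i (demazureLusztigSimple P j (demazureLusztigSimple P i (xpow ν))) =
      demazureLusztigSimple P j
        (demazureLusztigSimple P i (demazureLusztigSimple P j (xpow ν))) := by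
  have hn0 : (0 : ℤ) < n := by exact_mod_cast NeZero.pos n
  have e0 : j.castSucc = i.succ := Fin.ext (by simp [h])
  have n01 : i.castSucc ≠ i.succ := Fin.castSucc_lt_succ.ne
  have n12 : i.succ ≠ j.succ := by rw [← e0]; exact Fin.castSucc_lt_succ.ne
  have n02 : i.castSucc ≠ j.succ := by rw [Ne, Fin.ext_iff]; simp; omega
  set a0 := i.castSucc with ha0
  set a1 := i.succ with ha1
  set a2 := j.succ with ha2
  let col : ℤ → Fin n := fun k ↦ ⟨(k % n).toNat, by
    have := Int.emod_lt_of_pos k hn0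
    have := Int.emod_nonneg k hn0.ne'
    omega⟩
  have hcol : ∀ k, ((col k : ℕ) : ℤ) = k - n * (k / n) := by
    intro k
    have := Int.emod_nonneg k hn0.ne'
    have h1 := Int.mul_ediv_add_emod k n
    simp only [col]
    omega
  -- The shifts `0, 1, 2` are those of `ρ`: they turn `ν_{i+1} - ν_i + 1` into the difference of two
  -- shifted exponents, so that the second term of the operator just exchanges two colours. Dividing
  -- by `n` splits off `x^{n η}`, and `ω` keeps the shift together with all other coordinates.
  set η : Weight r := Pi.single a0 (ν a0 / n) + Pi.single a1 ((ν a1 + 1) / n)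
    + Pi.single a2 ((ν a2 + 2) / n) with hη
  let W : Weight r → Fin n → Fin n → Fin n → Weight r := fun ω a b c ↦
    ω + Pi.single a0 (a : ℤ) + Pi.single a1 (b : ℤ) + Pi.single a2 (c : ℤ)
  set ω : Weight r := ν - (n : ℤ) • η - W 0 (col (ν a0)) (col (ν a1 + 1)) (col (ν a2 + 2)) with hω
  have hν : ν = (n : ℤ) • η + W ω (col (ν a0)) (col (ν a1 + 1)) (col (ν a2 + 2)) := by
    rw [hω]; simp only [W]; abel
  have w0 : ω a0 = 0 := by
    simp [hω, hη, W, n01, n02, hcol]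
  have w1 : ω a1 = -1 := by
    simp [hω, hη, W, n01.symm, n12, hcol]
  have w2 : ω a2 = -2 := by
    simp [hω, hη, W, n02.symm, n12.symm, hcol]
  have ri : root i = Pi.single a0 1 - Pi.single a1 1 := rfl
  have rj : root j = Pi.single a1 1 - Pi.single a2 1 := by rw [root, e0]
  have hs := permAut_permAut_simple i
  have ht := permAut_permAut_simple j
  have xi0 : permAut (simpleReflection i) (x a0) = x a1 := by
    rw [permAut_x, ha0, simpleReflection_castSucc]
  have xi1 : permAut (simpleReflection i) (x a1) = x a0 := by
    rw [permAut_x, ha1, simpleReflection_succ]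
  have xi2 : permAut (simpleReflection i) (x a2) = x a2 := by
    rw [permAut_x, simpleReflection_apply_of_ne (by simp [ha2]; omega) (by simp [ha2]; omega)]
  have xj0 : permAut (simpleReflection j) (x a0) = x a0 := by
    rw [permAut_x, simpleReflection_apply_of_ne (by simp [ha0]; omega) (by simp [ha0]; omega)]
  have xj1 : permAut (simpleReflection j) (x a1) = x a2 := by
    rw [permAut_x, ← e0, simpleReflection_castSucc]
  have xj2 : permAut (simpleReflection j) (x a2) = x a1 := by
    rw [permAut_x, ha2, simpleReflection_succ, e0]
  have hYi : xroot i = x a0 / x a1 := rfl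
  have hYj : xroot j = x a1 / x a2 := by rw [xroot, e0]
  have z0 := pow_ne_zero n (x_ne_zero a0)
  have z1 := pow_ne_zero n (x_ne_zero a1)
  have z2 := pow_ne_zero n (x_ne_zero a2)
  have d1 : (x a1 : RatFun r) ^ n - x a0 ^ n ≠ 0 := by
    have := one_sub_xroot_pow_ne_zero (n := n) i
    rw [hYi, div_pow] at this
    intro h
    apply this
    field_simp
    rw [h, mul_zero]
  have d2 : (x a2 : RatFun r) ^ n - x a1 ^ n ≠ 0 := by
    have := one_sub_xroot_pow_ne_zero (n := n) j
    rw [hYj, div_pow] at this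
    intro h
    apply this
    field_simp
    rw [h, mul_zero]
  -- The root `α_i + α_j` is not simple; its denominator is mapped by `σ_i` to that of `α_j`.
  have d3 : (x a2 : RatFun r) ^ n - x a0 ^ n ≠ 0 := by
    intro h
    apply d2
    have := congrArg (permAut (simpleReflection i)) h
    rwa [map_sub, map_pow, map_pow, xi2, xi0, map_zero] at this
  have d1' : (x a0 : RatFun r) ^ n - x a1 ^ n ≠ 0 := fun h ↦ d1 (by linear_combination -h)
  have d2' : (x a1 : RatFun r) ^ n - x a2 ^ n ≠ 0 := fun h ↦ d2 (by linear_combination -h)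
  have stepi : ∀ (p : RatFun r) (a b c : Fin n), IsInvariant n p →
      demazureLusztigSimple P i (p * xpow (W ω a b c)) =
      (1 - algebraMap ℂ _ P.v) * (x a0 ^ n / (x a1 ^ n - x a0 ^ n) * p -
        (x a0 ^ n / (x a1 ^ n - x a0 ^ n) + if a < b then 0 else 1)
          * permAut (simpleReflection i) p) * xpow (W ω a b c) +
      algebraMap ℂ _ (P.v * P.g (((b : ℤ) - a : ℤ) : ZMod n)) * permAut (simpleReflection i) p
        * xpow (W ω b a c) := by
    intro p a b c hp
    rw [demazureLusztigSimple_apply_box P i hp _ (W ω b a c) (a := a) (b := b) (by omega)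
      (by omega) (by omega) (by omega), boxTwist, hYi, div_pow]
    · congr 2
      simp only [Nat.cast_lt, Fin.val_fin_lt]
      have : 1 - (x a0 : RatFun r) ^ n / x a1 ^ n = (x a1 ^ n - x a0 ^ n) / x a1 ^ n := by
        field_simp
      rw [this]
      split_ifs <;> field_simp <;> ring
    · simp [W, ← ha0, ← ha1, n01, n01.symm, n02, n12, w0, w1]; ring
    · simp only [W, ri]
      funext k
      simp only [Pi.add_apply, Pi.smul_apply, Pi.sub_apply, Pi.single_apply, smul_eq_mul]
      split_ifs <;> ring
  have stepj : ∀ (p : RatFun r) (a b c : Fin n), IsInvariant n p →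
      demazureLusztigSimple P j (p * xpow (W ω a b c)) =
      (1 - algebraMap ℂ _ P.v) * (x a1 ^ n / (x a2 ^ n - x a1 ^ n) * p -
        (x a1 ^ n / (x a2 ^ n - x a1 ^ n) + if b < c then 0 else 1)
          * permAut (simpleReflection j) p) * xpow (W ω a b c) +
      algebraMap ℂ _ (P.v * P.g (((c : ℤ) - b : ℤ) : ZMod n)) * permAut (simpleReflection j) p
        * xpow (W ω a c b) := by
    intro p a b c hp
    rw [demazureLusztigSimple_apply_box P j hp _ (W ω a c b) (a := b) (b := c) (by omega)
      (by omega) (by omega) (by omega), boxTwist, hYj, div_pow]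
    · congr 2
      simp only [Nat.cast_lt, Fin.val_fin_lt]
      have : 1 - (x a1 : RatFun r) ^ n / x a2 ^ n = (x a2 ^ n - x a1 ^ n) / x a2 ^ n := by
        field_simp
      rw [this]
      split_ifs <;> field_simp <;> ring
    · rw [e0, ← ha2]
      simp [W, n01.symm, n02.symm, n12.symm, n12, w1, w2]; ring
    · simp only [W, rj]
      funext k
      simp only [Pi.add_apply, Pi.smul_apply, Pi.sub_apply, Pi.single_apply, smul_eq_mul]
      split_ifs <;> ring
  have hx : ∀ a : Fin (r + 1), xpow ((n : ℤ) • (Pi.single a 1 : Weight r)) = x a ^ n := by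
    intro a
    rw [xpow_zsmul, xpow_single, zpow_one, zpow_natCast]
  have hΛ : ∀ η : Weight r, IsInvariant n (xpow ((n : ℤ) • η)) := fun η ↦
    isInvariant_xpow fun a b ↦ by simp [Int.ModEq]
  have hxa : ∀ a : Fin (r + 1), IsInvariant n (x a ^ n : RatFun r) := fun a ↦ hx a ▸ hΛ _
  have hc : ∀ c : ℂ, IsInvariant n (algebraMap ℂ (RatFun r) c) := isInvariant_algebraMap
  have hgab : ∀ a b : Fin n, a ≠ b →
      algebraMap ℂ (RatFun r) (P.v * P.g (((b : ℤ) - a : ℤ) : ZMod n)) *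
        algebraMap ℂ (RatFun r) (P.v * P.g (((a : ℤ) - b : ℤ) : ZMod n)) =
          algebraMap ℂ (RatFun r) P.v := by
    intro a b hab
    rw [← map_mul, ← neg_sub (b : ℤ) a, P.g_mul_neg]
    intro hdvd
    apply hab
    have : (b : ℤ) - a = 0 := Int.eq_zero_of_abs_lt_dvd hdvd (by rw [abs_lt]; omega)
    exact Fin.ext (by omega)
  have hI : ∀ (k l : Fin (r + 1)) (w : Weyl r) (p : RatFun r) (q : Prop) [Decidable q],
      IsInvariant n p →
      IsInvariant n ((1 - algebraMap ℂ _ P.v) * (x k ^ n / (x l ^ n - x k ^ n) * p -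
        (x k ^ n / (x l ^ n - x k ^ n) + if q then 0 else 1) * permAut w p)) := by
    intro k l w p q _ hp
    have h1 := (hxa k).div ((hxa l).sub (hxa k))
    refine (IsInvariant.sub isInvariant_one (hc _)).mul ((h1.mul hp).sub (IsInvariant.mul ?_
      (hp.permAut w)))
    refine IsHomogeneous.add h1 ?_
    split_ifs
    · simpa using hc 0
    · exact isInvariant_one
  rw [hν, xpow_add]
  -- The invariant factor `x^{n η}` plays the role of `p`; `A`, `B`, `C` are the fractions attached
  -- to `α_i`, `α_j`, `α_i + α_j`.
  refine braid_of_box (permAut (simpleReflection i)).toRingEquiv.toRingHom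
    (permAut (simpleReflection j)).toRingEquiv.toRingHom (demazureLusztigSimple P i)
    (demazureLusztigSimple P j) (IsInvariant n)
    (fun a b : Fin n ↦ algebraMap ℂ _ (P.v * P.g (((b : ℤ) - a : ℤ) : ZMod n)))
    (fun a b c ↦ xpow (W ω a b c)) (fun a b ↦ if a < b then 0 else 1)
    (A := x a0 ^ n / (x a1 ^ n - x a0 ^ n)) (B := x a1 ^ n / (x a2 ^ n - x a1 ^ n))
    (C := x a0 ^ n / (x a2 ^ n - x a0 ^ n)) (v := algebraMap ℂ _ P.v)
    ?_ ?_ ?_ ?_ ?_ ?_ ?_ ?_ ?_ ?_ ?_ ?_ ?_ ?_ ?_ (fun _ _ ↦ rfl) ?_ ?_ (hgab _ _) (hgab _ _)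
    stepi stepj (map_add _) (map_add _) (fun p hp ↦ hp.permAut _) (fun p hp ↦ hp.permAut _)
    (fun p k l hp ↦ (hc _).mul hp) (fun p a b hp ↦ hI _ _ _ _ _ hp)
    (fun p a b hp ↦ hI _ _ _ _ _ hp) (hΛ η)
  · change permAut (simpleReflection i) _ = _
    rw [map_div₀, map_sub, map_pow, map_pow, xi0, xi1]
    field_simp
    ring
  · change permAut (simpleReflection i) _ = _
    rw [map_div₀, map_sub, map_pow, map_pow, xi2, xi1]
  · change permAut (simpleReflection i) _ = _
    rw [map_div₀, map_sub, map_pow, map_pow, xi2, xi0]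
  · change permAut (simpleReflection j) _ = _
    rw [map_div₀, map_sub, map_pow, map_pow, xj0, xj1]
  · change permAut (simpleReflection j) _ = _
    rw [map_div₀, map_sub, map_pow, map_pow, xj2, xj1]
    field_simp
    ring
  · change permAut (simpleReflection j) _ = _
    rw [map_div₀, map_sub, map_pow, map_pow, xj2, xj0]
  · field_simp
    ring
  · have : x a0 ^ n / (x a1 ^ n - x a0 ^ n) + x a1 ^ n / (x a2 ^ n - x a1 ^ n) + 1 =
        (x a1 : RatFun r) ^ n * (x a2 ^ n - x a0 ^ n) /
          ((x a1 ^ n - x a0 ^ n) * (x a2 ^ n - x a1 ^ n)) := by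
      field_simp
      ring
    rw [this]
    exact div_ne_zero (mul_ne_zero z1 d3) (mul_ne_zero d1 d2)
  · exact AlgEquiv.commutes _ _
  · exact AlgEquiv.commutes _ _
  · exact fun _ _ ↦ AlgEquiv.commutes _ _
  · exact fun _ _ ↦ AlgEquiv.commutes _ _
  · exact hs
  · exact ht
  · intro q
    change permAut _ (permAut _ (permAut _ q)) = permAut _ (permAut _ (permAut _ q))
    simp only [← permAut_mul, ← mul_assoc]
    rw [simpleReflection_braid h]
  · intro k
    simp [P.g_zero]
  · rw [Ne, FaithfulSMul.algebraMap_eq_zero_iff]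
    exact P.v_ne_zero

end

section

variable {r n : ℕ}

/-! ### Laurent polynomials -/

/-- The space of Laurent polynomials. -/
def laurent (r : ℕ) : Submodule ℂ (RatFun r) := Submodule.span ℂ (Set.range xpow)

theorem xpow_mem_laurent (ν : Weight r) : xpow ν ∈ laurent r := Submodule.subset_span ⟨ν, rfl⟩

/-- The monomial `x^ν` as a Laurent polynomial. -/
def mono (ν : Weight r) : laurent r := ⟨xpow ν, xpow_mem_laurent ν⟩

/-- The coefficients of `T_i` on an antidominant monomial. -/
def stepCoeff (P : Parameters n) (k M : ℤ) : ℂ := if k = M then P.gFlat M else P.hFlat k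

variable [NeZero n]

theorem demazureLusztigSimple_xpow (P : Parameters n) (i : Fin r) (ν : Weight r) :
    demazureLusztigSimple P i (xpow ν) =
      (1 - algebraMap ℂ _ P.v) * (xroot i ^ n *
        (1 - (xroot i ^ n) ^ ((ν i.succ - ν i.castSucc) / (n : ℤ))) / (1 - xroot i ^ n)) * xpow ν
      + algebraMap ℂ _ (P.gFlat (ν i.succ - ν i.castSucc + 1))
        * (xroot i ^ (ν i.succ - ν i.castSucc + 1) * xpow ν) := by
  have h := demazureLusztigSimple_apply P i (isInvariant_one (r := r) (n := n)) ν
  rw [one_mul, map_one] at h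
  rw [h, xpow_add, xpow_zsmul, xpow_root, Parameters.gFlat,
    show 1 + ν i.succ - ν i.castSucc = ν i.succ - ν i.castSucc + 1 by ring]
  ring

theorem xroot_zpow_mul_mem (i : Fin r) (k : ℤ) (ν : Weight r) :
    xroot i ^ k * xpow ν ∈ laurent r := by
  rw [← xpow_root, ← xpow_zsmul, ← xpow_add]
  exact xpow_mem_laurent _

/-- This recursion in `q` holds for negative `q` too, so the quotient is a Laurent polynomial for
every integer `q`, although it has a denominator. -/
theorem geom_succ (i : Fin r) (q : ℤ) :
    xroot i ^ n * (1 - (xroot i ^ n) ^ (q + 1)) / (1 - xroot i ^ n) =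
      xroot i ^ n * (1 - (xroot i ^ n) ^ q) / (1 - xroot i ^ n) + xroot i ^ ((n : ℤ) * (q + 1)) := by
  have h := one_sub_xroot_pow_ne_zero (n := n) i
  have h' : xroot i ^ n ≠ 0 := pow_ne_zero n (xroot_ne_zero i)
  rw [zpow_mul, zpow_natCast, zpow_add₀ h', zpow_one]
  generalize (xroot i ^ n) ^ q = a at *
  generalize (xroot i ^ n) = y at *
  field_simp
  ring

theorem geom_mul_mem (i : Fin r) (q : ℤ) (ν : Weight r) :
    xroot i ^ n * (1 - (xroot i ^ n) ^ q) / (1 - xroot i ^ n) * xpow ν ∈ laurent r := by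
  induction q using Int.induction_on with
  | zero => simp
  | succ k ih =>
    rw [geom_succ, add_mul]
    exact add_mem ih (xroot_zpow_mul_mem _ _ _)
  | pred k ih =>
    have := geom_succ (n := n) i (-(k : ℤ) - 1)
    rw [sub_add_cancel] at this
    rw [this, add_mul] at ih
    simpa using sub_mem ih (xroot_zpow_mul_mem i ((n : ℤ) * (-k)) ν)

theorem demazureLusztigSimple_mem (P : Parameters n) (i : Fin r) :
    ∀ f ∈ laurent r, demazureLusztigSimple P i f ∈ laurent r := by
  intro f hf
  induction hf using Submodule.span_induction with
  | mem f hf =>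
    obtain ⟨ν, rfl⟩ := hf
    rw [demazureLusztigSimple_xpow, ← map_one (algebraMap ℂ (RatFun r)), ← map_sub, mul_assoc,
      ← Algebra.smul_def, ← Algebra.smul_def, map_one]
    exact add_mem ((laurent r).smul_mem _ (geom_mul_mem _ _ _))
      ((laurent r).smul_mem _ (xroot_zpow_mul_mem _ _ _))
  | zero => simp
  | add f g _ _ hf hg => rw [map_add]; exact add_mem hf hg
  | smul c f _ hf => rw [map_smul]; exact (laurent r).smul_mem c hf

/-- The Demazure–Lusztig operators on Laurent polynomials. -/
def laurentOp (P : Parameters n) (i : Fin r) : Module.End ℂ (laurent r) :=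
  (demazureLusztigSimple P i).restrict (demazureLusztigSimple_mem P i)

theorem coe_laurentOp (P : Parameters n) (i : Fin r) (f : laurent r) :
    ((laurentOp P i f : laurent r) : RatFun r) = demazureLusztigSimple P i f := rfl

theorem laurent_ext {V : Type*} [AddCommGroup V] [Module ℂ V] {A B : laurent r →ₗ[ℂ] V}
    (h : ∀ ν, A (mono ν) = B (mono ν)) : A = B := by
  apply LinearMap.ext
  rintro ⟨f, hf⟩
  induction hf using Submodule.span_induction with
  | mem f hf => obtain ⟨ν, rfl⟩ := hf; exact h ν
  | zero => exact (map_zero A).trans (map_zero B).symm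
  | add f g hf' hg' hf hg =>
    exact (map_add A ⟨f, hf'⟩ ⟨g, hg'⟩).trans ((congrArg₂ (· + ·) hf hg).trans
      (map_add B ⟨f, hf'⟩ ⟨g, hg'⟩).symm)
  | smul c f hf' hf =>
    exact (map_smul A c ⟨f, hf'⟩).trans ((congrArg (c • ·) hf).trans (map_smul B c ⟨f, hf'⟩).symm)

/-- The relations were checked on monomials only, and monomials span the Laurent polynomials. This
subspace is stable under the operators and contains `x^{w₀λ}`, so it suffices to work there. -/
theorem laurentOp_satisfiesBraid (P : Parameters n) :
    SatisfiesBraid (laurentOp P : Fin r → Module.End ℂ (laurent r)) := by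
  constructor
  · intro i j h
    exact laurent_ext fun ν ↦ Subtype.ext (demazureLusztigSimple_braid P h ν)
  · intro i j h
    exact laurent_ext fun ν ↦ Subtype.ext (demazureLusztigSimple_comm P h ν)

theorem laurentOp_quadratic (P : Parameters n) (i : Fin r) (f : laurent r) :
    laurentOp P i (laurentOp P i f) = (P.v - 1) • laurentOp P i f + P.v • f := by
  have : laurentOp P i * laurentOp P i = (P.v - 1) • laurentOp P i + P.v • LinearMap.id := by
    refine laurent_ext fun ν ↦ Subtype.ext ?_
    have := demazureLusztigSimple_quadratic P i ν
    rw [← map_one (algebraMap ℂ (RatFun r)), ← map_sub, ← Algebra.smul_def,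
      ← Algebra.smul_def] at this
    exact this
  exact LinearMap.congr_fun this f

/-- Only the multiples of `n` contribute, and there are `⌊d/n⌋` of them: a geometric sum in `x^{n
α_i}`. -/
theorem hFlat_sum (P : Parameters n) (i : Fin r) (d : ℕ) :
    ∑ k ∈ Finset.Icc (1 : ℤ) d, algebraMap ℂ (RatFun r) (P.hFlat k) * xroot i ^ k =
      (1 - algebraMap ℂ _ P.v) * (xroot i ^ n *
        (1 - (xroot i ^ n) ^ ((d : ℤ) / (n : ℤ))) / (1 - xroot i ^ n)) := by
  have hn0 : (0 : ℤ) < n := by exact_mod_cast NeZero.pos n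
  induction d with
  | zero => simp
  | succ d ih =>
    have : Finset.Icc (1 : ℤ) ((d + 1 : ℕ) : ℤ) = insert ((d : ℤ) + 1) (Finset.Icc (1 : ℤ) d) := by
      ext k; simp; omega
    rw [this, Finset.sum_insert (by simp), ih, Parameters.hFlat]
    split_ifs with h
    · obtain ⟨q, hq⟩ := h
      have h1 : (d : ℤ) / n = q - 1 := by
        rw [Int.ediv_eq_iff_of_pos hn0]; constructor <;> nlinarith
      have h2 : ((d + 1 : ℕ) : ℤ) / n = q - 1 + 1 := by
        rw [Int.ediv_eq_iff_of_pos hn0]; push_cast; constructor <;> nlinarith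
      rw [h1, h2, geom_succ, map_sub, map_one, hq, sub_add_cancel]
      ring
    · have h1 : ((d + 1 : ℕ) : ℤ) / n = (d : ℤ) / n := by
        have m1 := Int.emod_nonneg (d : ℤ) hn0.ne'
        have m2 := Int.emod_lt_of_pos (d : ℤ) hn0
        have m3 := Int.mul_ediv_add_emod (d : ℤ) n
        have m4 : (d : ℤ) % n ≠ n - 1 := by
          intro h'
          apply h
          exact ⟨d / n + 1, by rw [h'] at m3; linarith⟩
        have m5 : (d : ℤ) % n < n - 1 := lt_of_le_of_ne (by omega) m4
        rw [Int.ediv_eq_iff_of_pos hn0]; push_cast; constructor <;> nlinarith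
      rw [h1, map_zero, zero_mul, zero_add]

theorem laurentOp_mono (P : Parameters n) (i : Fin r) (ν : Weight r)
    (h : ν i.castSucc ≤ ν i.succ) :
    laurentOp P i (mono ν) = ∑ k ∈ Finset.Icc 1 (ν i.succ - ν i.castSucc + 1),
      stepCoeff P k (ν i.succ - ν i.castSucc + 1) • mono (ν + k • root i) := by
  apply Subtype.ext
  rw [coe_laurentOp, mono, demazureLusztigSimple_xpow, Submodule.coe_sum]
  obtain ⟨d, hd⟩ := Int.eq_ofNat_of_zero_le (sub_nonneg.2 h)
  rw [hd, ← hFlat_sum]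
  have : Finset.Icc (1 : ℤ) ((d : ℤ) + 1) = insert ((d : ℤ) + 1) (Finset.Icc (1 : ℤ) d) := by
    ext k; simp; omega
  rw [this, Finset.sum_insert (by simp), Finset.sum_mul, add_comm]
  congr 1
  · rw [stepCoeff, if_pos rfl]
    simp only [Submodule.coe_smul, mono, xpow_add, xpow_zsmul, xpow_root]
    rw [Algebra.smul_def]
    ring
  · refine Finset.sum_congr rfl fun k hk ↦ ?_
    rw [Finset.mem_Icc] at hk
    rw [stepCoeff, if_neg (by omega)]
    simp only [Submodule.coe_smul, mono, xpow_add, xpow_zsmul, xpow_root]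
    rw [Algebra.smul_def]
    ring

/-- The floor is `⌊-1/n⌋ = -1`, so the fraction contributes `-(1 - v)`, and the Gauss sum term
contributes `v g_0 = -v`. -/
theorem laurentOp_mono_of_eq (P : Parameters n) (i : Fin r) (ν : Weight r)
    (h : ν i.castSucc = ν i.succ + 1) : laurentOp P i (mono ν) = -mono ν := by
  have hn0 : (0 : ℤ) < n := by exact_mod_cast NeZero.pos n
  apply Subtype.ext
  rw [coe_laurentOp, mono, demazureLusztigSimple_xpow]
  have e : ν i.succ - ν i.castSucc = -1 := by omega
  have e1 : (-1 : ℤ) / n = -1 := by rw [Int.ediv_eq_iff_of_pos hn0]; constructor <;> omega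
  have h0 := one_sub_xroot_pow_ne_zero (n := n) i
  have h' : xroot i ^ n ≠ 0 := pow_ne_zero n (xroot_ne_zero i)
  rw [e, e1, Parameters.gFlat]
  simp only [neg_add_cancel, Int.cast_zero, P.g_zero, zpow_zero, zpow_neg, zpow_one, map_mul,
    map_neg, map_one, Submodule.coe_neg]
  generalize xroot i ^ n = y at *
  have h1 : y - 1 ≠ 0 := fun h ↦ h0 (by linear_combination -h)
  field_simp
  ring

theorem demazureLusztig_apply_laurent (P : Parameters n) (u : Weyl r) (f : laurent r) :
    demazureLusztig P u f = ((heckeProd (laurentOp P) u f : laurent r) : RatFun r) := by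
  rw [demazureLusztig, heckeProd]
  induction reducedWord u generalizing f with
  | nil => rfl
  | cons i l ih =>
    simp only [List.map_cons, List.prod_cons, Module.End.mul_apply]
    rw [ih, coe_laurentOp]

end

/-! ### The nested sum over a row, and the cancellation that produces its inequalities. -/

section

variable {r n : ℕ}

/-! ### Nested sums -/

/-- The simple root `α_j` as a weight with natural indices. -/
def natRoot (j : ℕ) : ℕ → ℤ := fun i ↦ if i = j then 1 else if i = j + 1 then -1 else 0

/-- The number `ν_{j+1} - ν_j + 1`. -/
def gap (ν : ℕ → ℤ) (j : ℕ) : ℤ := ν (j + 1) - ν j + 1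

theorem natRoot_self (j : ℕ) : natRoot j j = 1 := by simp [natRoot]

theorem natRoot_succ (j : ℕ) : natRoot j (j + 1) = -1 := by simp [natRoot]

theorem natRoot_of_ne {i j : ℕ} (h : i ≠ j) (h' : i ≠ j + 1) : natRoot j i = 0 := by
  simp [natRoot, h, h']

theorem add_smul_natRoot_self (ν : ℕ → ℤ) (k : ℤ) (j : ℕ) :
    (ν + k • natRoot j) j = ν j + k := by simp [natRoot_self]

theorem add_smul_natRoot_succ (ν : ℕ → ℤ) (k : ℤ) (j : ℕ) :
    (ν + k • natRoot j) (j + 1) = ν (j + 1) - k := by simp [natRoot_succ, sub_eq_add_neg]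

theorem add_smul_natRoot_of_ne (ν : ℕ → ℤ) (k : ℤ) {i j : ℕ} (h : i ≠ j) (h' : i ≠ j + 1) :
    (ν + k • natRoot j) i = ν i := by simp [natRoot_of_ne h h']

theorem gap_add_self (ν : ℕ → ℤ) (k : ℤ) (j : ℕ) :
    gap (ν + k • natRoot j) j = gap ν j - 2 * k := by
  rw [gap, add_smul_natRoot_self, add_smul_natRoot_succ, gap]; ring

theorem gap_add_succ (ν : ℕ → ℤ) (k : ℤ) (j : ℕ) :
    gap (ν + k • natRoot j) (j + 1) = gap ν (j + 1) + k := by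
  rw [gap, add_smul_natRoot_succ, add_smul_natRoot_of_ne _ _ (by omega) (by omega), gap]; ring

theorem gap_succ_add (ν : ℕ → ℤ) (k : ℤ) (j : ℕ) :
    gap (ν + k • natRoot (j + 1)) j = gap ν j + k := by
  rw [gap, add_smul_natRoot_self, add_smul_natRoot_of_ne _ _ (by omega) (by omega), gap]; ring

theorem gap_add_of_lt (ν : ℕ → ℤ) (k : ℤ) {i j : ℕ} (h : i + 2 ≤ j ∨ j + 2 ≤ i) :
    gap (ν + k • natRoot j) i = gap ν i := by
  rw [gap, add_smul_natRoot_of_ne _ _ (by omega) (by omega),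
    add_smul_natRoot_of_ne _ _ (by omega) (by omega), gap]

/-- The factor of a Gelfand–Tsetlin coefficient for `Γ_{ij} = k`, `Γ_{i,j+1} = l` and upper
bound `M`. -/
def gtFactor (P : Parameters n) (l k M : ℤ) : ℂ :=
  if k = l then if k = M then 0 else 1 else if k = M then P.gFlat k else P.hFlat k

theorem gtFactor_of_lt (P : Parameters n) {l k M : ℤ} (h : l < k) :
    gtFactor P l k M = stepCoeff P k M := by
  rw [gtFactor, if_neg (by omega), stepCoeff]
  split_ifs with h1
  · rw [h1]
  · rfl

section Nest

variable {V V' : Type*} [AddCommGroup V] [Module ℂ V] [AddCommGroup V'] [Module ℂ V']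
  (P : Parameters n) (ξ : (ℕ → ℤ) → V)

/-- The nested sum over `l ≤ k_j ≤ k_{j+1} ≤ ⋯` of products of Gelfand–Tsetlin factors. -/
def nest : ℕ → ℕ → ℤ → (ℕ → ℤ) → V
  | 0, _, _, ν => ξ ν
  | f + 1, j, l, ν => ∑ k ∈ Finset.Icc l (gap ν j),
      gtFactor P l k (gap ν j) • nest f (j + 1) k (ν + k • natRoot j)

variable {ξ}

theorem map_nest (φ : V →ₗ[ℂ] V') (f : ℕ) : ∀ (j : ℕ) (l : ℤ) (ν : ℕ → ℤ),
    φ (nest P ξ f j l ν) = nest P (fun ν ↦ φ (ξ ν)) f j l ν := by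
  induction f with
  | zero => intros; rfl
  | succ f ih =>
    intro j l ν
    simp only [nest, map_sum, map_smul, ih]

/-- `τ` acts on the monomials `ξ ν` as the Demazure–Lusztig operators do. -/
structure ActsAsDemazureLusztig (r : ℕ) (ξ : (ℕ → ℤ) → V) (τ : ℕ → Module.End ℂ V) : Prop where
  step : ∀ j < r, ∀ ν : ℕ → ℤ, 1 ≤ gap ν j →
    τ j (ξ ν) = ∑ k ∈ Finset.Icc 1 (gap ν j), stepCoeff P k (gap ν j) • ξ (ν + k • natRoot j)
  neg : ∀ j < r, ∀ ν : ℕ → ℤ, gap ν j = 0 → τ j (ξ ν) = -ξ ν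

variable {P} {τ : ℕ → Module.End ℂ V}

/-- The nested sum from column `i ≥ j + 2` on uses only roots and gaps unaffected by `α_j`, so `τ_j`
acts on all its terms alike. -/
theorem ActsAsDemazureLusztig.step_nest (h : ActsAsDemazureLusztig P r ξ τ) {j : ℕ} (hj : j < r)
    (f : ℕ) : ∀ (i : ℕ) (l : ℤ) (ν : ℕ → ℤ), j + 2 ≤ i → 1 ≤ gap ν j →
    τ j (nest P ξ f i l ν) = ∑ k ∈ Finset.Icc 1 (gap ν j),
      stepCoeff P k (gap ν j) • nest P ξ f i l (ν + k • natRoot j) := by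
  induction f with
  | zero =>
    intro i l ν hi hν
    exact h.step j hj ν hν
  | succ f ih =>
    intro i l ν hi hν
    have e1 : ∀ k, gap (ν + k • natRoot i) j = gap ν j := fun k ↦ gap_add_of_lt _ _ (Or.inl hi)
    have e2 : ∀ k, gap (ν + k • natRoot j) i = gap ν i := fun k ↦ gap_add_of_lt _ _ (Or.inr hi)
    simp only [nest, map_sum, map_smul, e2, Finset.smul_sum]
    rw [Finset.sum_comm]
    refine Finset.sum_congr rfl fun k _ ↦ ?_
    rw [ih (i + 1) k _ (by omega) (by rw [e1]; exact hν), e1, Finset.smul_sum]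
    refine Finset.sum_congr rfl fun k' _ ↦ ?_
    rw [smul_comm, add_right_comm]

theorem ActsAsDemazureLusztig.neg_nest (h : ActsAsDemazureLusztig P r ξ τ) {j : ℕ} (hj : j < r)
    (f : ℕ) : ∀ (i : ℕ) (l : ℤ) (ν : ℕ → ℤ), j + 2 ≤ i → gap ν j = 0 →
    τ j (nest P ξ f i l ν) = -nest P ξ f i l ν := by
  induction f with
  | zero =>
    intro i l ν hi hν
    exact h.neg j hj ν hν
  | succ f ih =>
    intro i l ν hi hν
    simp only [nest, map_sum, map_smul, ← Finset.sum_neg_distrib]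
    refine Finset.sum_congr rfl fun k _ ↦ ?_
    rw [ih (i + 1) k _ (by omega) (by rw [gap_add_of_lt _ _ (Or.inl hi)]; exact hν), smul_neg]

/-- Free summation over `q` against summation constrained by `k ≤ q`. Beyond `k` the terms agree; up
to `k` the free sum has coefficients `h♭(q)` because `k < M`, and the constrained sum has only the
term `q = k`, with factor `1`. -/
theorem sum_stepCoeff_sub {k M : ℤ} (hk : 1 ≤ k) (hM : k < M) (ρ : ℤ → V) :
    ∑ q ∈ Finset.Icc 1 M, stepCoeff P q M • ρ q - ∑ q ∈ Finset.Icc k M, gtFactor P k q M • ρ q =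
      ∑ q ∈ Finset.Icc 1 k, P.hFlat q • ρ q - ρ k := by
  have h1 : Finset.Icc 1 M = Finset.Icc 1 k ∪ Finset.Ioc k M := by
    ext q; simp; omega
  have h2 : Finset.Icc k M = insert k (Finset.Ioc k M) := by
    ext q; simp; omega
  rw [h1, Finset.sum_union, h2, Finset.sum_insert (by simp)]
  · have h3 : ∑ q ∈ Finset.Ioc k M, gtFactor P k q M • ρ q =
        ∑ q ∈ Finset.Ioc k M, stepCoeff P q M • ρ q :=
      Finset.sum_congr rfl fun q hq ↦ by
        rw [Finset.mem_Ioc] at hq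
        rw [gtFactor_of_lt P hq.1]
    have h4 : ∑ q ∈ Finset.Icc 1 k, stepCoeff P q M • ρ q =
        ∑ q ∈ Finset.Icc 1 k, P.hFlat q • ρ q :=
      Finset.sum_congr rfl fun q hq ↦ by
        rw [Finset.mem_Icc] at hq
        rw [stepCoeff, if_neg (by omega)]
    have h5 : gtFactor P k k M = 1 := by rw [gtFactor, if_pos rfl, if_neg hM.ne]
    rw [h3, h4, h5, one_smul]
    abel
  · rw [Finset.disjoint_left]
    intro q h1 h2
    rw [Finset.mem_Icc] at h1
    rw [Finset.mem_Ioc] at h2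
    omega

/-- The heart of the proof: the terms by which the free and the constrained sum differ, collected
for a fixed value `q` of the second exponent. Let `N` be the nested sum at `ν + q α_j + q α_{j+1}`,
a weight with gap `M - q` at `j`. If `q < M` and `n ∣ q`, the difference is `(1 - v)(τ_j N - v N)`;
if `q < M` and `n ∤ q`, all its coefficients vanish; if `q = M`, the gap is zero and `τ_j N = -N`.
In every case `E` gives zero. -/
theorem ActsAsDemazureLusztig.map_bracket (h : ActsAsDemazureLusztig P r ξ τ) {j : ℕ} (hj : j < r)
    {E : V →ₗ[ℂ] V'} (hE1 : ∀ f, E (τ j f) = P.v • E f) (hE2 : ∀ f, τ j f = -f → E f = 0)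
    (f : ℕ) {q : ℤ} {ν : ℕ → ℤ} (hq : 1 ≤ q) (hq' : q ≤ gap ν j) :
    E (P.hFlat q • ∑ k ∈ Finset.Icc q (gap ν j), stepCoeff P k (gap ν j) •
        nest P ξ f (j + 2) q (ν + k • natRoot j + q • natRoot (j + 1))
      - stepCoeff P q (gap ν j) •
        nest P ξ f (j + 2) q (ν + q • natRoot j + q • natRoot (j + 1))) = 0 := by
  set M := gap ν j with hM
  have hgap : gap (ν + q • natRoot j + q • natRoot (j + 1)) j = M - q := by
    rw [gap_succ_add, gap_add_self]; ring
  rcases hq'.lt_or_eq with hlt | rfl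
  · by_cases hdvd : (n : ℤ) ∣ q
    · have hh : P.hFlat q = 1 - P.v := by rw [Parameters.hFlat, if_pos hdvd]
      have hstep := h.step_nest hj f (j + 2) q _ le_rfl
        (by rw [hgap]; omega : 1 ≤ gap (ν + q • natRoot j + q • natRoot (j + 1)) j)
      rw [hgap] at hstep
      have hI : Finset.Icc q M = insert q (Finset.Ioc q M) := by ext k; simp; omega
      have hsum : ∑ k ∈ Finset.Ioc q M, stepCoeff P k M •
          nest P ξ f (j + 2) q (ν + k • natRoot j + q • natRoot (j + 1)) =
          τ j (nest P ξ f (j + 2) q (ν + q • natRoot j + q • natRoot (j + 1))) := by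
        rw [hstep]
        refine Finset.sum_nbij' (fun k ↦ k - q) (fun k ↦ k + q) ?_ ?_ ?_ ?_ ?_
        · intro k hk; rw [Finset.mem_Ioc] at hk; rw [Finset.mem_Icc]; omega
        · intro k hk; rw [Finset.mem_Icc] at hk; rw [Finset.mem_Ioc]; omega
        · intro k _; ring
        · intro k _; ring
        · intro k _
          have e1 : ν + q • natRoot j + q • natRoot (j + 1) + (k - q) • natRoot j =
            ν + k • natRoot j + q • natRoot (j + 1) := by module
          -- Subtracting the multiple `q` of `n` from both arguments changes neither the
          -- divisibility in `h♭` nor the residue in `g♭`.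
          have e2 : stepCoeff P (k - q) (M - q) = stepCoeff P k M := by
            obtain ⟨a, rfl⟩ := hdvd
            simp [stepCoeff, Parameters.gFlat, Parameters.hFlat,
              dvd_sub_left (dvd_mul_right (n : ℤ) a)]
          rw [e1, e2]
      have hc : stepCoeff P q M = 1 - P.v := by rw [stepCoeff, if_neg hlt.ne, hh]
      rw [hI, Finset.sum_insert (by simp), hsum, hc, hh, map_sub, map_smul, map_add, map_smul,
        hE1]
      module
    · have hh : P.hFlat q = 0 := by rw [Parameters.hFlat, if_neg hdvd]
      have hc : stepCoeff P q M = 0 := by rw [stepCoeff, if_neg hlt.ne, hh]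
      rw [hh, hc, zero_smul, zero_smul, sub_zero, map_zero]
  · rw [Finset.Icc_self, Finset.sum_singleton, map_sub, map_smul, map_smul,
      hE2 _ (h.neg_nest hj f _ _ _ le_rfl (by rw [hgap, sub_self]))]
    simp

/-- By induction the part `τ_m ⋯ τ_{j+1}` gives sums whose first exponent is bounded below by `1`,
while the nested sum demands the bound `k`, the exponent just used for `α_j`. The error vanishes by
`map_bracket`. -/
theorem ActsAsDemazureLusztig.map_descProd (h : ActsAsDemazureLusztig P r ξ τ) {m : ℕ} (hm : m < r)
    {E : V →ₗ[ℂ] V'} (hE1 : ∀ j < m, ∀ f, E (τ j f) = P.v • E f)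
    (hE2 : ∀ j < m, ∀ f, τ j f = -f → E f = 0) (f : ℕ) : ∀ (j : ℕ) (ν : ℕ → ℤ), j + f = m →
    (∀ i, j ≤ i → i ≤ m → 1 ≤ gap ν i) →
    E (descProd τ m j (ξ ν)) = ∑ k ∈ Finset.Icc 1 (gap ν j),
      stepCoeff P k (gap ν j) • E (nest P ξ f (j + 1) k (ν + k • natRoot j)) := by
  induction f with
  | zero =>
    intro j ν hj hν
    obtain rfl : j = m := by omega
    rw [descProd_of_le _ le_rfl, descProd_self, one_mul, h.step j hm ν (hν j le_rfl le_rfl)]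
    simp only [map_sum, map_smul, nest]
  | succ f ih =>
    intro j ν hj hν
    rw [descProd_of_le _ (by omega), Module.End.mul_apply, h.step j (by omega) ν
      (hν j le_rfl (by omega))]
    simp only [map_sum, map_smul]
    rw [← sub_eq_zero, ← Finset.sum_sub_distrib]
    set M := gap ν j with hM
    have hk : ∀ k ∈ Finset.Icc 1 M, stepCoeff P k M • E (descProd τ m (j + 1)
          (ξ (ν + k • natRoot j))) -
        stepCoeff P k M • E (nest P ξ (f + 1) (j + 1) k (ν + k • natRoot j)) =
        ∑ q ∈ Finset.Icc 1 k, E (P.hFlat q • stepCoeff P k M •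
          nest P ξ f (j + 2) q (ν + k • natRoot j + q • natRoot (j + 1))) -
        E (stepCoeff P k M • nest P ξ f (j + 2) k (ν + k • natRoot j + k • natRoot (j + 1))) := by
      intro k hk
      rw [Finset.mem_Icc] at hk
      have hν1 := hν (j + 1) (by omega) (by omega)
      rw [ih (j + 1) _ (by omega), nest, map_sum, ← smul_sub]
      · simp only [map_smul]
        rw [sum_stepCoeff_sub hk.1 (by rw [gap_add_succ]; omega)
          (fun q ↦ E (nest P ξ f (j + 2) q (ν + k • natRoot j + q • natRoot (j + 1)))),
          smul_sub, Finset.smul_sum]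
        congr 1
        exact Finset.sum_congr rfl fun q _ ↦ smul_comm _ _ _
      · intro i hi hi'
        rcases hi.eq_or_lt with rfl | hlt
        · rw [gap_add_succ]; omega
        · rw [gap_add_of_lt _ _ (by omega)]; exact hν i (by omega) hi'
    -- Exchange the order of summation so that the errors are grouped by the second exponent `q`,
    -- with `k` running from `q` to `M`.
    rw [Finset.sum_congr rfl hk, Finset.sum_sub_distrib,
      Finset.sum_comm' (t' := Finset.Icc 1 M) (s' := fun q ↦ Finset.Icc q M),
      ← Finset.sum_sub_distrib]
    · refine Finset.sum_eq_zero fun q hq ↦ ?_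
      rw [Finset.mem_Icc] at hq
      have := h.map_bracket (by omega) (hE1 j (by omega)) (hE2 j (by omega)) f (q := q) (ν := ν)
        hq.1 hq.2
      rw [map_sub, Finset.smul_sum, map_sum] at this
      exact this
    · intro k q
      simp only [Finset.mem_Icc]
      omega

/-- In the nested sum with lower bound `0`, the terms with first exponent `k ≥ 1` come from the
product ending in `τ_j`. The term `k = 0` has factor `1` because the gap is positive, leaves the
weight unchanged, and is the same nested sum for the shorter products. -/
theorem ActsAsDemazureLusztig.map_sum_descProd (h : ActsAsDemazureLusztig P r ξ τ) {m : ℕ}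
    (hm : m < r)
    {E : V →ₗ[ℂ] V'} (hE1 : ∀ j < m, ∀ f, E (τ j f) = P.v • E f)
    (hE2 : ∀ j < m, ∀ f, τ j f = -f → E f = 0) {ν : ℕ → ℤ} (f : ℕ) : ∀ j, j + f = m + 1 →
    (∀ i, j ≤ i → i ≤ m → 1 ≤ gap ν i) →
    E ((∑ i ∈ Finset.Icc j (m + 1), descProd τ m i) (ξ ν)) =
      nest P (fun ν ↦ E (ξ ν)) f j 0 ν := by
  induction f with
  | zero =>
    intro j hj hν
    obtain rfl : j = m + 1 := by omega
    simp [descProd_self, nest]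
  | succ f ih =>
    intro j hj hν
    have hI : Finset.Icc j (m + 1) = insert j (Finset.Icc (j + 1) (m + 1)) := by
      ext i; simp; omega
    have hg := hν j le_rfl (by omega)
    have hI2 : Finset.Icc 0 (gap ν j) = insert 0 (Finset.Icc 1 (gap ν j)) := by
      ext i; simp; omega
    rw [hI, Finset.sum_insert (by simp), LinearMap.add_apply, map_add,
      ih (j + 1) (by omega) fun i hi hi' ↦ hν i (by omega) hi',
      h.map_descProd hm hE1 hE2 f j ν (by omega) hν, nest, hI2, Finset.sum_insert (by simp),
      add_comm]
    have e : gtFactor P 0 0 (gap ν j) = 1 := by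
      rw [gtFactor, if_pos rfl, if_neg (by omega)]
    rw [e, one_smul, zero_smul, add_zero]
    congr 1
    refine Finset.sum_congr rfl fun k hk ↦ ?_
    rw [Finset.mem_Icc] at hk
    rw [gtFactor_of_lt P (by omega), map_nest]

/-- When column `i` is reached, adding `k α_{i-1}` has raised its gap from `0` to `k`, which is also
its lower bound. The only possible exponent is then both circled and boxed, and its factor is `0`.
-/
theorem nest_eq_zero {i : ℕ} (f : ℕ) : ∀ (j : ℕ) (l : ℤ) (ν : ℕ → ℤ),
    (i = j ∧ gap ν i = l ∨ j < i ∧ gap ν i = 0) → i < j + f → nest P ξ f j l ν = 0 := by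
  induction f with
  | zero => intro j l ν h h'; omega
  | succ f ih =>
    intro j l ν h h'
    rw [nest]
    refine Finset.sum_eq_zero fun k hk ↦ ?_
    rcases h with ⟨rfl, h⟩ | ⟨hlt, h⟩
    · rw [h, Finset.Icc_self, Finset.mem_singleton] at hk
      rw [gtFactor, if_pos hk, if_pos (by rw [h, hk]), zero_smul]
    · rw [ih (j + 1) k, smul_zero]
      · rcases Nat.eq_or_lt_of_le (Nat.succ_le_of_lt hlt) with h1 | h1
        · left
          subst h1
          exact ⟨rfl, by rw [gap_add_succ, h, zero_add]⟩
        · right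
          exact ⟨h1, by rw [gap_add_of_lt _ _ (by omega), h]⟩
      · omega

/-! ### Sums over interlacing rows -/

open Classical in
/-- The weights reached by the nested sum. -/
def rows : ℕ → ℕ → ℤ → (ℕ → ℤ) → Finset (ℕ → ℤ)
  | 0, _, _, ν => {ν}
  | f + 1, j, l, ν => (Finset.Icc l (gap ν j)).biUnion fun k ↦ rows f (j + 1) k (ν + k • natRoot j)

/-- After adding `i` to the `i`-th coordinate the inequalities say that the new row interlaces with
the old one. The coordinate `j + f` has no inequality of its own; it is determined by the conserved
sum. -/
theorem mem_rows (f : ℕ) : ∀ (j : ℕ) (l : ℤ) (ν ν' : ℕ → ℤ), ν' ∈ rows f j l ν ↔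
    (∀ i, i < j ∨ j + f < i → ν' i = ν i) ∧
    ∑ i ∈ Finset.range (f + 1), ν' (j + i) = ∑ i ∈ Finset.range (f + 1), ν (j + i) ∧
    (0 < f → ν j + l ≤ ν' j ∧ ν' j ≤ ν (j + 1) + 1) ∧
    ∀ i, j < i → i < j + f → ν i ≤ ν' i ∧ ν' i ≤ ν (i + 1) + 1 := by
  induction f with
  | zero =>
    intro j l ν ν'
    simp only [rows, Finset.mem_singleton, zero_add, Finset.range_one, Finset.sum_singleton,
      add_zero, lt_irrefl, false_imp_iff, true_and]
    constructor
    · rintro rfl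
      exact ⟨fun _ _ ↦ rfl, rfl, fun i _ _ ↦ by omega⟩
    · rintro ⟨h1, h2, _⟩
      funext i
      rcases Nat.lt_trichotomy i j with h | rfl | h
      · exact h1 i (Or.inl h)
      · exact h2
      · exact h1 i (Or.inr h)
  | succ f ih =>
    intro j l ν ν'
    simp only [rows, Finset.mem_biUnion, Finset.mem_Icc, ih]
    have hs : ∀ k : ℤ, ∑ i ∈ Finset.range (f + 1), (ν + k • natRoot j) (j + 1 + i) =
        ∑ i ∈ Finset.range (f + 1), ν (j + 1 + i) - k := by
      intro k
      rw [Finset.sum_range_succ', Finset.sum_range_succ', add_zero, add_smul_natRoot_succ,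
        ← add_sub_assoc]
      congr 2
      exact Finset.sum_congr rfl fun i _ ↦ add_smul_natRoot_of_ne _ _ (by omega) (by omega)
    have hs2 : ∀ μ : ℕ → ℤ, ∑ i ∈ Finset.range (f + 1 + 1), μ (j + i) =
        ∑ i ∈ Finset.range (f + 1), μ (j + 1 + i) + μ j := by
      intro μ
      rw [Finset.sum_range_succ', add_zero]
      congr 1
      exact Finset.sum_congr rfl fun i _ ↦ by rw [add_assoc, add_comm 1 i]
    constructor
    · rintro ⟨k, ⟨hk1, hk2⟩, h1, h2, h3, h4⟩
      have hj : ν' j = ν j + k := by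
        rw [h1 j (Or.inl (by omega)), add_smul_natRoot_self]
      rw [gap] at hk2
      rw [hs] at h2
      refine ⟨fun i hi ↦ ?_, ?_, fun _ ↦ by omega, fun i hi hi' ↦ ?_⟩
      · rw [h1 i (by omega), add_smul_natRoot_of_ne _ _ (by omega) (by omega)]
      · rw [hs2, hs2, h2, hj]; ring
      · rcases Nat.eq_or_lt_of_le (Nat.succ_le_of_lt hi) with rfl | hlt
        · have := h3 (by omega)
          rw [add_smul_natRoot_succ, add_smul_natRoot_of_ne _ _ (by omega) (by omega)] at this
          simp only [Nat.succ_eq_add_one]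
          omega
        · have := h4 i (by omega) (by omega)
          rw [add_smul_natRoot_of_ne _ _ (by omega) (by omega),
            add_smul_natRoot_of_ne _ _ (by omega) (by omega)] at this
          exact this
    · rintro ⟨h1, h2, h3, h4⟩
      have h3 := h3 (by omega)
      rw [hs2, hs2] at h2
      refine ⟨ν' j - ν j, ⟨by omega, by rw [gap]; omega⟩, fun i hi ↦ ?_, ?_, fun hf ↦ ?_,
        fun i hi hi' ↦ ?_⟩
      · by_cases hij : i = j
        · subst hij; rw [add_smul_natRoot_self]; ring
        · rw [add_smul_natRoot_of_ne _ _ (by omega) (by omega), h1 i (by omega)]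
      · rw [hs]; linarith
      · have := h4 (j + 1) (by omega) (by omega)
        rw [add_smul_natRoot_succ, add_smul_natRoot_of_ne _ _ (by omega) (by omega)]
        omega
      · rw [add_smul_natRoot_of_ne _ _ (by omega) (by omega),
            add_smul_natRoot_of_ne _ _ (by omega) (by omega)]
        exact h4 i (by omega) (by omega)

variable (P) in
/-- The product of the Gelfand–Tsetlin factors of a step from `ν` to `ν'`. -/
def rowCoeff : ℕ → ℕ → ℤ → (ℕ → ℤ) → (ℕ → ℤ) → ℂ
  | 0, _, _, _, _ => 1
  | f + 1, j, l, ν, ν' => gtFactor P l (ν' j - ν j) (gap ν j) *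
      rowCoeff f (j + 1) (ν' j - ν j) (ν + (ν' j - ν j) • natRoot j) ν'

/-- The exponents can be recovered from the final weight: no step after the one in column `j`
changes coordinate `j`, so `k = ν'_j - ν_j`, and the union defining `rows` is disjoint. -/
theorem nest_eq_sum_rows (f : ℕ) : ∀ (j : ℕ) (l : ℤ) (ν : ℕ → ℤ), nest P ξ f j l ν =
    ∑ ν' ∈ rows f j l ν, rowCoeff P f j l ν ν' • ξ ν' := by
  induction f with
  | zero => intro j l ν; simp [nest, rows, rowCoeff]
  | succ f ih =>
    intro j l ν
    have hj : ∀ k, ∀ ν' ∈ rows f (j + 1) k (ν + k • natRoot j), ν' j - ν j = k := by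
      intro k ν' h
      rw [mem_rows] at h
      rw [h.1 j (Or.inl (by omega)), add_smul_natRoot_self]
      ring
    classical
    rw [nest, rows, Finset.sum_biUnion]
    · refine Finset.sum_congr rfl fun k _ ↦ ?_
      rw [ih, Finset.smul_sum]
      refine Finset.sum_congr rfl fun ν' h ↦ ?_
      rw [rowCoeff, hj k ν' h, mul_smul]
    · intro k _ k' _ hne
      rw [Function.onFun, Finset.disjoint_left]
      intro ν' h h'
      exact hne ((hj k ν' h).symm.trans (hj k' ν' h'))

variable (P ξ) in
/-- The iterated sum over all rows. -/
def iterSum : ℕ → (ℕ → ℤ) → V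
  | 0, ν => ξ ν
  | m + 1, ν => nest P (iterSum m) (m + 1) 0 0 ν

end Nest

end

/-! ### The operator side as an iterated sum over interlacing rows. -/

section

variable {r n : ℕ}

section

variable {V : Type*} [AddCommGroup V] [Module ℂ V] {P : Parameters n}

theorem nest_congr {ξ ξ' : (ℕ → ℤ) → V} {f j : ℕ} {l : ℤ} {ν : ℕ → ℤ}
    (h : ∀ ν' ∈ rows f j l ν, ξ ν' = ξ' ν') : nest P ξ f j l ν = nest P ξ' f j l ν := by
  rw [nest_eq_sum_rows, nest_eq_sum_rows]
  exact Finset.sum_congr rfl fun ν' hν' ↦ by rw [h ν' hν']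

/-- Interlacing gives `ν'_i ≤ ν_{i+1} + 1 ≤ ν'_{i+1} + 1`. Strictness may be lost, which is why
`parabolicSum_natMono` has to allow zero gaps. -/
theorem gap_nonneg_of_mem_rows {m c : ℕ} {ν ν' : ℕ → ℤ} (hc : c ≤ m + 1)
    (hν : ∀ i ≤ m, 1 ≤ gap ν i) (h : ν' ∈ rows (m + 1 - c) c 0 ν) {i : ℕ} (hi : i < m) :
    0 ≤ gap ν' i := by
  rw [mem_rows] at h
  obtain ⟨h1, _, h3, h4⟩ := h
  have g1 := hν i hi.le
  have g2 := hν (i + 1) (by omega)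
  rw [gap] at *
  have key : ∀ i, c ≤ i → i ≤ m → ν i ≤ ν' i ∧ ν' i ≤ ν (i + 1) + 1 := by
    intro i hci him
    rcases hci.eq_or_lt with rfl | hlt
    · have := h3 (by omega)
      omega
    · exact h4 i hlt (by omega)
  have k1 := key (i + 1)
  rcases Nat.lt_or_ge i c with hic | hic
  · rw [h1 i (Or.inl hic)]
    rcases Nat.lt_or_ge (i + 1) c with hic' | hic'
    · rw [h1 _ (Or.inl hic')]; omega
    · have := k1 hic' (by omega); omega
  · have := key i hic hi.le
    have := k1 (by omega) (by omega)
    omega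

end

variable [NeZero n]

/-- The monomial with the given exponents. -/
def natMono (r : ℕ) (ν : ℕ → ℤ) : laurent r := mono fun j ↦ ν j

theorem natMono_add (i : Fin r) (ν : ℕ → ℤ) (k : ℤ) :
    natMono r (ν + k • natRoot i) = mono ((fun j : Fin (r + 1) ↦ ν j) + k • root i) := by
  rw [natMono]
  congr 1
  funext j
  simp only [Pi.add_apply, Pi.smul_apply, natRoot, root, Pi.sub_apply, Pi.single_apply,
    Fin.ext_iff, Fin.val_castSucc, Fin.val_succ]
  split_ifs <;> first | omega | simp

theorem natFam_actsAs (P : Parameters n) :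
    ActsAsDemazureLusztig P r (natMono r) (natFam (laurentOp P)) := by
  constructor
  · intro j hj ν h
    have e := natFam_of_lt (laurentOp P) (⟨j, hj⟩ : Fin r)
    simp only at e
    rw [gap] at h
    rw [e, natMono, laurentOp_mono P _ _ (by simp; omega)]
    refine Finset.sum_congr ?_ fun k _ ↦ ?_
    · simp [gap]
    · have := natMono_add (⟨j, hj⟩ : Fin r) ν k
      simp only at this
      rw [this]
      simp [gap]
  · intro j hj ν h
    have e := natFam_of_lt (laurentOp P) (⟨j, hj⟩ : Fin r)
    simp only at e
    rw [gap] at h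
    rw [e, natMono, laurentOp_mono_of_eq P _ _ (by simp; omega)]

/-- The sum factors as `F (1 + T_j)`, and the quadratic relation is `(1 + T_j) T_j = v (1 + T_j)`.
-/
theorem parabolicSum_comp (P : Parameters n) {m j : ℕ} (hj : j < m) (hm : m ≤ r)
    (f : laurent r) :
    parabolicSum (laurentOp P) m (natFam (laurentOp P) j f) =
      P.v • parabolicSum (laurentOp P) m f ∧
    (natFam (laurentOp P) j f = -f → parabolicSum (laurentOp P) m f = 0) := by
  have e := natFam_of_lt (laurentOp P) (⟨j, by omega⟩ : Fin r)
  simp only at e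
  obtain ⟨F, hF⟩ := exists_parabolicSum_eq (M := Module.End ℂ (laurent r)) (laurentOp_satisfiesBraid P) (m := m)
    (i := (⟨j, by omega⟩ : Fin r)) hj
  rw [hF, e]
  simp only [Module.End.mul_apply, LinearMap.add_apply, Module.End.one_apply]
  constructor
  · rw [laurentOp_quadratic, ← map_smul F]
    refine congrArg F ?_
    module
  · intro h
    rw [h, add_neg_cancel, map_zero]

theorem parabolicSum_mul_natMono (P : Parameters n) {m : ℕ} (hm : m < r) {c : ℕ}
    (hc : c ≤ m + 1) {ν : ℕ → ℤ} (hν : ∀ i, c ≤ i → i ≤ m → 1 ≤ gap ν i) :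
    (parabolicSum (laurentOp P) m *
      ∑ j ∈ Finset.Icc c (m + 1), descProd (natFam (laurentOp P)) m j : Module.End ℂ (laurent r))
      (natMono r ν) =
      nest P (fun ν ↦ parabolicSum (laurentOp P) m (natMono r ν)) (m + 1 - c) c 0 ν := by
  rw [Module.End.mul_apply]
  exact (natFam_actsAs P).map_sum_descProd hm (fun j hj f ↦ (parabolicSum_comp P hj hm.le f).1)
    (fun j hj f ↦ (parabolicSum_comp P hj hm.le f).2) (m + 1 - c) c (by omega) hν

theorem parabolicSum_natMono (P : Parameters n) {m : ℕ} (hm : m ≤ r) : ∀ ν : ℕ → ℤ,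
    (∀ i < m, 0 ≤ gap ν i) →
    parabolicSum (laurentOp P) m (natMono r ν) = iterSum P (natMono r) m ν := by
  induction m with
  | zero => intro ν _; rw [parabolicSum_zero]; rfl
  | succ m ih =>
    intro ν hν
    -- A zero gap means `T_i x^ν = -x^ν`, so the left side vanishes; on the right this is the
    -- vanishing for patterns with repeated entries in a row.
    by_cases h : ∃ i ≤ m, gap ν i = 0
    · obtain ⟨i, hi, h0⟩ := h
      rw [(parabolicSum_comp P (j := i) (by omega) hm _).2
        ((natFam_actsAs P).neg i (by omega) ν h0), iterSum]
      symm
      apply nest_eq_zero (i := i) _ _ _ _ _ (by omega)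
      rcases Nat.eq_zero_or_pos i with h1 | h1
      · exact Or.inl ⟨h1, h0⟩
      · exact Or.inr ⟨h1, h0⟩
    · push Not at h
      have hν' : ∀ i ≤ m, 1 ≤ gap ν i := fun i hi ↦ by
        have := hν i (by omega)
        have := h i hi
        omega
      rw [parabolicSum_succ (M := Module.End ℂ (laurent r)) (laurentOp_satisfiesBraid P) (by omega),
        parabolicSum_mul_natMono P (by omega) (by omega) fun i _ ↦ hν' i, iterSum]
      exact nest_congr fun ν' h' ↦ ih (by omega) ν' fun i hi ↦
        gap_nonneg_of_mem_rows (by omega) hν' h' hi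

theorem sum_bruhatInterval_natMono (P : Parameters n) {m c : ℕ} (hm : m < r) (hc : c ≤ m + 1)
    {ν : ℕ → ℤ} (hν : ∀ i ≤ m, 1 ≤ gap ν i) :
    (∑ u ∈ bruhatInterval (topEl m * cycleEl m c : Weyl r), demazureLusztig P u)
      (natMono r ν : RatFun r) =
      ((nest P (iterSum P (natMono r) m) (m + 1 - c) c 0 ν : laurent r) : RatFun r) := by
  have h1 : nest P (iterSum P (natMono r) m) (m + 1 - c) c 0 ν =
      nest P (fun ν ↦ parabolicSum (laurentOp P) m (natMono r ν)) (m + 1 - c) c 0 ν :=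
    nest_congr fun ν' h' ↦ (parabolicSum_natMono P hm.le ν' fun i hi ↦
      gap_nonneg_of_mem_rows hc hν h' hi).symm
  rw [h1, ← parabolicSum_mul_natMono P hm hc fun i _ ↦ hν i,
    ← sum_sectionSet_heckeProd (M := Module.End ℂ (laurent r)) (laurentOp_satisfiesBraid P) hm, bruhatInterval_topEl_mul hm hc,
    LinearMap.sum_apply, LinearMap.sum_apply, Submodule.coe_sum]
  exact Finset.sum_congr rfl fun u _ ↦ demazureLusztig_apply_laurent P u _

end

/-! ### The signature rule on reading words of tableaux given by chains of shapes. -/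

section

variable {r : ℕ}

/-! ### Kashiwara operators on words -/

section Words

variable {i : ℕ}

theorem wordPhi_append_of_forall_ne {u w : List ℕ} (h : ∀ a ∈ u, a ≠ i ∧ a ≠ i + 1) :
    wordPhi i (u ++ w) = wordPhi i w := by
  induction u with
  | nil => rfl
  | cons a u ih =>
    have ha := h a List.mem_cons_self
    rw [List.cons_append, wordPhi, if_neg ha.1, if_neg ha.2,
      ih fun b hb ↦ h b (List.mem_cons_of_mem _ hb)]

theorem wordPhi_replicate_self (A : ℕ) (w : List ℕ) :
    wordPhi i (List.replicate A i ++ w) = wordPhi i w + A := by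
  induction A with
  | zero => simp
  | succ A ih => rw [List.replicate_succ, List.cons_append, wordPhi, if_pos rfl, ih, add_assoc]

theorem wordPhi_replicate_succ (B : ℕ) (w : List ℕ) :
    wordPhi i (List.replicate B (i + 1) ++ w) = wordPhi i w - B := by
  induction B with
  | zero => simp
  | succ B ih =>
    rw [List.replicate_succ, List.cons_append, wordPhi, if_neg (by omega), if_pos rfl, ih]
    omega

theorem wordF_cons_of_lt {a : ℕ} {w : List ℕ} (h : (if a = i + 1 then 1 else 0) < wordPhi i w) :
    wordF i (a :: w) = (wordF i w).map (a :: ·) := by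
  rw [wordF, if_pos h]

theorem wordF_append_of_forall_ne {u w w' : List ℕ} (h : ∀ a ∈ u, a ≠ i ∧ a ≠ i + 1)
    (hw : 0 < wordPhi i w) (hF : wordF i w = some w') : wordF i (u ++ w) = some (u ++ w') := by
  induction u with
  | nil => exact hF
  | cons a u ih =>
    have ha := h a List.mem_cons_self
    have hu := fun b hb ↦ h b (List.mem_cons_of_mem _ hb)
    rw [List.cons_append, wordF_cons_of_lt, ih hu, Option.map_some, List.cons_append]
    rwa [if_neg ha.2, wordPhi_append_of_forall_ne hu]

theorem wordF_replicate_self (A : ℕ) {w w' : List ℕ} (hw : 0 < wordPhi i w)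
    (hF : wordF i w = some w') :
    wordF i (List.replicate A i ++ w) = some (List.replicate A i ++ w') := by
  induction A with
  | zero => exact hF
  | succ A ih =>
    rw [List.replicate_succ, List.cons_append, wordF_cons_of_lt, ih, Option.map_some,
      List.cons_append]
    rw [if_neg (by omega), wordPhi_replicate_self]
    omega

theorem wordF_replicate_succ (B : ℕ) {w w' : List ℕ} (hw : B < wordPhi i w)
    (hF : wordF i w = some w') :
    wordF i (List.replicate B (i + 1) ++ w) = some (List.replicate B (i + 1) ++ w') := by
  induction B with
  | zero => exact hF
  | succ B ih =>
    rw [List.replicate_succ, List.cons_append, wordF_cons_of_lt, ih (by omega), Option.map_some,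
      List.cons_append]
    rw [if_pos rfl, wordPhi_replicate_succ]
    omega

theorem wordF_replicate_hit (A : ℕ) {w : List ℕ} (hw : wordPhi i w = 0) :
    wordF i (List.replicate (A + 1) i ++ w) = some (List.replicate A i ++ (i + 1) :: w) := by
  rw [List.replicate_succ', List.append_assoc, List.singleton_append]
  apply wordF_replicate_self
  · rw [wordPhi, if_pos rfl]; omega
  · rw [wordF, if_neg (by omega), if_pos rfl]

theorem wordF_eq_none {w : List ℕ} (hw : wordPhi i w = 0) : wordF i w = none := by
  induction w with
  | nil => rfl
  | cons a w ih =>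
    rw [wordPhi] at hw
    rw [wordF]
    by_cases h1 : a = i
    · rw [if_pos h1] at hw; omega
    · rw [if_neg h1] at hw ⊢
      by_cases h2 : a = i + 1
      · rw [if_pos h2] at hw ⊢
        rw [if_neg (by omega)]
      · rw [if_neg h2] at hw ⊢
        rw [hw, if_neg (by omega)]

end Words

/-! ### Chains of shapes -/

/-- Chains of partitions `s 0 ⊆ s 1 ⊆ ⋯ ⊆ s (r + 1) = μ` whose successive differences are
horizontal strips. -/
structure ShapeChain (μ : DominantEffectiveWeight r) where
  s : ℕ → ℕ → ℕ
  zero : ∀ p, s 0 p = 0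
  le : ∀ k p, s k p ≤ s (k + 1) p
  strip : ∀ k p, s (k + 1) (p + 1) ≤ s k p
  top : ∀ k p, r < k → s k p = μ.diagram.rowLen p

namespace ShapeChain

variable {μ : DominantEffectiveWeight r}

@[ext] theorem ext {S S' : ShapeChain μ} (h : ∀ k ≤ r, ∀ p, S.s k p = S'.s k p) : S = S' := by
  cases S with
  | mk s h1 h2 h3 h4 =>
    cases S' with
    | mk s' h1' h2' h3' h4' =>
      have : s = s' := by
        funext k p
        rcases Nat.lt_or_ge r k with hk | hk
        · exact (h4 k p hk).trans (h4' k p hk).symm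
        · exact h k hk p
      subst this
      rfl

theorem eq_zero (S : ShapeChain μ) : ∀ {k p : ℕ}, k ≤ p → S.s k p = 0 := by
  intro k
  induction k with
  | zero => intro p _; exact S.zero p
  | succ k ih =>
    intro p hp
    obtain ⟨p, rfl⟩ : ∃ q, p = q + 1 := ⟨p - 1, by omega⟩
    have := S.strip k p
    rw [ih (by omega)] at this
    omega

theorem mono (S : ShapeChain μ) (p : ℕ) : Monotone fun k ↦ S.s k p := monotone_nat_of_le_succ (S.le · p)

/-- The letters of row `p`. -/
def rowWord (S : ShapeChain μ) (k p : ℕ) : List ℕ :=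
  (List.range k).flatMap fun l ↦ List.replicate (S.s (l + 1) p - S.s l p) l

/-- The word of the rows above row `q`. -/
def word (S : ShapeChain μ) (q : ℕ) : List ℕ :=
  (List.range q).reverse.flatMap (S.rowWord (r + 1))

theorem word_succ (S : ShapeChain μ) (q : ℕ) :
    S.word (q + 1) = S.rowWord (r + 1) q ++ S.word q := by
  rw [word, List.range_succ, List.reverse_append, List.reverse_singleton, List.singleton_append,
    List.flatMap_cons, word]

theorem rowWord_succ (S : ShapeChain μ) (k p : ℕ) :
    S.rowWord (k + 1) p = S.rowWord k p ++ List.replicate (S.s (k + 1) p - S.s k p) k := by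
  simp [rowWord, List.range_succ]

theorem lt_of_mem_rowWord (S : ShapeChain μ) {k p a : ℕ} (h : a ∈ S.rowWord k p) : a < k := by
  simp only [rowWord, List.mem_flatMap, List.mem_range, List.mem_replicate] at h
  obtain ⟨l, hl, _, rfl⟩ := h
  exact hl

/-- Within a row the letters `i` and `i + 1` are adjacent runs, with smaller letters before and
larger ones after. The last clause gives the same decomposition, with the same outer parts, for a
chain changed only at level `i + 1`: such a change moves the boundary between the two runs. -/
theorem rowWord_split (S : ShapeChain μ) {i : ℕ} (p : ℕ) (d : ℕ) : ∃ u : List ℕ,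
    (∀ a ∈ u, i + 1 < a) ∧
    S.rowWord (i + 2 + d) p = S.rowWord i p ++ (List.replicate (S.s (i + 1) p - S.s i p) i ++
      (List.replicate (S.s (i + 2) p - S.s (i + 1) p) (i + 1) ++ u)) ∧
    ∀ S' : ShapeChain μ, (∀ k, k ≠ i + 1 → S'.s k p = S.s k p) →
      S'.rowWord (i + 2 + d) p = S.rowWord i p ++
        (List.replicate (S'.s (i + 1) p - S.s i p) i ++
      (List.replicate (S.s (i + 2) p - S'.s (i + 1) p) (i + 1) ++ u)) := by
  induction d with
  | zero =>
    refine ⟨[], by simp, ?_, ?_⟩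
    · simp [rowWord_succ]
    · intro S' h
      have : S'.rowWord i p = S.rowWord i p := by
        unfold rowWord
        apply List.flatMap_congr
        intro l hl
        rw [List.mem_range] at hl
        rw [h _ (by omega), h _ (by omega)]
      simp [rowWord_succ, this, h i (by omega), h (i + 2) (by omega)]
  | succ d ih =>
    obtain ⟨u, h1, h2, h3⟩ := ih
    refine ⟨u ++ List.replicate (S.s (i + 2 + d + 1) p - S.s (i + 2 + d) p) (i + 2 + d), ?_, ?_, ?_⟩
    · intro a ha
      rcases List.mem_append.1 ha with ha | ha
      · exact h1 a ha
      · rw [List.eq_of_mem_replicate ha]; omega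
    · rw [← add_assoc, rowWord_succ, h2]; simp
    · intro S' h
      rw [← add_assoc, rowWord_succ, h3 S' h, h (i + 2 + d + 1) (by omega), h (i + 2 + d) (by omega)]
      simp

variable {i : ℕ} (S : ShapeChain μ)

/-- The letters `i + 1` of the row cancel against the letters `i` of the rows above it, which come
later in the word; the letters `i` of the row are then added. -/
theorem wordPhi_rowWord (hi : i < r) (p : ℕ) (w : List ℕ) :
    wordPhi i (S.rowWord (r + 1) p ++ w) =
      (wordPhi i w - (S.s (i + 2) p - S.s (i + 1) p)) + (S.s (i + 1) p - S.s i p) := by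
  obtain ⟨u, h1, h2, _⟩ := S.rowWord_split (i := i) p (r - i - 1)
  rw [show r + 1 = i + 2 + (r - i - 1) by omega, h2]
  simp only [List.append_assoc]
  rw [wordPhi_append_of_forall_ne, wordPhi_replicate_self, wordPhi_replicate_succ,
    wordPhi_append_of_forall_ne]
  · intro a ha; have := h1 a ha; omega
  · intro a ha; have := S.lt_of_mem_rowWord ha; omega

theorem wordF_rowWord (hi : i < r) (p : ℕ) {w w' : List ℕ}
    (h : S.s (i + 2) p - S.s (i + 1) p < wordPhi i w) (hF : wordF i w = some w') :
    wordF i (S.rowWord (r + 1) p ++ w) = some (S.rowWord (r + 1) p ++ w') := by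
  obtain ⟨u, h1, h2, _⟩ := S.rowWord_split (i := i) p (r - i - 1)
  have hu : ∀ a ∈ u, a ≠ i ∧ a ≠ i + 1 := fun a ha ↦ by have := h1 a ha; omega
  have hv : ∀ a ∈ S.rowWord i p, a ≠ i ∧ a ≠ i + 1 := fun a ha ↦ by
    have := S.lt_of_mem_rowWord ha; omega
  rw [show r + 1 = i + 2 + (r - i - 1) by omega, h2]
  simp only [List.append_assoc]
  refine wordF_append_of_forall_ne hv ?_ (wordF_replicate_self _ ?_ (wordF_replicate_succ _ ?_
    (wordF_append_of_forall_ne hu (by omega) hF)))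
  · rw [wordPhi_replicate_self, wordPhi_replicate_succ, wordPhi_append_of_forall_ne hu]; omega
  · rw [wordPhi_replicate_succ, wordPhi_append_of_forall_ne hu]; omega
  · rwa [wordPhi_append_of_forall_ne hu]

theorem wordF_rowWord_hit (hi : i < r) (p : ℕ) {w : List ℕ} {S' : ShapeChain μ}
    (h : wordPhi i w ≤ S.s (i + 2) p - S.s (i + 1) p) (hlt : S.s i p < S.s (i + 1) p)
    (hS : ∀ k, k ≠ i + 1 → S'.s k p = S.s k p) (hS' : S'.s (i + 1) p + 1 = S.s (i + 1) p) :
    wordF i (S.rowWord (r + 1) p ++ w) = some (S'.rowWord (r + 1) p ++ w) := by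
  obtain ⟨u, h1, h2, h3⟩ := S.rowWord_split (i := i) p (r - i - 1)
  have hu : ∀ a ∈ u, a ≠ i ∧ a ≠ i + 1 := fun a ha ↦ by have := h1 a ha; omega
  have hv : ∀ a ∈ S.rowWord i p, a ≠ i ∧ a ≠ i + 1 := fun a ha ↦ by
    have := S.lt_of_mem_rowWord ha; omega
  have : S.s (i + 1) p ≤ S.s (i + 2) p := S.le (i + 1) p
  rw [show r + 1 = i + 2 + (r - i - 1) by omega, h2, h3 S' hS]
  simp only [List.append_assoc]
  have e1 : S.s (i + 1) p - S.s i p = (S'.s (i + 1) p - S.s i p) + 1 := by omega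
  have e2 : S.s (i + 2) p - S'.s (i + 1) p = (S.s (i + 2) p - S.s (i + 1) p) + 1 := by omega
  have h0 : wordPhi i (List.replicate (S.s (i + 2) p - S.s (i + 1) p) (i + 1) ++ (u ++ w)) = 0 := by
    rw [wordPhi_replicate_succ, wordPhi_append_of_forall_ne hu]; omega
  rw [e1, e2]
  refine wordF_append_of_forall_ne hv ?_ ?_
  · rw [wordPhi_replicate_self]; omega
  · rw [wordF_replicate_hit _ h0, List.replicate_succ, List.cons_append]

/-- If no box of level `i + 1` can be removed in rows above `q`, then all letters `i` in those rows
are cancelled, at the latest by the letters `i + 1` in row `q`. The step uses that level `i` and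
level `i + 1` differ by a horizontal strip. -/
theorem wordPhi_word_le (hi : i < r) {q : ℕ} (h : ∀ p < q, S.s (i + 1) p = S.s (i + 2) (p + 1)) :
    wordPhi i (S.word q) ≤ S.s (i + 2) q - S.s (i + 1) q := by
  induction q with
  | zero => simp [word, wordPhi]
  | succ q ih =>
    have := ih fun p hp ↦ h p (by omega)
    have h1 := h q (by omega)
    have h2 := S.strip i q
    rw [word_succ, S.wordPhi_rowWord hi]
    omega

theorem word_congr {S S' : ShapeChain μ} {q : ℕ} (h : ∀ p < q, ∀ k, S'.s k p = S.s k p) :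
    S'.word q = S.word q := by
  unfold word
  apply List.flatMap_congr
  intro p hp
  rw [List.mem_reverse, List.mem_range] at hp
  unfold rowWord
  simp only [h p hp]

/-- Let `q` be the first row with a removable box. The letters `i` above it are cancelled, so `f_i`
does not act there. By `h3` each lower row has too few letters `i + 1` to cancel what has
accumulated, so `f_i` passes it and acts at the end of the run of `i` in row `q`. -/
theorem wordF_word (hi : i < r) {q : ℕ} (hq : q ≤ r) {S' : ShapeChain μ}
    (h1 : ∀ p < q, S.s (i + 1) p = S.s (i + 2) (p + 1))
    (h2 : S.s (i + 2) (q + 1) < S.s (i + 1) q)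
    (h3 : ∀ p, q ≤ p → S.s i p = S.s (i + 1) (p + 1))
    (hS : ∀ k p, k ≠ i + 1 ∨ p ≠ q → S'.s k p = S.s k p)
    (hS' : S'.s (i + 1) q + 1 = S.s (i + 1) q) :
    wordF i (S.word (r + 1)) = some (S'.word (r + 1)) := by
  have key : ∀ d, wordF i (S.word (q + 1 + d)) = some (S'.word (q + 1 + d)) ∧
      S.s (i + 2) (q + 1 + d) - S.s (i + 1) (q + 1 + d) < wordPhi i (S.word (q + 1 + d)) := by
    intro d
    induction d with
    | zero =>
      have h4 := h3 q le_rfl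
      have h5 : S.s (i + 1) (q + 1) ≤ S.s (i + 2) (q + 1) := S.le (i + 1) (q + 1)
      have h6 : S.s (i + 2) (q + 1) ≤ S.s (i + 1) q := S.strip (i + 1) q
      rw [add_zero, word_succ, word_succ, word_congr fun p hp k ↦ hS k p (Or.inr hp.ne),
        S.wordPhi_rowWord hi]
      exact ⟨S.wordF_rowWord_hit hi q (S.wordPhi_word_le hi h1) (by omega)
        (fun k hk ↦ hS k q (Or.inl hk)) hS', by omega⟩
    | succ d ih =>
      have h4 := h3 (q + 1 + d) (by omega)
      have h5 : S.s (i + 1) (q + 1 + d + 1) ≤ S.s (i + 2) (q + 1 + d + 1) := S.le (i + 1) _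
      have h8 : S.s (i + 2) (q + 1 + d + 1) ≤ S.s (i + 1) (q + 1 + d) := S.strip (i + 1) _
      have h7 : S'.rowWord (r + 1) (q + 1 + d) = S.rowWord (r + 1) (q + 1 + d) := by
        unfold rowWord
        simp only [hS _ (q + 1 + d) (Or.inr (by omega))]
      rw [← add_assoc, word_succ, word_succ, S.wordPhi_rowWord hi, h7]
      exact ⟨S.wordF_rowWord hi _ ih.2 ih.1, by omega⟩
  have := (key (r - q)).1
  rwa [show q + 1 + (r - q) = r + 1 by omega] at this

theorem wordF_word_eq_none (hi : i < r) (h : ∀ p, S.s (i + 1) p = S.s (i + 2) (p + 1)) :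
    wordF i (S.word (r + 1)) = none := by
  apply wordF_eq_none
  have := S.wordPhi_word_le hi (q := r + 1) fun p _ ↦ h p
  rw [S.eq_zero (by omega : i + 2 ≤ r + 1)] at this
  omega

end ShapeChain

end

/-! ### Tableaux as chains of shapes. -/

section

variable {r : ℕ}

theorem lt_card_iff_mem {D : Finset ℕ} (hD : ∀ a b, a ≤ b → b ∈ D → a ∈ D) (c : ℕ) :
    c < D.card ↔ c ∈ D := by
  constructor
  · intro h
    by_contra hc
    have : D ⊆ Finset.range c := fun a ha ↦ by
      rw [Finset.mem_range]
      by_contra hac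
      exact hc (hD _ _ (not_lt.1 hac) ha)
    have := Finset.card_le_card this
    rw [Finset.card_range] at this
    omega
  · intro h
    have : Finset.range (c + 1) ⊆ D := fun a ha ↦ by
      rw [Finset.mem_range] at ha
      exact hD _ _ (by omega) h
    have := Finset.card_le_card this
    rw [Finset.card_range] at this
    omega

theorem eq_of_flatMap_reverse_range {F G : ℕ → List ℕ} {q : ℕ}
    (hlen : ∀ p, (F p).length = (G p).length)
    (h : (List.range q).reverse.flatMap F = (List.range q).reverse.flatMap G) :
    ∀ p < q, F p = G p := by
  induction q with
  | zero => intro p hp; omega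
  | succ q ih =>
    rw [List.range_succ, List.reverse_append, List.reverse_singleton, List.singleton_append,
      List.flatMap_cons, List.flatMap_cons] at h
    obtain ⟨h1, h2⟩ := List.append_inj h (hlen q)
    intro p hp
    rcases Nat.lt_succ_iff_lt_or_eq.1 hp with hp | rfl
    · exact ih h2 p hp
    · exact h1

namespace DominantEffectiveWeight

theorem rowLen_diagram (μ : DominantEffectiveWeight r) (p : Fin (r + 1)) :
    μ.diagram.rowLen p = (μ.val p).toNat := by
  have := YoungDiagram.rowLen_ofRowLens (w := List.ofFn fun j ↦ (μ.val j).toNat)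
    (hw := List.sortedGE_ofFn_iff.2 fun _ _ h ↦ Int.toNat_le_toNat (μ.dominant h))
    ⟨p, by simp; omega⟩
  rw [diagram, this, Fin.getElem_fin, List.getElem_ofFn]

theorem rowLen_diagram_of_lt (μ : DominantEffectiveWeight r) {p : ℕ} (hp : r < p) :
    μ.diagram.rowLen p = 0 := by
  by_contra h
  have h1 : (p, 0) ∈ μ.diagram := YoungDiagram.mem_iff_lt_rowLen.2 (Nat.pos_of_ne_zero h)
  rw [diagram, YoungDiagram.mem_ofRowLens] at h1
  obtain ⟨h2, _⟩ := h1
  simp at h2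
  omega

theorem val_nonneg (μ : DominantEffectiveWeight r) (p : Fin (r + 1)) : 0 ≤ μ.val p :=
  μ.effective.trans (μ.dominant (Fin.le_last p))

end DominantEffectiveWeight

theorem Crystal.readingWord_injective {μ : DominantEffectiveWeight r} :
    Function.Injective (Crystal.readingWord (μ := μ)) := by
  intro b b' h
  have key := eq_of_flatMap_reverse_range (fun p ↦ by simp) h
  refine Subtype.ext (SemistandardYoungTableau.ext fun p c ↦ ?_)
  by_cases hc : (p, c) ∈ μ.diagram
  · have hc' := YoungDiagram.mem_iff_lt_rowLen.1 hc
    have hp : p < r + 1 := by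
      by_contra hp
      rw [μ.rowLen_diagram_of_lt (by omega)] at hc'
      omega
    have := key p hp
    rw [List.map_inj_left] at this
    exact this c (List.mem_range.2 hc')
  · rw [b.1.zeros hc, b'.1.zeros hc]

namespace ShapeChain

variable {μ : DominantEffectiveWeight r} (S : ShapeChain μ)

theorem le_rowLen (k p : ℕ) : S.s k p ≤ μ.diagram.rowLen p := by
  rw [← S.top (max k (r + 1)) p (by omega)]
  exact S.mono p (by omega)

theorem anti_row (k p : ℕ) : S.s k (p + 1) ≤ S.s k p := (S.le k (p + 1)).trans (S.strip k p)

theorem antitone_row (k : ℕ) : Antitone (S.s k) := antitone_nat_of_succ_le (S.anti_row k)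

/-- The entries of the tableau whose entries smaller than `k` fill the shape `s k`. -/
def entry (p c : ℕ) : ℕ := sInf {k | c < S.s (k + 1) p}

theorem entry_lt_iff {p c : ℕ} (hc : c < μ.diagram.rowLen p) (k : ℕ) :
    S.entry p c < k ↔ c < S.s k p := by
  have hne : c < S.s (S.entry p c + 1) p :=
    Nat.sInf_mem (s := {k | c < S.s (k + 1) p}) ⟨r, by
      change c < S.s (r + 1) p
      rwa [S.top _ _ (by omega)]⟩
  constructor
  · intro h
    exact hne.trans_le (S.mono p h)
  · intro h
    cases k with
    | zero => rw [S.zero] at h; omega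
    | succ k => exact Nat.lt_succ_of_le (Nat.sInf_le h)

theorem entry_eq_zero {p c : ℕ} (hc : μ.diagram.rowLen p ≤ c) : S.entry p c = 0 := by
  have : {k | c < S.s (k + 1) p} = ∅ :=
    Set.eq_empty_of_forall_notMem fun k hk ↦
      absurd ((lt_of_le_of_lt hc hk).trans_le (S.le_rowLen _ _)) (lt_irrefl _)
  rw [entry, this, Nat.sInf_empty]

/-- The vertex of the crystal attached to a chain of shapes. -/
def toCrystal : Crystal μ where
  val :=
    { entry := S.entry
      row_weak' := by
        intro p c d hcd hd
        rw [YoungDiagram.mem_iff_lt_rowLen] at hd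
        have h := (S.entry_lt_iff hd _).1 (Nat.lt_succ_self _)
        exact Nat.lt_succ_iff.1 ((S.entry_lt_iff (hcd.trans hd) _).2 (hcd.trans h))
      col_strict' := by
        intro p q c hpq hq
        have hp := μ.diagram.up_left_mem hpq.le le_rfl hq
        rw [YoungDiagram.mem_iff_lt_rowLen] at hq hp
        have h := (S.entry_lt_iff hq _).1 (Nat.lt_succ_self _)
        exact (S.entry_lt_iff hp _).2
          (h.trans_le ((S.antitone_row _ (Nat.succ_le_of_lt hpq)).trans (S.strip _ p)))
      zeros' := by
        intro p c hc
        rw [YoungDiagram.mem_iff_lt_rowLen] at hc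
        exact S.entry_eq_zero (not_lt.1 hc) }
  property := by
    intro p c
    change S.entry p c ≤ r
    by_cases hc : c < μ.diagram.rowLen p
    · rw [← Nat.lt_succ_iff, S.entry_lt_iff hc, S.top _ _ (by omega)]
      exact hc
    · rw [S.entry_eq_zero (not_lt.1 hc)]
      omega

/-- The shape of level `k` is recovered as the set of cells with entry less than `k`. -/
theorem toCrystal_injective : Function.Injective (toCrystal (μ := μ)) := by
  intro S S' h
  have h' : ∀ p c, S.entry p c = S'.entry p c := fun p c ↦
    congrArg (fun T : Crystal μ ↦ T.1 p c) h
  ext k _ p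
  have h1 := S.le_rowLen k p
  have h2 := S'.le_rowLen k p
  have key : ∀ c < μ.diagram.rowLen p, (c < S.s k p ↔ c < S'.s k p) := fun c hc ↦ by
    rw [← S.entry_lt_iff hc, ← S'.entry_lt_iff hc, h']
  rcases lt_trichotomy (S.s k p) (S'.s k p) with hlt | heq | hlt
  · have := key (S.s k p) (by omega); omega
  · exact heq
  · have := key (S'.s k p) (by omega); omega

/-- The shapes filled by the entries smaller than `k`. -/
def ofCrystal (b : Crystal μ) : ShapeChain μ where
  s k p := ((Finset.range (μ.diagram.rowLen p)).filter fun c ↦ b.1 p c < k).card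
  zero p := by simp
  le k p := by
    apply Finset.card_le_card
    apply Finset.monotone_filter_right
    intro c _ hc
    omega
  strip k p := by
    apply Finset.card_le_card
    intro c hc
    rw [Finset.mem_filter, Finset.mem_range, ← YoungDiagram.mem_iff_lt_rowLen] at hc ⊢
    have := b.1.col_strict (Nat.lt_add_one p) hc.1
    exact ⟨μ.diagram.up_left_mem (Nat.le_succ p) le_rfl hc.1, by omega⟩
  top k p hk := by
    rw [Finset.filter_true_of_mem, Finset.card_range]
    intro c _
    exact (b.2 p c).trans_lt hk

theorem toCrystal_ofCrystal (b : Crystal μ) : (ofCrystal b).toCrystal = b := by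
  refine Subtype.ext (SemistandardYoungTableau.ext fun p c ↦ ?_)
  by_cases hc : (p, c) ∈ μ.diagram
  · have hc' := YoungDiagram.mem_iff_lt_rowLen.1 hc
    have key : ∀ k, (ofCrystal b).entry p c < k ↔ b.1 p c < k := by
      intro k
      rw [entry_lt_iff _ hc']
      rw [ofCrystal, lt_card_iff_mem, Finset.mem_filter, Finset.mem_range]
      · exact ⟨fun h ↦ h.2, fun h ↦ ⟨hc', h⟩⟩
      · intro a d had hd
        rw [Finset.mem_filter, Finset.mem_range] at hd ⊢
        refine ⟨had.trans_lt hd.1, lt_of_le_of_lt ?_ hd.2⟩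
        exact b.1.row_weak_of_le had (YoungDiagram.mem_iff_lt_rowLen.2 hd.1)
    have h1 := (key ((ofCrystal b).entry p c + 1)).1 (Nat.lt_succ_self _)
    have h2 := (key (b.1 p c + 1)).2 (Nat.lt_succ_self _)
    change (ofCrystal b).entry p c = b.1 p c
    omega
  · rw [b.1.zeros hc, SemistandardYoungTableau.zeros _ hc]

theorem toCrystal_bijective : Function.Bijective (toCrystal (μ := μ)) :=
  ⟨toCrystal_injective, fun b ↦ ⟨ofCrystal b, toCrystal_ofCrystal b⟩⟩

theorem map_entry (k p : ℕ) : (List.range (S.s k p)).map (S.entry p) = S.rowWord k p := by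
  induction k with
  | zero => rw [S.zero]; rfl
  | succ k ih =>
    have h1 := S.le k p
    have h2 := S.le_rowLen (k + 1) p
    rw [rowWord_succ, ← ih]
    conv_lhs => rw [← Nat.add_sub_of_le h1]
    rw [List.range_add, List.map_append, List.map_map]
    congr 1
    rw [List.eq_replicate_iff]
    refine ⟨by simp, fun a ha ↦ ?_⟩
    rw [List.mem_map] at ha
    obtain ⟨c, hc, rfl⟩ := ha
    rw [List.mem_range] at hc
    have h3 := S.entry_lt_iff (p := p) (c := S.s k p + c) (by omega)
    have h4 := (h3 (k + 1)).2 (by omega)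
    have h5 := mt (h3 k).1 (by omega)
    change S.entry p (S.s k p + c) = k
    omega

theorem readingWord_toCrystal : S.toCrystal.readingWord = S.word (r + 1) := by
  unfold Crystal.readingWord word
  apply List.flatMap_congr
  intro p _
  rw [← S.map_entry, S.top _ _ (by omega)]
  rfl

theorem count_rowWord {k K : ℕ} (p : ℕ) (h : k < K) :
    (S.rowWord K p).count k = S.s (k + 1) p - S.s k p := by
  have h0 : ∀ K, K ≤ k → (S.rowWord K p).count k = 0 := fun K hK ↦
    List.count_eq_zero.2 fun hk ↦ by have := S.lt_of_mem_rowWord hk; omega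
  induction K with
  | zero => omega
  | succ K ih =>
    rw [rowWord_succ, List.count_append, List.count_replicate]
    rcases Nat.lt_succ_iff_lt_or_eq.1 h with h | rfl
    · rw [ih h]
      simp [h.ne']
    · rw [h0 k le_rfl]
      simp

theorem count_word {k : ℕ} (hk : k ≤ r) (q : ℕ) :
    (S.word q).count k = ∑ p ∈ Finset.range q, (S.s (k + 1) p - S.s k p) := by
  induction q with
  | zero => rfl
  | succ q ih =>
    rw [word_succ, List.count_append, ih, S.count_rowWord q (by omega), Finset.sum_range_succ,
      add_comm]

theorem wt_toCrystal (k : Fin (r + 1)) :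
    S.toCrystal.wt k = ∑ p ∈ Finset.range (r + 1), ((S.s (k + 1) p : ℤ) - S.s k p) := by
  rw [Crystal.wt, readingWord_toCrystal, S.count_word (by omega), Nat.cast_sum]
  refine Finset.sum_congr rfl fun p _ ↦ ?_
  rw [Nat.cast_sub (S.le _ _)]

end ShapeChain

end

section

variable {r : ℕ}

/-! ### String lengths -/

namespace Crystal

variable {μ : DominantEffectiveWeight r}

theorem f_eq_some {i : Fin r} {b b' : Crystal μ}
    (h : wordF i b.readingWord = some b'.readingWord) : f i b = some b' := by
  have hex : ∃ b' : Crystal μ, wordF i (readingWord b) = some (readingWord b') := ⟨b', h⟩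
  rw [f, dif_pos hex]
  congr 1
  apply readingWord_injective
  exact (Option.some.inj (h.symm.trans hex.choose_spec)).symm

theorem f_eq_none {i : Fin r} {b : Crystal μ} (h : wordF i b.readingWord = none) :
    f i b = none := by
  rw [f, dif_neg]
  rintro ⟨b', h'⟩
  rw [h] at h'
  exact Option.some_ne_none _ h'.symm

theorem fPow_succ_eq_bind (i : Fin r) (k : ℕ) (b : Crystal μ) :
    fPow i (k + 1) b = (f i b).bind (fPow i k) := by
  induction k with
  | zero =>
    change f i b = (f i b).bind some
    rw [Option.bind_fun_some]
  | succ k ih =>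
    rw [fPow, ih, Option.bind_assoc]
    rfl

theorem fPow_eq_none_of_le {i : Fin r} {N k : ℕ} {b : Crystal μ} (h : fPow i N b = none)
    (hk : N ≤ k) : fPow i k b = none := by
  induction k, hk using Nat.le_induction with
  | base => exact h
  | succ k _ ih => rw [fPow, ih, Option.bind_none]

theorem phi_eq {i : Fin r} {N : ℕ} {b b' : Crystal μ} (h : fPow i N b = some b')
    (h' : fPow i (N + 1) b = none) : phi i b = N := by
  have : {k | fPow i k b ≠ none} = Set.Iic N := by
    ext k
    rw [Set.mem_Iic]
    constructor
    · intro hk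
      by_contra hN
      exact hk (fPow_eq_none_of_le h' (by omega))
    · intro hk hn
      rw [fPow_eq_none_of_le hn hk] at h
      exact Option.some_ne_none _ h.symm
  rw [phi, this, csSup_Iic]

theorem stringEnd_eq {i : Fin r} {N : ℕ} {b b' : Crystal μ} (h : fPow i N b = some b')
    (h' : fPow i (N + 1) b = none) : stringEnd i b = b' := by
  rw [stringEnd, phi_eq h h', h, Option.getD_some]

/-- The end of the path with a given sequence of edge labels. -/
def pathEnd (ω : List (Fin r)) (b : Crystal μ) : Crystal μ := ω.foldl (fun b i ↦ stringEnd i b) b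

theorem path_append (ω ω' : List (Fin r)) (b : Crystal μ) :
    path (ω ++ ω') b = path ω b ++ path ω' (pathEnd ω b) := by
  induction ω generalizing b with
  | nil => rfl
  | cons i ω ih => rw [List.cons_append, path, path, ih]; rfl

theorem pathEnd_append (ω ω' : List (Fin r)) (b : Crystal μ) :
    pathEnd (ω ++ ω') b = pathEnd ω' (pathEnd ω b) := List.foldl_append

end Crystal

namespace ShapeChain

variable {μ : DominantEffectiveWeight r}

/-- The total amount by which the shape of level `i + 1` can be lowered. -/
def excess (S : ShapeChain μ) (i : ℕ) : ℕ :=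
  ∑ p ∈ Finset.range (r + 1), (S.s (i + 1) p - S.s (i + 2) (p + 1))

/-- Removal of one box of the shape of level `i + 1` in row `q`. -/
def removeBox (S : ShapeChain μ) (i q : ℕ) (hi : i < r) (h1 : S.s i q < S.s (i + 1) q)
    (h2 : S.s (i + 2) (q + 1) < S.s (i + 1) q) : ShapeChain μ where
  s k p := if k = i + 1 ∧ p = q then S.s k p - 1 else S.s k p
  zero p := by rw [if_neg (by omega), S.zero]
  le k p := by
    have := S.le k p
    split_ifs with h h' h'
    · omega
    · omega
    · obtain ⟨h3, rfl⟩ := h'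
      obtain rfl : k = i := by omega
      omega
    · exact this
  strip k p := by
    have := S.strip k p
    split_ifs with h h' h'
    · omega
    · omega
    · obtain ⟨rfl, rfl⟩ := h'
      have h3 : S.s (i + 1 + 1) (p + 1) < S.s (i + 1) p := h2
      omega
    · exact this
  top k p hk := by rw [if_neg (by omega), S.top k p hk]

/-- Each `f_i` removes one box of level `i + 1` from the first row where this is possible, until
that shape is the shape of level `i + 2` without its first row. The hypothesis on level `i`
guarantees that level `i` never obstructs this, and it survives each removal. -/
theorem fPow_excess {i : ℕ} (hi : i < r) (N : ℕ) : ∀ (S S' : ShapeChain μ), S.excess i = N →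
    (∀ q, S.s (i + 2) (q + 1) < S.s (i + 1) q → ∀ p, q ≤ p → S.s i p = S.s (i + 1) (p + 1)) →
    (∀ k p, S'.s k p = if k = i + 1 then S.s (i + 2) (p + 1) else S.s k p) →
    Crystal.fPow ⟨i, hi⟩ N S.toCrystal = some S'.toCrystal ∧
      Crystal.fPow ⟨i, hi⟩ (N + 1) S.toCrystal = none := by
  have hst : ∀ (S : ShapeChain μ) p, S.s (i + 2) (p + 1) ≤ S.s (i + 1) p := fun S p ↦
    S.strip (i + 1) p
  induction N with
  | zero =>
    intro S S' hN _ hS'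
    have heq : ∀ p, S.s (i + 1) p = S.s (i + 2) (p + 1) := by
      intro p
      rcases Nat.lt_or_ge p (r + 1) with hp | hp
      · have h1 := (Finset.sum_eq_zero_iff.1 hN) p (Finset.mem_range.2 hp)
        have h2 := hst S p
        omega
      · rw [S.eq_zero (by omega), S.eq_zero (by omega)]
    have h0 : S' = S := by
      ext k _ p
      rw [hS']
      split_ifs with hk
      · rw [hk, heq]
      · rfl
    rw [h0, Crystal.fPow_succ_eq_bind, Crystal.f_eq_none]
    · exact ⟨rfl, rfl⟩
    · rw [readingWord_toCrystal]
      exact S.wordF_word_eq_none hi heq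
  | succ N ih =>
    intro S S' hN hS hS'
    have hex : ∃ q, S.s (i + 2) (q + 1) < S.s (i + 1) q := by
      by_contra! hcon
      rw [excess, Finset.sum_eq_zero] at hN
      · omega
      · intro p _
        have := hcon p
        omega
    classical
    -- The first row with a removable box is the one in which the signature rule acts.
    set q := Nat.find hex with hq
    have hq1 : S.s (i + 2) (q + 1) < S.s (i + 1) q := Nat.find_spec hex
    have hq2 : ∀ p < q, S.s (i + 1) p = S.s (i + 2) (p + 1) := fun p hp ↦ by
      have h1 := Nat.find_min hex hp
      have h2 := hst S p
      omega
    have hqr : q ≤ r := by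
      by_contra hqr
      rw [S.eq_zero (show i + 1 ≤ q by omega)] at hq1
      omega
    have hq3 : S.s i q < S.s (i + 1) q := by
      rw [hS q hq1 q le_rfl]
      exact lt_of_le_of_lt (S.le (i + 1) (q + 1)) hq1
    let R := S.removeBox i q hi hq3 hq1
    have hR : ∀ k p, R.s k p = if k = i + 1 ∧ p = q then S.s k p - 1 else S.s k p := fun k p ↦ rfl
    have hR2 : ∀ p, R.s (i + 2) p = S.s (i + 2) p := fun p ↦ by rw [hR, if_neg (by omega)]
    have hRq : R.s (i + 1) q = S.s (i + 1) q - 1 := by rw [hR, if_pos ⟨rfl, rfl⟩]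
    have hRne : ∀ p, p ≠ q → R.s (i + 1) p = S.s (i + 1) p := fun p hp ↦ by
      rw [hR, if_neg (by omega)]
    have hRN : R.excess i = N := by
      have hq' : q ∈ Finset.range (r + 1) := Finset.mem_range.2 (by omega)
      rw [excess, ← Finset.add_sum_erase _ _ hq'] at hN ⊢
      rw [hRq, hR2, Finset.sum_congr rfl (g := fun p ↦ S.s (i + 1) p - S.s (i + 2) (p + 1))]
      · omega
      · intro p hp
        rw [hR2, hRne p (Finset.ne_of_mem_erase hp)]
    have hstep : Crystal.f ⟨i, hi⟩ S.toCrystal = some R.toCrystal := by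
      apply Crystal.f_eq_some
      rw [readingWord_toCrystal, readingWord_toCrystal]
      refine S.wordF_word hi hqr hq2 hq1 (hS q hq1) ?_ (by rw [hRq]; omega)
      intro k p hkp
      rw [hR, if_neg (by tauto)]
    have := ih R S' hRN ?_ ?_
    · rw [Crystal.fPow_succ_eq_bind, Crystal.fPow_succ_eq_bind _ (N + 1), hstep]
      exact this
    · intro q' hq' p hp
      have hqq : q ≤ q' := by
        by_contra hlt
        rw [hR2, hRne q' (by omega), hq2 q' (by omega)] at hq'
        omega
      have h4 : S.s (i + 2) (q' + 1) < S.s (i + 1) q' := by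
        rw [hR2] at hq'
        by_cases h5 : q' = q
        · rw [h5]; exact hq1
        · rwa [hRne q' h5] at hq'
      rw [hRne (p + 1) (by omega), hR, if_neg (by omega)]
      exact hS q' h4 p hp
    · intro k p
      rw [hS', hR2]
      split_ifs with hk
      · rfl
      · rw [hR, if_neg (by tauto)]

/-- The tableaux met on the path along the long word, in the part `σ_{m+1} ⋯ σ₁` of this word,
before `σ_c`. -/
def along (S : ShapeChain μ) (m c : ℕ) (hm : m < r) (hc : c ≤ m + 1) : ShapeChain μ where
  -- Levels `k ≤ c` still are the last `k` rows of the shape of level `m + 1`; levels from `c + 1`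
  -- to `m + 2` already are the last `k` rows of the shape of level `m + 2`.
  s k p := if k ≤ c then S.s (m + 1) (p + (m + 1 - k))
    else if k ≤ m + 2 then S.s (m + 2) (p + (m + 2 - k)) else S.s k p
  zero p := by rw [if_pos (Nat.zero_le _), S.eq_zero (by omega)]
  le k p := by
    by_cases h1 : k + 1 ≤ c
    · rw [if_pos (by omega), if_pos h1]
      exact S.antitone_row _ (by omega)
    by_cases h2 : k ≤ c
    · obtain rfl : c = k := by omega
      rw [if_pos le_rfl, if_neg h1, if_pos (by omega), show m + 2 - (c + 1) = m + 1 - c by omega]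
      exact S.le _ _
    rw [if_neg h2, if_neg h1]
    by_cases h3 : k + 1 ≤ m + 2
    · rw [if_pos (by omega), if_pos h3]
      exact S.antitone_row _ (by omega)
    rw [if_neg h3]
    split_ifs with h4
    · obtain rfl : k = m + 2 := by omega
      rw [Nat.sub_self]
      exact S.le _ _
    · exact S.le _ _
  strip k p := by
    by_cases h1 : k + 1 ≤ c
    · rw [if_pos h1, if_pos (show k ≤ c by omega)]
      exact S.antitone_row _ (by omega)
    by_cases h2 : k ≤ c
    · obtain rfl : c = k := by omega
      rw [if_pos le_rfl, if_neg h1, if_pos (by omega),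
        show p + 1 + (m + 2 - (c + 1)) = p + (m + 1 - c) + 1 by omega]
      exact S.strip _ _
    rw [if_neg h2, if_neg h1]
    by_cases h3 : k + 1 ≤ m + 2
    · rw [if_pos h3, if_pos (show k ≤ m + 2 by omega)]
      exact S.antitone_row _ (by omega)
    rw [if_neg h3]
    split_ifs with h4
    · obtain rfl : k = m + 2 := by omega
      rw [Nat.sub_self]
      exact S.strip _ _
    · exact S.strip _ _
  top k p hk := by
    rw [if_neg (by omega)]
    split_ifs with h
    · obtain rfl : k = m + 2 := by omega
      rw [Nat.sub_self, add_zero, S.top _ _ hk]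
    · exact S.top _ _ hk

/-- The length of the segment of the path belonging to the letter `i` in the part
`σ_{m+1} ⋯ σ₁` of the long word. -/
def stringLength (S : ShapeChain μ) (m i : ℕ) : ℕ :=
  ∑ p ∈ Finset.range (r + 1), (S.s (m + 1) (p + (m - i)) - S.s (m + 2) (p + (m - i) + 1))

theorem string_along (S : ShapeChain μ) {m i : ℕ} (hm : m < r) (hi : i ≤ m) :
    Crystal.phi ⟨i, hi.trans_lt hm⟩ (S.along m (i + 1) hm (by omega)).toCrystal =
        S.stringLength m i ∧
      Crystal.stringEnd ⟨i, hi.trans_lt hm⟩ (S.along m (i + 1) hm (by omega)).toCrystal =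
        (S.along m i hm (by omega)).toCrystal := by
  set R := S.along m (i + 1) hm (by omega) with hR
  have hRs : ∀ k p, R.s k p = if k ≤ i + 1 then S.s (m + 1) (p + (m + 1 - k))
    else if k ≤ m + 2 then S.s (m + 2) (p + (m + 2 - k)) else S.s k p := fun k p ↦ rfl
  have hN : R.excess i = S.stringLength m i := by
    refine Finset.sum_congr rfl fun p _ ↦ ?_
    rw [hRs, hRs, if_pos le_rfl, if_neg (by omega), if_pos (by omega)]
    congr 2 <;> omega
  have := R.fPow_excess (hi.trans_lt hm) _ (S.along m i hm (by omega)) hN ?_ ?_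
  · exact ⟨Crystal.phi_eq this.1 this.2, Crystal.stringEnd_eq this.1 this.2⟩
  · intro _ _ p _
    rw [hRs, hRs, if_pos (by omega), if_pos le_rfl]
    congr 1
    omega
  · intro k p
    change (if k ≤ i then _ else _) = _
    rw [hRs, hRs, if_neg (show ¬ i + 2 ≤ i + 1 by omega), if_pos (show i + 2 ≤ m + 2 by omega)]
    by_cases h1 : k ≤ i
    · rw [if_pos h1, if_neg (by omega), if_pos (by omega)]
    rw [if_neg h1]
    by_cases h2 : k = i + 1
    · rw [if_pos h2, if_pos (by omega)]
      congr 1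
      omega
    · rw [if_neg h2, if_neg (show ¬ k ≤ i + 1 by omega)]

/-- Passing the letter `i` replaces just the shape of level `i + 1`, so the lengths depend only on
the original levels `m + 1` and `m + 2`. -/
theorem path_along (S : ShapeChain μ) {m c : ℕ} (hm : m < r) (hc : c ≤ m + 1) :
    ∀ ω : List (Fin r), ω.map Fin.val = (List.range c).reverse →
    Crystal.path ω (S.along m c hm hc).toCrystal = (List.range c).reverse.map (S.stringLength m) ∧
      Crystal.pathEnd ω (S.along m c hm hc).toCrystal =
        (S.along m 0 hm (Nat.zero_le _)).toCrystal := by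
  induction c with
  | zero =>
    intro ω hω
    obtain rfl : ω = [] := by simpa using hω
    exact ⟨rfl, rfl⟩
  | succ c ih =>
    intro ω hω
    rw [List.range_succ, List.reverse_append, List.reverse_singleton, List.singleton_append] at hω ⊢
    obtain ⟨i, ω, rfl, hi, hω'⟩ := List.map_eq_cons_iff.1 hω
    subst hi
    obtain ⟨h1, h2⟩ := S.string_along hm (i := i) (by omega)
    rw [Fin.eta] at h1 h2
    obtain ⟨h3, h4⟩ := ih (by omega) ω hω'
    rw [List.map_cons, Crystal.path, Crystal.pathEnd, List.foldl_cons, h1, h2, h3]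
    exact ⟨rfl, h4⟩

/-- The string lengths along the first `m` parts of the long word. -/
def stringLengths (S : ShapeChain μ) : ℕ → List ℕ
  | 0 => []
  | m + 1 => S.stringLengths m ++ (List.range (m + 1)).reverse.map (S.stringLength m)

/-- After `m` blocks every level `k ≤ m + 1` is the shape of level `m + 1` without its first `m + 1
- k` rows, the lowest weight configuration for the letters `0, …, m`; higher levels are untouched.
This is exactly the start of the next block. -/
theorem path_longWordNat (S : ShapeChain μ) {m : ℕ} (hm : m ≤ r) :
    ∀ ω : List (Fin r), ω.map Fin.val = longWordNat m →
    Crystal.path ω S.toCrystal = S.stringLengths m ∧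
      ∃ S' : ShapeChain μ, Crystal.pathEnd ω S.toCrystal = S'.toCrystal ∧
        ∀ k p, S'.s k p = if k ≤ m + 1 then S.s (m + 1) (p + (m + 1 - k)) else S.s k p := by
  induction m with
  | zero =>
    intro ω hω
    obtain rfl : ω = [] := by simpa [longWordNat] using hω
    refine ⟨rfl, S, rfl, fun k p ↦ ?_⟩
    split_ifs with h
    · interval_cases k
      · rw [S.zero, S.eq_zero (by omega)]
      · rfl
    · rfl
  | succ m ih =>
    intro ω hω
    rw [longWordNat, List.map_eq_append_iff] at hω
    obtain ⟨ω₁, ω₂, rfl, h1, h2⟩ := hω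
    rw [← List.range_eq_range'] at h2
    obtain ⟨h3, S', h4, h5⟩ := ih (by omega) ω₁ h1
    have hS' : S' = S.along m (m + 1) (by omega) le_rfl := by
      ext k _ p
      rw [h5]
      change _ = if k ≤ m + 1 then _ else _
      split_ifs with h6 h7
      · rfl
      · obtain rfl : k = m + 2 := by omega
        rw [Nat.sub_self, add_zero]
      · rfl
    rw [hS'] at h4
    obtain ⟨h6, h7⟩ := S.path_along (by omega) le_rfl ω₂ h2
    rw [Crystal.path_append, Crystal.pathEnd_append, h3, h4, h6, h7]
    refine ⟨rfl, _, rfl, fun k p ↦ ?_⟩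
    change (if k ≤ 0 then _ else _) = _
    split_ifs with h8 h9 h9
    · rw [S.eq_zero (by omega), S.eq_zero (by omega)]
    · omega
    · rfl
    · rfl

theorem bzl_toCrystal (S : ShapeChain μ) : S.toCrystal.bzl = S.stringLengths r :=
  (S.path_longWordNat le_rfl _ (map_val_longWord r)).1

theorem length_stringLengths (S : ShapeChain μ) (m : ℕ) :
    (S.stringLengths m).length = (m + 1).choose 2 := by
  induction m with
  | zero => rfl
  | succ m ih =>
    rw [stringLengths, List.length_append, ih, List.length_map, List.length_reverse,
      List.length_range, Nat.choose_succ_succ' (m + 1) 1, Nat.choose_one_right, add_comm]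

theorem getD_stringLengths (S : ShapeChain μ) {m M i : ℕ} (hm : m < M) (hi : i ≤ m) :
    (S.stringLengths M).getD ((m + 1).choose 2 + i) 0 = S.stringLength m (m - i) := by
  induction M, hm using Nat.le_induction with
  | base =>
    rw [stringLengths, List.getD_append_right _ _ _ _ (by rw [length_stringLengths]; omega),
      length_stringLengths, Nat.add_sub_cancel_left, List.getD_eq_getElem _ _ (by simp; omega),
      List.getElem_map, List.getElem_reverse, List.getElem_range, List.length_range]
    congr 1
  | succ M hM ih =>
    rw [stringLengths, List.getD_append, ih]
    rw [length_stringLengths]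
    have h1 : (m + 2).choose 2 ≤ (M + 1).choose 2 := Nat.choose_le_choose 2 (by omega)
    have h2 : (m + 2).choose 2 = (m + 1) + (m + 1).choose 2 := by
      rw [Nat.choose_succ_succ' (m + 1) 1, Nat.choose_one_right]
    omega

/-- Block `m` lists the letters `m, …, 0`, so omitting its first `m + 1 - c` entries leaves the
letters below `c`, followed by all later blocks. -/
theorem forall_mem_drop_stringLengths (S : ShapeChain μ) {m M c : ℕ} (hm : m < M)
    (hc : c ≤ m + 1) :
    (∀ a ∈ (S.stringLengths M).drop ((m + 1).choose 2 + (m + 1 - c)), a = 0) ↔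
      (∀ i < c, S.stringLength m i = 0) ∧
        ∀ m', m < m' → m' < M → ∀ i ≤ m', S.stringLength m' i = 0 := by
  induction M, hm using Nat.le_induction with
  | base =>
    rw [stringLengths, ← S.length_stringLengths m, List.drop_append, List.drop_eq_nil_of_le (by omega),
      Nat.add_sub_cancel_left, List.nil_append, ← List.map_drop, List.drop_reverse,
      List.length_range, List.take_range]
    have : min (m + 1 - (m + 1 - c)) (m + 1) = c := by omega
    rw [this]
    simp only [List.mem_map, List.mem_reverse, List.mem_range, forall_exists_index, and_imp,
      forall_apply_eq_imp_iff₂]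
    constructor
    · exact fun h ↦ ⟨h, fun m' h1 h2 ↦ by omega⟩
    · exact fun h ↦ h.1
  | succ M hM ih =>
    rw [stringLengths, List.drop_append_of_le_length]
    · simp only [List.mem_append, or_imp, forall_and, ih, List.mem_map, List.mem_reverse,
        List.mem_range, forall_exists_index, and_imp, forall_apply_eq_imp_iff₂]
      constructor
      · rintro ⟨⟨h1, h2⟩, h3⟩
        refine ⟨h1, fun m' h4 h5 i hi ↦ ?_⟩
        rcases Nat.lt_succ_iff_lt_or_eq.1 h5 with h5 | rfl
        · exact h2 m' h4 h5 i hi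
        · exact h3 i (by omega)
      · rintro ⟨h1, h2⟩
        exact ⟨⟨h1, fun m' h4 h5 ↦ h2 m' h4 (by omega)⟩, fun i hi ↦ h2 M (by omega) (by omega) i (by omega)⟩
    · rw [length_stringLengths]
      have h1 : (m + 2).choose 2 ≤ (M + 1).choose 2 := Nat.choose_le_choose 2 (by omega)
      have h2 : (m + 2).choose 2 = (m + 1) + (m + 1).choose 2 := by
        rw [Nat.choose_succ_succ' (m + 1) 1, Nat.choose_one_right]
      omega

end ShapeChain

end

section

variable {r : ℕ}

/-! ### Gelfand–Tsetlin patterns and tableaux -/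

theorem DominantEffectiveWeight.rowLen_diagram_anti (μ : DominantEffectiveWeight r) (p : ℕ) :
    μ.diagram.rowLen (p + 1) ≤ μ.diagram.rowLen p :=
  μ.diagram.rowLen_anti p (p + 1) (Nat.le_succ p)

namespace GTPattern

variable {μ : DominantEffectiveWeight r}

theorem a_zero (t : GTPattern μ) (j : ℕ) : t.a 0 j = μ.diagram.rowLen j := by
  rcases Nat.lt_or_ge j (r + 1) with hj | hj
  · have h1 := t.top ⟨j, hj⟩
    have h2 := μ.rowLen_diagram ⟨j, hj⟩
    simp only at h1 h2
    omega
  · rw [t.zeros _ _ (Or.inr hj), μ.rowLen_diagram_of_lt hj]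

theorem a_succ_le (t : GTPattern μ) (i p : ℕ) : t.a (i + 1) (p + 1) ≤ t.a i p := by
  by_cases h : i ≤ p ∧ p + 1 ≤ r
  · exact (t.interleave (i + 1) (p + 1) (by omega) (by omega) h.2).1
  · rw [t.zeros _ _ (by omega)]
    exact Nat.zero_le _

theorem a_le_succ (t : GTPattern μ) {i p : ℕ} (hp : i < p) : t.a i p ≤ t.a (i + 1) p := by
  by_cases h : p ≤ r
  · exact (t.interleave (i + 1) p (by omega) (by omega) h).2
  · rw [t.zeros _ _ (by omega)]
    exact Nat.zero_le _

/-- The chain of shapes formed by the rows of a pattern. -/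
def toChain (t : GTPattern μ) : ShapeChain μ where
  s k p := t.a (r + 1 - k) (r + 1 - k + p)
  zero p := t.zeros _ _ (by omega)
  le k p := by
    rcases Nat.lt_or_ge r k with hk | hk
    · rw [show r + 1 - k = r + 1 - (k + 1) by omega]
    · rw [show r + 1 - k = r + 1 - (k + 1) + 1 by omega, Nat.add_right_comm]
      exact t.a_succ_le _ _
  strip k p := by
    rcases Nat.lt_or_ge r k with hk | hk
    · rw [show r + 1 - k = 0 by omega, show r + 1 - (k + 1) = 0 by omega, zero_add, zero_add,
        t.a_zero, t.a_zero]
      exact μ.rowLen_diagram_anti p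
    · rw [show r + 1 - k = r + 1 - (k + 1) + 1 by omega, Nat.add_right_comm, ← add_assoc]
      exact t.a_le_succ (by omega)
  top k p hk := by
    rw [show r + 1 - k = 0 by omega, zero_add, t.a_zero]

/-- The pattern whose rows are the members of a chain of shapes. -/
def ofChain (S : ShapeChain μ) : GTPattern μ where
  a i j := if i ≤ j then S.s (r + 1 - i) (j - i) else 0
  top j := by
    rw [if_pos (Nat.zero_le _), S.top _ _ (by omega), Nat.sub_zero, μ.rowLen_diagram,
      Int.toNat_of_nonneg (μ.val_nonneg j)]
  interleave i j hi hij hj := by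
    obtain ⟨i, rfl⟩ : ∃ k, i = k + 1 := ⟨i - 1, by omega⟩
    rw [if_pos hij, if_pos (by omega), if_pos (by omega)]
    have h1 := S.le (r + 1 - (i + 1)) (j - (i + 1))
    have h2 := S.strip (r + 1 - (i + 1)) (j - (i + 1))
    rw [show r + 1 - (i + 1) + 1 = r + 1 - i by omega] at h1 h2
    rw [show j - (i + 1) + 1 = j - i by omega] at h2
    rw [Nat.add_sub_cancel, show j - 1 - i = j - (i + 1) by omega]
    exact ⟨h1, h2⟩
  zeros i j h := by
    split_ifs with hij
    · exact S.eq_zero (by omega)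
    · rfl

@[ext] theorem ext {t t' : GTPattern μ} (h : ∀ i j, i ≤ j → j ≤ r → t.a i j = t'.a i j) :
    t = t' := by
  cases t with
  | mk a h1 h2 h3 =>
    cases t' with
    | mk a' h1' h2' h3' =>
      have : a = a' := by
        funext i j
        by_cases hij : i ≤ j ∧ j ≤ r
        · exact h i j hij.1 hij.2
        · rw [h3 i j (by omega), h3' i j (by omega)]
      subst this
      rfl

theorem toChain_bijective : Function.Bijective (toChain (μ := μ)) := by
  constructor
  · intro t t' h
    ext i j hij hj
    have h1 := congrArg (fun S : ShapeChain μ ↦ S.s (r + 1 - i) (j - i)) h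
    simp only [toChain] at h1
    rwa [show r + 1 - (r + 1 - i) = i by omega, Nat.add_sub_of_le hij] at h1
  · intro S
    refine ⟨ofChain S, ShapeChain.ext fun k hk p ↦ ?_⟩
    change (if r + 1 - k ≤ r + 1 - k + p then _ else _) = _
    rw [if_pos (by omega)]
    congr 1 <;> omega

/-- The vertex of the crystal corresponding to a pattern. -/
def toCrystal (t : GTPattern μ) : Crystal μ := t.toChain.toCrystal

theorem toCrystal_bijective : Function.Bijective (toCrystal (μ := μ)) :=
  ShapeChain.toCrystal_bijective.comp toChain_bijective

instance : Fintype (GTPattern μ) :=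
  Fintype.ofEquiv (Crystal μ) (Equiv.ofBijective _ toCrystal_bijective).symm

/-- Row `r - m` of the pattern is the shape of level `m + 1` and the row above it that of level `m +
2`, with columns shifted by one against each other. Hence the differences of entries are those in
the string length. -/
theorem gam_eq_stringLength (t : GTPattern μ) {m q : ℕ} (hm : m < r) (hq : q ≤ m) :
    t.Gam (r - m) (r - q) = t.toChain.stringLength m q := by
  have key : ∀ p, (t.toChain.s (m + 1) (p + (m - q)) : ℤ) - t.toChain.s (m + 2) (p + (m - q) + 1) =
      (t.a (r - m) (r - q + p) : ℤ) - t.a (r - m - 1) (r - q + p) := by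
    intro p
    simp only [toChain]
    rw [show r + 1 - (m + 1) + (p + (m - q)) = r - q + p by omega,
      show r + 1 - (m + 2) + (p + (m - q) + 1) = r - q + p by omega,
      show r + 1 - (m + 1) = r - m by omega, show r + 1 - (m + 2) = r - m - 1 by omega]
  have h1 : (t.toChain.stringLength m q : ℤ) =
      ∑ p ∈ Finset.range (r + 1), ((t.a (r - m) (r - q + p) : ℤ) - t.a (r - m - 1) (r - q + p)) := by
    rw [ShapeChain.stringLength, Nat.cast_sum]
    refine Finset.sum_congr rfl fun p _ ↦ ?_
    rw [Nat.cast_sub (t.toChain.strip (m + 1) _)]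
    exact key p
  rw [h1, Gam, ← Finset.Ico_add_one_right_eq_Icc, Finset.sum_Ico_eq_sum_range,
    show r + 1 - (r - q) = q + 1 by omega]
  refine Finset.sum_subset (by intro p; simp only [Finset.mem_range]; omega) fun p _ hp ↦ ?_
  rw [Finset.mem_range] at hp
  rw [t.zeros _ _ (Or.inr (by omega)), t.zeros _ _ (Or.inr (by omega)), sub_self]

theorem corresponds_toCrystal (t : GTPattern μ) : t.Corresponds t.toCrystal := by
  intro i j hi hij hj
  have h := t.gam_eq_stringLength (m := r - i) (q := r - j) (by omega) (by omega)
  rw [show r - (r - i) = i by omega, show r - (r - j) = j by omega] at h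
  rw [h, Crystal.bzlEntry, toCrystal, ShapeChain.bzl_toCrystal, show r + 1 - i = r - i + 1 by omega,
    ShapeChain.getD_stringLengths _ (by omega) (by omega),
    show r - i - (j - i) = r - j by omega]

theorem gam_eq_add (t : GTPattern μ) (i : ℕ) {j : ℕ} (hj : j ≤ r) :
    t.Gam i j = ((t.a i j : ℤ) - t.a (i - 1) j) + t.Gam i (j + 1) := by
  rw [Gam, ← Finset.add_sum_Ioc_eq_sum_Icc hj, Gam, Finset.Icc_add_one_left_eq_Ioc]

/-- The top row is fixed, and successive differences of the `Γ`-entries determine each row from the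
one above it. -/
theorem eq_of_corresponds {t t' : GTPattern μ} {b : Crystal μ} (h : t.Corresponds b)
    (h' : t'.Corresponds b) : t = t' := by
  have hG : ∀ i j, 1 ≤ i → i ≤ j → t.Gam i j = t'.Gam i j := by
    intro i j hi hij
    rcases Nat.lt_or_ge r j with hj | hj
    · rw [Gam, Gam, Finset.Icc_eq_empty (by omega), Finset.sum_empty, Finset.sum_empty]
    · rw [h i j hi hij hj, h' i j hi hij hj]
  refine ext fun i ↦ ?_
  induction i with
  | zero => intro j _ _; rw [t.a_zero, t'.a_zero]
  | succ i ih =>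
    intro j hij hj
    have h1 := hG (i + 1) j (by omega) hij
    have h2 := hG (i + 1) (j + 1) (by omega) (by omega)
    rw [t.gam_eq_add _ hj, t'.gam_eq_add _ hj, h2, Nat.add_sub_cancel, ih j (by omega) hj] at h1
    omega

theorem gtCoeff_toCrystal {n : ℕ} (P : Parameters n) (t : GTPattern μ) :
    gtCoeff P t.toCrystal = t.coeff P := by
  have h : ∃ t' : GTPattern μ, t'.Corresponds t.toCrystal := ⟨t, t.corresponds_toCrystal⟩
  rw [gtCoeff, dif_pos h, eq_of_corresponds h.choose_spec t.corresponds_toCrystal]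

theorem toCrystal_mem_demazureCrystal (t : GTPattern μ) {m c : ℕ} (hm : m < r) (hc : c ≤ m + 1) :
    t.toCrystal ∈ demazureCrystal μ (topEl m * cycleEl m c) ↔
      (∀ q < c, t.Gam (r - m) (r - q) = 0) ∧
        ∀ m', m < m' → m' < r → ∀ q ≤ m', t.Gam (r - m') (r - q) = 0 := by
  classical
  rw [demazureCrystal, Finset.mem_filter, toCrystal, ShapeChain.bzl_toCrystal,
    len_topEl_mul hm hc, ShapeChain.forall_mem_drop_stringLengths _ hm hc]
  simp only [Finset.mem_univ, true_and]
  refine and_congr ?_ ?_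
  · refine forall₂_congr fun q hq ↦ ?_
    rw [t.gam_eq_stringLength hm (by omega), Nat.cast_eq_zero]
  · refine forall₃_congr fun m' _ hm' ↦ forall₂_congr fun q hq ↦ ?_
    rw [t.gam_eq_stringLength hm' hq, Nat.cast_eq_zero]

end GTPattern

end

/-! ### Matching nested sums with partial Gelfand–Tsetlin patterns. -/

section

variable {r n : ℕ}

/-! ### Sums over Gelfand–Tsetlin patterns -/

/-- The recursion changes the weight as it proceeds, but on entering column `j` the only trace of
earlier steps in the relevant coordinates is that coordinate `j` has been lowered by the last
exponent `l`. The exponents thus are partial sums of `ν' - ν`, and the bound in the next column is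
`l` plus the original gap. -/
theorem rowCoeff_eq_prod (P : Parameters n) {ν ν' : ℕ → ℤ} (f : ℕ) :
    ∀ (j : ℕ) (l : ℤ) (κ : ℕ → ℤ), κ j = ν j - l → (∀ i, j < i → κ i = ν i) →
    rowCoeff P f j l κ ν' = ∏ q ∈ Finset.range f,
      gtFactor P (l + ∑ i ∈ Finset.range q, (ν' (j + i) - ν (j + i)))
        (l + ∑ i ∈ Finset.range (q + 1), (ν' (j + i) - ν (j + i)))
        (l + ∑ i ∈ Finset.range q, (ν' (j + i) - ν (j + i)) + gap ν (j + q)) := by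
  induction f with
  | zero => intros; rfl
  | succ f ih =>
    intro j l κ h1 h2
    have e1 : gap κ j = l + gap ν j := by rw [gap, gap, h1, h2 _ (Nat.lt_succ_self j)]; ring
    rw [rowCoeff, ih (j + 1) (ν' j - κ j) _ ?_ ?_, Finset.prod_range_succ', mul_comm]
    · congr 1
      · refine Finset.prod_congr rfl fun q _ ↦ ?_
        have e2 : ∀ q, ν' j - κ j + ∑ i ∈ Finset.range q, (ν' (j + 1 + i) - ν (j + 1 + i)) =
            l + ∑ i ∈ Finset.range (q + 1), (ν' (j + i) - ν (j + i)) := by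
          intro q
          rw [Finset.sum_range_succ', h1, add_zero]
          have : ∀ i, j + 1 + i = j + (i + 1) := fun i ↦ by omega
          simp only [this]
          ring
        rw [e2, e2, show j + 1 + q = j + (q + 1) by omega]
      · rw [e1, h1]
        simp only [Finset.range_zero, Finset.sum_empty, zero_add, Finset.sum_range_one, add_zero]
        congr 1
        ring
    · rw [add_smul_natRoot_succ, h2 _ (Nat.lt_succ_self j)]
    · intro i hi
      rw [add_smul_natRoot_of_ne _ _ (by omega) (by omega), h2 i (by omega)]

namespace GTPattern

variable {μ : DominantEffectiveWeight r}

/-- The weight, shifted by `w₀ρ`, reached after the rows `0, …, r - m` of a pattern. -/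
def levelWeight (t : GTPattern μ) (m j : ℕ) : ℤ :=
  if j ≤ m then t.a (r - m) (r - j) - j
  else if j ≤ r then ∑ q ∈ Finset.range (j + 1), (t.a (r - j) (r - q) : ℤ) -
    ∑ q ∈ Finset.range j, (t.a (r - j + 1) (r - q) : ℤ) - j
  else 0

theorem levelWeight_of_le (t : GTPattern μ) {m j : ℕ} (h : j ≤ m) :
    t.levelWeight m j = t.a (r - m) (r - j) - j := if_pos h

theorem levelWeight_of_lt (t : GTPattern μ) {m j : ℕ} (h : m < j) (hj : j ≤ r) :
    t.levelWeight m j = ∑ q ∈ Finset.range (j + 1), (t.a (r - j) (r - q) : ℤ) -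
      ∑ q ∈ Finset.range j, (t.a (r - j + 1) (r - q) : ℤ) - j := by
  rw [levelWeight, if_neg (by omega), if_pos hj]

theorem levelWeight_of_lt' (t : GTPattern μ) {m j : ℕ} (h : m < j) (hj : r < j) :
    t.levelWeight m j = 0 := by
  rw [levelWeight, if_neg (by omega), if_neg (by omega)]

/-- The shift by `w₀ρ` cancels in the difference of the two levels, so the partial sums that are the
exponents of the nested sum are the entries of the `Γ`-array. -/
theorem gam_eq_sum (t : GTPattern μ) {m : ℕ} (hm : m < r) {q : ℕ} (hq : q ≤ m + 1) :
    t.Gam (r - m) (r + 1 - q) =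
      ∑ i ∈ Finset.range q, (t.levelWeight m i - t.levelWeight (m + 1) i) := by
  induction q with
  | zero => rw [Gam, Finset.Icc_eq_empty (by omega)]; rfl
  | succ q ih =>
    rw [t.gam_eq_add _ (by omega), Finset.sum_range_succ, ← ih (by omega),
      t.levelWeight_of_le (by omega), t.levelWeight_of_le (by omega),
      show r + 1 - (q + 1) + 1 = r + 1 - q by omega, show r + 1 - (q + 1) = r - q by omega,
      show r - (m + 1) = r - m - 1 by omega]
    ring

theorem gap_levelWeight (t : GTPattern μ) {m q : ℕ} (hq : q < m) :
    gap (t.levelWeight m) q = (t.a (r - m) (r - q - 1) : ℤ) - t.a (r - m) (r - q) := by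
  rw [gap, t.levelWeight_of_le (by omega), t.levelWeight_of_le (by omega), Nat.sub_sub]
  push_cast
  ring

/-- The contribution of row `r - m` to the coefficient of a pattern. -/
def rowFactor (P : Parameters n) (t : GTPattern μ) (m : ℕ) : ℂ :=
  ∏ q ∈ Finset.range (m + 1), t.factor P (r - m) (r - q)

theorem coeff_eq_prod (P : Parameters n) (t : GTPattern μ) :
    t.coeff P = ∏ m ∈ Finset.range r, t.rowFactor P m := by
  refine Finset.prod_nbij' (fun i ↦ r - i) (fun m ↦ r - m) ?_ ?_ ?_ ?_ ?_
  · intro i; simp only [Finset.mem_Icc, Finset.mem_range]; omega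
  · intro i; simp only [Finset.mem_Icc, Finset.mem_range]; omega
  · intro i; simp only [Finset.mem_Icc]; omega
  · intro i; simp only [Finset.mem_range]; omega
  · intro i hi
    rw [Finset.mem_Icc] at hi
    rw [rowFactor, show r - (r - i) = i by omega]
    refine Finset.prod_nbij' (fun j ↦ r - j) (fun q ↦ r - q) ?_ ?_ ?_ ?_ ?_
    · intro j; simp only [Finset.mem_Icc, Finset.mem_range]; omega
    · intro j; simp only [Finset.mem_Icc, Finset.mem_range]; omega
    · intro j; simp only [Finset.mem_Icc]; omega
    · intro j; simp only [Finset.mem_range]; omega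
    · intro j hj
      rw [Finset.mem_Icc] at hj
      rw [show r - (r - j) = j by omega]

theorem factor_eq_gtFactor (P : Parameters n) (t : GTPattern μ) {m q : ℕ} (hm : m < r)
    (hq : q ≤ m) :
    t.factor P (r - m) (r - q) = gtFactor P (t.Gam (r - m) (r + 1 - q)) (t.Gam (r - m) (r - q))
      (t.Gam (r - m) (r + 1 - q) + gap (t.levelWeight (m + 1)) q) := by
  rw [factor, gtFactor, t.gap_levelWeight (by omega), show r - q + 1 = r + 1 - q by omega,
    show r - (m + 1) = r - m - 1 by omega, add_sub_assoc]

/-- The first `c` factors have `Γ = 0`, hence are circled; positive gaps prevent them from being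
boxed, so they equal `1`. The others agree with those of the nested sum started in column `c`. -/
theorem rowFactor_eq_rowCoeff (P : Parameters n) (t : GTPattern μ) {m c : ℕ} (hm : m < r)
    (hc : c ≤ m + 1) (hgap : ∀ q < c, 1 ≤ gap (t.levelWeight (m + 1)) q)
    (h : ∀ q < c, t.Gam (r - m) (r - q) = 0) :
    t.rowFactor P m = rowCoeff P (m + 1 - c) c 0 (t.levelWeight (m + 1)) (t.levelWeight m) := by
  have h' : ∀ q ≤ c, t.Gam (r - m) (r + 1 - q) = 0 := by
    intro q hq
    cases q with
    | zero => rw [Gam, Finset.Icc_eq_empty (by omega), Finset.sum_empty]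
    | succ q => rw [Nat.add_sub_add_right]; exact h q hq
  rw [rowCoeff_eq_prod P (ν := t.levelWeight (m + 1)) _ _ _ _ (sub_zero _).symm fun _ _ ↦ rfl,
    rowFactor]
  conv_lhs => rw [show m + 1 = c + (m + 1 - c) by omega, Finset.prod_range_add]
  rw [Finset.prod_eq_one, one_mul]
  · refine Finset.prod_congr rfl fun q hq ↦ ?_
    rw [Finset.mem_range] at hq
    have key : ∀ q ≤ m + 1 - c, 0 + ∑ i ∈ Finset.range q,
        (t.levelWeight m (c + i) - t.levelWeight (m + 1) (c + i)) =
          t.Gam (r - m) (r + 1 - (c + q)) := by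
      intro q hq
      rw [t.gam_eq_sum hm (by omega), Finset.sum_range_add, ← t.gam_eq_sum hm hc, h' c le_rfl]
    rw [key q (by omega), key (q + 1) (by omega), t.factor_eq_gtFactor P hm (by omega)]
    congr 1
    congr 1
    omega
  · intro q hq
    rw [Finset.mem_range] at hq
    have := hgap q hq
    rw [t.factor_eq_gtFactor P hm (by omega), h q hq, h' q hq.le, zero_add, gtFactor, if_pos rfl,
      if_neg (by omega)]

/-- Interlacing and conservation of the sum hold for every pattern, so the only condition is that
the first `c` coordinates do not change. This amounts to the vanishing of the corresponding partial
sums `Γ`. -/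
theorem levelWeight_mem_rows (t : GTPattern μ) {m c : ℕ} (hm : m < r) (hc : c ≤ m + 1) :
    t.levelWeight m ∈ rows (m + 1 - c) c 0 (t.levelWeight (m + 1)) ↔
      ∀ q < c, t.Gam (r - m) (r - q) = 0 := by
  have hsum : ∑ i ∈ Finset.range (m + 2), t.levelWeight m i =
      ∑ i ∈ Finset.range (m + 2), t.levelWeight (m + 1) i := by
    rw [Finset.sum_range_succ, t.levelWeight_of_lt (Nat.lt_succ_self m) hm]
    have e1 : ∑ i ∈ Finset.range (m + 1), t.levelWeight m i =
        ∑ i ∈ Finset.range (m + 1), ((t.a (r - m) (r - i) : ℤ) - i) :=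
      Finset.sum_congr rfl fun i hi ↦ t.levelWeight_of_le (by rw [Finset.mem_range] at hi; omega)
    have e2 : ∑ i ∈ Finset.range (m + 2), t.levelWeight (m + 1) i =
        ∑ i ∈ Finset.range (m + 2), ((t.a (r - (m + 1)) (r - i) : ℤ) - i) :=
      Finset.sum_congr rfl fun i hi ↦ t.levelWeight_of_le (by rw [Finset.mem_range] at hi; omega)
    rw [e1, e2, Finset.sum_sub_distrib, Finset.sum_sub_distrib,
      Finset.sum_range_succ (fun i : ℕ ↦ (i : ℤ)) (m + 1), show r - (m + 1) + 1 = r - m by omega]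
    ring
  have hint : ∀ i ≤ m, t.levelWeight (m + 1) i ≤ t.levelWeight m i ∧
      t.levelWeight m i ≤ t.levelWeight (m + 1) (i + 1) + 1 := by
    intro i hi
    rw [t.levelWeight_of_le (by omega), t.levelWeight_of_le hi, t.levelWeight_of_le (by omega)]
    have h1 := t.a_le_succ (i := r - (m + 1)) (p := r - i) (by omega)
    have h2 := t.a_succ_le (r - (m + 1)) (r - (i + 1))
    rw [show r - (m + 1) + 1 = r - m by omega] at h1 h2
    rw [show r - (i + 1) + 1 = r - i by omega] at h2
    omega
  have hsplit : ∀ ν : ℕ → ℤ, ∑ i ∈ Finset.range (m + 2), ν i =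
      ∑ i ∈ Finset.range c, ν i + ∑ i ∈ Finset.range (m + 1 - c + 1), ν (c + i) := fun ν ↦ by
    rw [show m + 2 = c + (m + 1 - c + 1) by omega, Finset.sum_range_add]
  rw [hsplit, hsplit] at hsum
  rw [mem_rows]
  constructor
  · rintro ⟨h, _⟩ q hq
    have h1 := t.gam_eq_sum hm (q := q + 1) (by omega)
    rw [Nat.add_sub_add_right] at h1
    rw [h1]
    refine Finset.sum_eq_zero fun i hi ↦ ?_
    rw [Finset.mem_range] at hi
    rw [h i (by omega), sub_self]
  · intro h
    have heq : ∀ i < c, t.levelWeight m i = t.levelWeight (m + 1) i := by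
      intro i hi
      have h1 := h i hi
      have h2 := t.gam_eq_sum hm (q := i + 1) (by omega)
      rw [Finset.sum_range_succ, ← t.gam_eq_sum hm (by omega), Nat.add_sub_add_right, h1] at h2
      have h3 : t.Gam (r - m) (r + 1 - i) = 0 := by
        cases i with
        | zero => rw [Gam, Finset.Icc_eq_empty (by omega), Finset.sum_empty]
        | succ i => rw [Nat.add_sub_add_right]; exact h i (by omega)
      rw [h3] at h2
      omega
    refine ⟨?_, ?_, ?_, ?_⟩
    · rintro i (hi | hi)
      · exact heq i hi
      · rcases Nat.lt_or_ge r i with hir | hir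
        · rw [t.levelWeight_of_lt' (by omega) hir, t.levelWeight_of_lt' (by omega) hir]
        · rw [t.levelWeight_of_lt (by omega) hir, t.levelWeight_of_lt (by omega) hir]
    · rw [Finset.sum_congr rfl fun i hi ↦ heq i (Finset.mem_range.1 hi)] at hsum
      exact add_left_cancel hsum
    · intro hlt
      rw [add_zero]
      exact hint c (by omega)
    · intro i hi hi'
      exact hint i (by omega)

/-- Two patterns agree in the rows `0, …, r - m`. -/
def AgreeAbove (m : ℕ) (t t' : GTPattern μ) : Prop := ∀ i ≤ r - m, ∀ j, t.a i j = t'.a i j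

theorem AgreeAbove.levelWeight_eq {m : ℕ} {t t' : GTPattern μ} (h : AgreeAbove m t t') :
    t.levelWeight m = t'.levelWeight m := by
  funext j
  rcases Nat.lt_or_ge m j with hj | hj
  · rcases Nat.lt_or_ge r j with hr | hr
    · rw [t.levelWeight_of_lt' hj hr, t'.levelWeight_of_lt' hj hr]
    · rw [t.levelWeight_of_lt hj hr, t'.levelWeight_of_lt hj hr]
      simp only [h (r - j) (by omega), h (r - j + 1) (by omega)]
  · rw [t.levelWeight_of_le hj, t'.levelWeight_of_le hj, h _ le_rfl]

theorem agreeAbove_iff {m : ℕ} (hm : m < r) {t t' : GTPattern μ} :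
    AgreeAbove m t t' ↔ AgreeAbove (m + 1) t t' ∧ t.levelWeight m = t'.levelWeight m := by
  constructor
  · intro h
    exact ⟨fun i hi ↦ h i (by omega), h.levelWeight_eq⟩
  · rintro ⟨h1, h2⟩ i hi j
    rcases hi.eq_or_lt with rfl | hi
    · by_cases hj : r - m ≤ j ∧ j ≤ r
      · have := congrFun h2 (r - j)
        rw [t.levelWeight_of_le (by omega), t'.levelWeight_of_le (by omega),
          show r - (r - j) = j by omega] at this
        omega
      · rw [t.zeros _ _ (by omega), t'.zeros _ _ (by omega)]
    · exact h1 i (by omega) j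

/-- A row interlacing with row `r - m - 1` of a pattern extends the upper part of this pattern. -/
theorem exists_levelWeight_eq (t : GTPattern μ) {m c : ℕ} (hm : m < r) (hc : c ≤ m + 1)
    {ν : ℕ → ℤ} (hν : ν ∈ rows (m + 1 - c) c 0 (t.levelWeight (m + 1))) :
    ∃ t' : GTPattern μ, AgreeAbove (m + 1) t' t ∧ t'.levelWeight m = ν := by
  rw [mem_rows] at hν
  obtain ⟨h1, h2, h3, h4⟩ := hν
  have hlw : ∀ q ≤ m + 1, t.levelWeight (m + 1) q = t.a (r - (m + 1)) (r - q) - q :=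
    fun q hq ↦ t.levelWeight_of_le hq
  have hrow : ∀ q ≤ m, t.a (r - (m + 1)) (r - q) ≤ t.a (r - (m + 1)) (r - (q + 1)) := by
    intro q hq
    have h5 := t.a_le_succ (i := r - (m + 1)) (p := r - q) (by omega)
    have h6 := t.a_succ_le (r - (m + 1)) (r - (q + 1))
    rw [show r - (q + 1) + 1 = r - q by omega] at h6
    exact h5.trans h6
  have hint : ∀ q ≤ m, (t.a (r - (m + 1)) (r - q) : ℤ) ≤ ν q + q ∧
      ν q + q ≤ t.a (r - (m + 1)) (r - (q + 1)) := by
    intro q hq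
    have h5 := hlw q (by omega)
    have h6 := hlw (q + 1) (by omega)
    have h7 := hrow q hq
    rcases Nat.lt_trichotomy q c with h | h | h
    · rw [h1 q (Or.inl h)]
      omega
    · subst h
      have := h3 (by omega)
      omega
    · have := h4 q h (by omega)
      omega
  -- Below row `r - m - 1` all rows are truncations of the single row prescribed by `ν`; it
  -- increases with `q` by the interlacing, so these rows interlace with each other.
  let a : ℕ → ℕ → ℕ := fun i j ↦ if i < r - m then t.a i j
    else if i ≤ j ∧ j ≤ r then (ν (r - j) + (r - j : ℕ)).toNat else 0
  have ha : ∀ i j, i < r - m → a i j = t.a i j := fun i j h ↦ if_pos h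
  have ha' : ∀ i q, r - m ≤ i → i ≤ r - q → q ≤ r → (a i (r - q) : ℤ) = ν q + q := by
    intro i q hi hq hqr
    have := (hint q (by omega)).1
    simp only [a]
    rw [if_neg (by omega), if_pos (by omega), show r - (r - q) = q by omega]
    omega
  let t' : GTPattern μ :=
    { a := a
      top := fun j ↦ by rw [ha _ _ (by omega)]; exact t.top j
      interleave := by
        intro i j hi hij hj
        rcases Nat.lt_or_ge i (r - m) with h | h
        · rw [ha _ _ h, ha _ _ (by omega), ha _ _ (by omega)]
          exact t.interleave i j hi hij hj
        · obtain ⟨q, rfl, hq⟩ : ∃ q, j = r - q ∧ q ≤ r := ⟨r - j, by omega, by omega⟩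
          have e1 := ha' i q h hij (by omega)
          have e2 := hint q (by omega)
          rcases h.eq_or_lt with rfl | h
          · rw [ha (r - m - 1) _ (by omega), ha (r - m - 1) _ (by omega), Nat.sub_sub, Nat.sub_sub]
            omega
          · have e3 := ha' (i - 1) q (by omega) (by omega) hq
            have e4 := ha' (i - 1) (q + 1) (by omega) (by omega) (by omega)
            have e5 := hint (q + 1) (by omega)
            rw [Nat.sub_sub r q 1]
            push_cast at e4
            omega
      zeros := by
        intro i j h
        simp only [a]
        split_ifs with h' h''
        · exact t.zeros i j h
        · omega
        · rfl }
  have hag : AgreeAbove (m + 1) t' t := fun i hi j ↦ ha i j (by omega)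
  refine ⟨t', hag, ?_⟩
  have ha'' : ∀ q ≤ m, (t'.a (r - m) (r - q) : ℤ) = ν q + q := fun q hq ↦
    ha' _ _ le_rfl (by omega) (by omega)
  funext j
  rcases Nat.lt_trichotomy j (m + 1) with hj | rfl | hj
  · rw [t'.levelWeight_of_le (by omega), ha'' j (by omega)]
    ring
  · have hsplit : ∀ κ : ℕ → ℤ, ∑ i ∈ Finset.range (m + 2), κ i =
        ∑ i ∈ Finset.range c, κ i + ∑ i ∈ Finset.range (m + 1 - c + 1), κ (c + i) := fun κ ↦ by
      rw [show m + 2 = c + (m + 1 - c + 1) by omega, Finset.sum_range_add]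
    have h5 : ∑ i ∈ Finset.range (m + 2), ν i =
        ∑ i ∈ Finset.range (m + 2), t.levelWeight (m + 1) i := by
      rw [hsplit, hsplit, h2,
        Finset.sum_congr rfl fun i hi ↦ h1 i (Or.inl (Finset.mem_range.1 hi))]
    rw [t'.levelWeight_of_lt (Nat.lt_succ_self m) hm, show r - (m + 1) + 1 = r - m by omega]
    have e1 : ∑ q ∈ Finset.range (m + 1), (t'.a (r - m) (r - q) : ℤ) =
        ∑ q ∈ Finset.range (m + 1), (ν q + q) :=
      Finset.sum_congr rfl fun q hq ↦ ha'' q (by rw [Finset.mem_range] at hq; omega)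
    have e2 : ∑ q ∈ Finset.range (m + 2), (t'.a (r - (m + 1)) (r - q) : ℤ) =
        ∑ q ∈ Finset.range (m + 2), (t.levelWeight (m + 1) q + q) := by
      refine Finset.sum_congr rfl fun q hq ↦ ?_
      rw [Finset.mem_range] at hq
      rw [hag _ le_rfl, hlw q (by omega)]
      ring
    rw [e1, e2, Finset.sum_add_distrib, Finset.sum_add_distrib, ← h5, Finset.sum_range_succ ν,
      Finset.sum_range_succ (fun i : ℕ ↦ (i : ℤ)) (m + 1)]
    ring
  · rw [h1 j (by omega), ← hag.levelWeight_eq]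
    rcases Nat.lt_or_ge r j with hr | hr
    · rw [t'.levelWeight_of_lt' (by omega) hr, t'.levelWeight_of_lt' (by omega) hr]
    · rw [t'.levelWeight_of_lt (by omega) hr, t'.levelWeight_of_lt (by omega) hr]

section Sums

variable {V : Type*} [AddCommGroup V] [Module ℂ V] (P : Parameters n) (ξ : (ℕ → ℤ) → V)

-- Group the patterns by row `r - m`, that is, by `levelWeight m`. Its possible values are the
-- `rows` of the nested sum, a representative for each exists by `exists_levelWeight_eq`, and each
-- fibre is a full set of patterns agreeing with this representative one row further down.
open Classical in
theorem sum_agreeAbove_succ {m c : ℕ} (hm : m < r) (hc : c ≤ m + 1)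
    (ih : ∀ t₀ : GTPattern μ, ∑ t with AgreeAbove m t t₀,
      (∏ i ∈ Finset.range m, t.rowFactor P i) • ξ (t.levelWeight 0) =
        iterSum P ξ m (t₀.levelWeight m))
    (t₀ : GTPattern μ) (hgap : ∀ q < c, 1 ≤ gap (t₀.levelWeight (m + 1)) q) :
    ∑ t with AgreeAbove (m + 1) t t₀ ∧ ∀ q < c, t.Gam (r - m) (r - q) = 0,
      (∏ i ∈ Finset.range (m + 1), t.rowFactor P i) • ξ (t.levelWeight 0) =
        nest P (iterSum P ξ m) (m + 1 - c) c 0 (t₀.levelWeight (m + 1)) := by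
  rw [nest_eq_sum_rows, ← Finset.sum_fiberwise_of_maps_to (g := fun t : GTPattern μ ↦ t.levelWeight m)
    (t := rows (m + 1 - c) c 0 (t₀.levelWeight (m + 1)))]
  · refine Finset.sum_congr rfl fun ν hν ↦ ?_
    obtain ⟨t₁, h1, rfl⟩ := t₀.exists_levelWeight_eq hm hc hν
    rw [← ih t₁, Finset.smul_sum]
    have hfil : ((Finset.univ.filter fun t : GTPattern μ ↦ AgreeAbove (m + 1) t t₀ ∧
        ∀ q < c, t.Gam (r - m) (r - q) = 0).filter fun t ↦ t.levelWeight m = t₁.levelWeight m) =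
        Finset.univ.filter fun t ↦ AgreeAbove m t t₁ := by
      ext t
      simp only [Finset.mem_filter, Finset.mem_univ, true_and, agreeAbove_iff hm]
      constructor
      · rintro ⟨⟨h2, _⟩, h3⟩
        exact ⟨fun i hi j ↦ (h2 i hi j).trans (h1 i hi j).symm, h3⟩
      · rintro ⟨h2, h3⟩
        have h4 : AgreeAbove (m + 1) t t₀ := fun i hi j ↦ (h2 i hi j).trans (h1 i hi j)
        refine ⟨⟨h4, ?_⟩, h3⟩
        rw [← t.levelWeight_mem_rows hm hc, h3, h4.levelWeight_eq]
        exact hν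
    rw [hfil]
    refine Finset.sum_congr rfl fun t ht ↦ ?_
    rw [Finset.mem_filter, agreeAbove_iff hm] at ht
    obtain ⟨_, h2, h3⟩ := ht
    have h4 : t.levelWeight (m + 1) = t₀.levelWeight (m + 1) :=
      h2.levelWeight_eq.trans h1.levelWeight_eq
    rw [Finset.prod_range_succ, mul_comm, mul_smul, t.rowFactor_eq_rowCoeff P hm hc, h3, h4]
    · rwa [h4]
    · rw [← t.levelWeight_mem_rows hm hc, h3, h4]
      exact hν
  · intro t ht
    rw [Finset.mem_filter] at ht
    rw [← ht.2.1.levelWeight_eq, t.levelWeight_mem_rows hm hc]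
    exact ht.2.2

open Classical in
theorem sum_agreeAbove {m : ℕ} (hm : m ≤ r) : ∀ t₀ : GTPattern μ, ∑ t with AgreeAbove m t t₀,
    (∏ i ∈ Finset.range m, t.rowFactor P i) • ξ (t.levelWeight 0) =
      iterSum P ξ m (t₀.levelWeight m) := by
  induction m with
  | zero =>
    intro t₀
    have : (Finset.univ.filter fun t : GTPattern μ ↦ AgreeAbove 0 t t₀) = {t₀} := by
      ext t
      simp only [Finset.mem_filter, Finset.mem_univ, true_and, Finset.mem_singleton]
      constructor
      · intro h
        ext i j hij hj
        exact h i (by omega) j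
      · rintro rfl _ _ _
        rfl
    rw [this, Finset.sum_singleton, Finset.range_zero, Finset.prod_empty, one_smul, iterSum]
  | succ m ih =>
    intro t₀
    have := sum_agreeAbove_succ P ξ (c := 0) hm (Nat.zero_le _) (ih (by omega)) t₀
      (fun q hq ↦ absurd hq (Nat.not_lt_zero q))
    rw [Nat.sub_zero] at this
    rw [iterSum, ← this]
    congr 1
    ext t
    simp

end Sums

end GTPattern

end

/-! ### The long element, the Demazure crystal as a set of patterns, and the conclusion. -/

section

variable {r n : ℕ}

/-! ### The long element -/

theorem cycleEl_apply_of_lt {m : ℕ} (hm : m < r) (k : ℕ) : ∀ j, j + k = m + 1 →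
    ∀ a : Fin (r + 1), j < (a : ℕ) → (a : ℕ) ≤ m + 1 →
      ((cycleEl m j : Weyl r) a : ℕ) = a - 1 := by
  induction k with
  | zero => intro j hj a h1 h2; omega
  | succ k ih =>
    intro j hj a h1 h2
    have hjr : j < r := by omega
    have e := cycleEl_of_le (j := (⟨j, hjr⟩ : Fin r)) (m := m) (by simp; omega)
    simp only at e
    rw [e, Equiv.Perm.mul_apply]
    by_cases ha : (a : ℕ) = j + 1
    · have h3 : a = (⟨j, hjr⟩ : Fin r).succ := Fin.ext ha
      rw [h3, simpleReflection, Equiv.swap_apply_right, cycleEl_apply_of_notMem hm (by omega)]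
      · rfl
      · left; exact Nat.lt_succ_self j
    · rw [simpleReflection, Equiv.swap_apply_of_ne_of_ne, ih (j + 1) (by omega) a (by omega) h2]
      · intro h; rw [h] at h1; exact absurd h1 (lt_irrefl _)
      · intro h; rw [h] at ha; exact ha rfl

theorem topEl_apply {m : ℕ} (hm : m ≤ r) : ∀ a : Fin (r + 1), (a : ℕ) ≤ m →
    ((topEl m : Weyl r) a : ℕ) = m - a := by
  induction m with
  | zero => intro a ha; rw [topEl, Equiv.Perm.one_apply]; omega
  | succ m ih =>
    intro a ha
    rw [topEl, Equiv.Perm.mul_apply]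
    rcases Nat.eq_zero_or_pos (a : ℕ) with h0 | h0
    · have h1 := cycleEl_apply_start (m := m) (by omega) (Nat.zero_le _) h0
      rw [mem_parabolic.1 (topEl_mem (by omega)) _ (by rw [h1]; omega), h1, h0, Nat.sub_zero]
    · have h1 := cycleEl_apply_of_lt (r := r) (m := m) (by omega) (m + 1) 0 (by omega) a h0 ha
      rw [ih (by omega) _ (by omega), h1]
      omega

theorem act_longElement (μ : Weight r) (j : Fin (r + 1)) :
    act (longElement r) μ j = μ ⟨r - j, by omega⟩ := by
  rw [act, longElement_eq]
  congr 1
  rw [Equiv.Perm.inv_eq_iff_eq, Fin.ext_iff, topEl_apply le_rfl _ (Nat.sub_le _ _)]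
  have := j.isLt
  simp only
  omega

/-! ### The sum over the crystal -/

namespace GTPattern

variable {μ : DominantEffectiveWeight r}

/-- The `k`-th coordinate is the difference of the sizes of the shapes of levels `k + 1` and `k`,
hence of the sums of two consecutive rows of the pattern. -/
theorem wt_toCrystal (t : GTPattern μ) (k : Fin (r + 1)) :
    t.toCrystal.wt k = t.levelWeight 0 k + k := by
  have key : ∀ k ≤ r + 1, ∑ p ∈ Finset.range (r + 1), (t.toChain.s k p : ℤ) =
      ∑ q ∈ Finset.range k, (t.a (r + 1 - k) (r - q) : ℤ) := by
    intro k hk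
    rw [← Finset.sum_range_reflect (fun q ↦ (t.a (r + 1 - k) (r - q) : ℤ)) k]
    refine (Finset.sum_subset_zero_on_sdiff (by
      intro p; simp only [Finset.mem_range]; omega) (fun p hp ↦ ?_) fun p hp ↦ ?_).symm
    · simp only [Finset.mem_sdiff, Finset.mem_range] at hp
      rw [t.toChain.eq_zero (by omega), Nat.cast_zero]
    · rw [Finset.mem_range] at hp
      change _ = (t.a (r + 1 - k) (r + 1 - k + p) : ℤ)
      congr 2
      omega
  have hk := k.isLt
  rw [toCrystal, ShapeChain.wt_toCrystal, Finset.sum_sub_distrib, key _ (by omega),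
    key _ (by omega), Nat.add_sub_add_right]
  rcases Nat.eq_zero_or_pos (k : ℕ) with h0 | h0
  · rw [h0, t.levelWeight_of_le le_rfl]
    simp
  · rw [t.levelWeight_of_lt h0 (by omega), show r + 1 - (k : ℕ) = r - k + 1 by omega]
    ring

/-- The pattern all of whose rows are parts of the top row. -/
def highest (μ : DominantEffectiveWeight r) : GTPattern μ where
  a i j := if i ≤ j then μ.diagram.rowLen j else 0
  top j := by
    rw [if_pos (Nat.zero_le _), μ.rowLen_diagram, Int.toNat_of_nonneg (μ.val_nonneg j)]
  interleave i j hi hij hj := by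
    rw [if_pos hij, if_pos (by omega), if_pos (by omega)]
    exact ⟨μ.diagram.rowLen_anti _ _ (Nat.sub_le _ _), le_rfl⟩
  zeros i j h := by
    split_ifs with hij
    · exact μ.rowLen_diagram_of_lt (by omega)
    · rfl

theorem highest_a {i j : ℕ} (h : i ≤ j) : (highest μ).a i j = μ.diagram.rowLen j := if_pos h

/-- The value does not depend on `m`: for `μ = λ + ρ` this pattern has weight `w₀λ` at every level,
and can serve as the starting pattern of the recursion at any row. -/
theorem levelWeight_highest {m j : ℕ} (hj : j ≤ r) :
    (highest μ).levelWeight m j = μ.diagram.rowLen (r - j) - j := by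
  rcases Nat.lt_or_ge m j with h | h
  · have e : ∑ q ∈ Finset.range j, ((highest μ).a (r - j) (r - q) : ℤ) =
        ∑ q ∈ Finset.range j, ((highest μ).a (r - j + 1) (r - q) : ℤ) := by
      refine Finset.sum_congr rfl fun q hq ↦ ?_
      rw [Finset.mem_range] at hq
      rw [highest_a (by omega), highest_a (by omega)]
    rw [levelWeight_of_lt _ h hj, Finset.sum_range_succ, e, highest_a le_rfl]
    ring
  · rw [levelWeight_of_le _ h, highest_a (by omega)]

/-- Vanishing of a whole `Γ`-row forces that row to repeat the entries of the row above. The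
Demazure condition on the later blocks therefore fixes the top part of the pattern. -/
theorem agreeAbove_highest_iff {t : GTPattern μ} {m : ℕ} :
    AgreeAbove (m + 1) t (highest μ) ↔
      ∀ m', m < m' → m' < r → ∀ q ≤ m', t.Gam (r - m') (r - q) = 0 := by
  constructor
  · intro h m' h1 h2 q hq
    refine Finset.sum_eq_zero fun k hk ↦ ?_
    rw [Finset.mem_Icc] at hk
    rw [h _ (by omega), h _ (by omega), highest_a (by omega), highest_a (by omega), sub_self]
  · intro h i
    induction i with
    | zero => intro _ j; rw [t.a_zero, highest_a (Nat.zero_le j)]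
    | succ i ih =>
      intro hi j
      by_cases hj : i + 1 ≤ j ∧ j ≤ r
      · have h1 : ∀ j, i + 1 ≤ j → j ≤ r → t.Gam (i + 1) j = 0 := by
          intro j hj hj'
          have := h (r - (i + 1)) (by omega) (by omega) (r - j) (by omega)
          rwa [show r - (r - (i + 1)) = i + 1 by omega, show r - (r - j) = j by omega] at this
        have h2 : t.Gam (i + 1) (j + 1) = 0 := by
          rcases Nat.lt_or_ge j r with h3 | h3
          · exact h1 _ (by omega) h3
          · rw [Gam, Finset.Icc_eq_empty (by omega), Finset.sum_empty]
        have h3 := t.gam_eq_add (i + 1) hj.2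
        rw [h1 j hj.1 hj.2, h2, Nat.add_sub_cancel, ih (by omega) j, highest_a (by omega)] at h3
        rw [highest_a hj.1]
        omega
      · rw [t.zeros _ _ (by omega), (highest μ).zeros _ _ (by omega)]

end GTPattern

variable (lam : DominantEffectiveWeight r)

theorem rowLen_addRho {j : ℕ} (hj : j ≤ r) :
    (lam.addRho.diagram.rowLen (r - j) : ℤ) = lam.val ⟨r - j, by omega⟩ + j := by
  have h1 := lam.addRho.rowLen_diagram ⟨r - j, by omega⟩
  have h2 := lam.addRho.val_nonneg ⟨r - j, by omega⟩
  have h3 : lam.addRho.val ⟨r - j, by omega⟩ = lam.val ⟨r - j, by omega⟩ + j := by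
    simp only [DominantEffectiveWeight.addRho, Pi.add_apply, rho]
    omega
  simp only at h1
  omega

theorem natMono_levelWeight_highest (m : ℕ) :
    ((natMono r ((GTPattern.highest lam.addRho).levelWeight m) : laurent r) : RatFun r) =
      xpow (act (longElement r) lam.val) := by
  change xpow _ = _
  congr 1
  funext j
  have hj : (j : ℕ) ≤ r := by omega
  rw [act_longElement, GTPattern.levelWeight_highest hj, rowLen_addRho lam hj, add_sub_cancel_right]

theorem one_le_gap_highest {m q : ℕ} (hq : q < m) (hm : m ≤ r) :
    1 ≤ gap ((GTPattern.highest lam.addRho).levelWeight m) q := by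
  have h1 := lam.dominant (show (⟨r - (q + 1), by omega⟩ : Fin (r + 1)) ≤ ⟨r - q, by omega⟩ by
    rw [Fin.mk_le_mk]; omega)
  rw [gap, GTPattern.levelWeight_highest (by omega), GTPattern.levelWeight_highest (by omega),
    rowLen_addRho lam (by omega), rowLen_addRho lam (by omega)]
  omega

open Classical in
/-- The right-hand side as a sum over patterns. -/
theorem sum_demazureCrystal (P : Parameters n) (w : Weyl r) :
    xpow (-act (longElement r) (rho r)) *
        ∑ b ∈ demazureCrystal lam.addRho w, algebraMap ℂ (RatFun r) (gtCoeff P b) * xpow b.wt =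
      ((∑ t : GTPattern lam.addRho with t.toCrystal ∈ demazureCrystal lam.addRho w,
        t.coeff P • natMono r (t.levelWeight 0) : laurent r) : RatFun r) := by
  rw [Finset.mul_sum, Submodule.coe_sum]
  symm
  refine Finset.sum_bij (fun t _ ↦ t.toCrystal) ?_ ?_ ?_ ?_
  · intro t ht
    exact (Finset.mem_filter.1 ht).2
  · intro t _ t' _ h
    exact GTPattern.toCrystal_bijective.1 h
  · intro b hb
    obtain ⟨t, rfl⟩ := GTPattern.toCrystal_bijective.2 b
    exact ⟨t, Finset.mem_filter.2 ⟨Finset.mem_univ _, hb⟩, rfl⟩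
  · intro t _
    rw [GTPattern.gtCoeff_toCrystal, mul_left_comm, ← xpow_add, Submodule.coe_smul,
      Algebra.smul_def]
    congr 1
    change xpow _ = _
    congr 1
    funext j
    have hj := j.isLt
    rw [Pi.add_apply, Pi.neg_apply, act_longElement, t.wt_toCrystal, rho]
    simp only
    omega

theorem coeff_of_agreeAbove (P : Parameters n) {m : ℕ} (hm : m < r) {t : GTPattern lam.addRho}
    (h : GTPattern.AgreeAbove (m + 1) t (GTPattern.highest lam.addRho)) :
    t.coeff P = ∏ i ∈ Finset.range (m + 1), t.rowFactor P i := by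
  rw [t.coeff_eq_prod]
  refine (Finset.prod_subset (by
    intro i; simp only [Finset.mem_range]; omega) fun i hi hi' ↦ ?_).symm
  rw [Finset.mem_range] at hi hi'
  have h' : GTPattern.AgreeAbove (i + 1) t (GTPattern.highest lam.addRho) :=
    fun k hk ↦ h k (by omega)
  -- With `c = i + 1` the nested sum has no columns left, so a row forced to agree with the highest
  -- pattern contributes the factor `1`.
  rw [t.rowFactor_eq_rowCoeff P hi le_rfl, Nat.sub_self, rowCoeff]
  · intro q hq
    rw [h'.levelWeight_eq]
    exact one_le_gap_highest lam hq hi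
  · exact fun q hq ↦ GTPattern.agreeAbove_highest_iff.1 h i (by omega) hi q (by omega)

theorem sum_bruhatInterval_of_pos [NeZero n] (P : Parameters n) (hr : 0 < r) {w : Weyl r}
    (hw : IsBeginningSection w) :
    (∑ u ∈ bruhatInterval w, demazureLusztig P u) (xpow (act (longElement r) lam.val)) =
      xpow (-act (longElement r) (rho r)) *
        ∑ b ∈ demazureCrystal lam.addRho w,
          algebraMap ℂ (RatFun r) (gtCoeff P b) * xpow b.wt := by
  classical
  obtain ⟨m, c, hm, hc, rfl⟩ := exists_beginningSection hr hw
  rw [sum_demazureCrystal, ← natMono_levelWeight_highest lam (m + 1),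
    sum_bruhatInterval_natMono P hm hc fun i hi ↦ one_le_gap_highest lam (by omega) hm,
    ← GTPattern.sum_agreeAbove_succ P (natMono r) hm hc (GTPattern.sum_agreeAbove P _ hm.le) _
      fun q hq ↦ one_le_gap_highest lam (by omega) hm]
  congr 1
  refine Finset.sum_congr ?_ fun t ht ↦ ?_
  · ext t
    rw [Finset.mem_filter, Finset.mem_filter, t.toCrystal_mem_demazureCrystal hm hc,
      GTPattern.agreeAbove_highest_iff, and_comm (a := ∀ m', _)]
  · rw [Finset.mem_filter] at ht
    rw [coeff_of_agreeAbove lam P hm]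
    rw [GTPattern.agreeAbove_highest_iff]
    exact ((t.toCrystal_mem_demazureCrystal hm hc).1 ht.2).2

/-- In rank zero there is no index `m < r` for the factorization of `w`, but the group, the long
word and the set of patterns are all trivial. -/
theorem sum_bruhatInterval_rank_zero [NeZero n] (P : Parameters n)
    (lam : DominantEffectiveWeight 0) (w : Weyl 0) :
    (∑ u ∈ bruhatInterval w, demazureLusztig P u) (xpow (act (longElement 0) lam.val)) =
      xpow (-act (longElement 0) (rho 0)) *
        ∑ b ∈ demazureCrystal lam.addRho w,
          algebraMap ℂ (RatFun 0) (gtCoeff P b) * xpow b.wt := by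
  classical
  have : Subsingleton (Weyl 0) := inferInstanceAs (Subsingleton (Equiv.Perm (Fin 1)))
  have h1 : bruhatInterval w = {w} := by
    ext u
    rw [Subsingleton.elim u w, bruhatInterval, Finset.mem_filter, Finset.mem_singleton]
    exact ⟨fun _ ↦ rfl, fun _ ↦ ⟨Finset.mem_univ _, Relation.ReflTransGen.refl⟩⟩
  have h2 : demazureLusztig P w = 1 := by
    rw [demazureLusztig, Subsingleton.elim (reducedWord w) [], List.map_nil, List.prod_nil]
  have h3 : (Finset.univ.filter fun t : GTPattern lam.addRho ↦
      t.toCrystal ∈ demazureCrystal lam.addRho w) =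
      Finset.univ.filter fun t ↦ GTPattern.AgreeAbove 0 t (GTPattern.highest lam.addRho) := by
    ext t
    simp only [Finset.mem_filter, Finset.mem_univ, true_and]
    refine ⟨fun _ i hi j ↦ ?_, fun _ ↦ ?_⟩
    · obtain rfl : i = 0 := by omega
      rw [t.a_zero, GTPattern.highest_a (Nat.zero_le j)]
    · rw [demazureCrystal, Finset.mem_filter]
      refine ⟨Finset.mem_univ _, fun a ha ↦ ?_⟩
      rw [Crystal.bzl, longWord, Crystal.path, List.drop_nil] at ha
      exact absurd ha List.not_mem_nil
  have h4 := GTPattern.sum_agreeAbove P (natMono 0) (le_refl 0) (GTPattern.highest lam.addRho)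
  rw [sum_demazureCrystal, h1, Finset.sum_singleton, h2, Module.End.one_apply, h3,
    ← natMono_levelWeight_highest lam 0]
  congr 1
  rw [iterSum] at h4
  rw [← h4]
  refine Finset.sum_congr rfl fun t _ ↦ ?_
  rw [t.coeff_eq_prod]

end

end Metaplectic

end

theorem theorem2p1 {n r : ℕ} [NeZero n] (P : Parameters n) (lam : DominantEffectiveWeight r)
    (w : Weyl r) (hw : IsBeginningSection w) :
    (∑ u ∈ bruhatInterval w, demazureLusztig P u) (xpow (act (longElement r) lam.val)) =
      xpow (-act (longElement r) (rho r)) *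
        ∑ b ∈ demazureCrystal lam.addRho w,
          algebraMap ℂ (RatFun r) (gtCoeff P b) * xpow b.wt := by
  rcases Nat.eq_zero_or_pos r with rfl | hr
  · exact sum_bruhatInterval_rank_zero P lam w
  · exact sum_bruhatInterval_of_pos lam P hr hw
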